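/- Let $\mathcal C$ be a small category. Let $\mathcal I^0$ be a left ideal of $\mathcal C$ (a collection of morphisms such that $f\in\mathcal I^0$ implies $gf\in\mathcal I^0$ whenever $gf$ is defined) and $\mathcal I^1$ a right ideal (a collection of morphisms such that $f\in\mathcal I^1$ implies $fg\in\mathcal I^1$ whenever $fg$ is defined). The Brauer category with inner endpoints $\mathcal B=\mathcal B(\mathcal C,\mathcal I^0,\mathcal I^1)$ is defined as follows. Its objects are the finite sequences of signed objects $X^{\pm}$, $X\in\mathsf{Ob}(\mathcal C)$. A diagram from a sequence $S$ (bottom) to a sequence $T$ (top) is a compact oriented one-manifold (a finite disjoint union of intervals and circles), cut by finitely many vertices into oriented edges, each circle carrying at least one vertex. Vertices are labelled by objects of $\mathcal C$, and each edge by a morphism of $\mathcal C$ from the label of its initial vertex to the label of its final vertex. The terms of $S$ and $T$ are endpoints of intervals, with the given labels; strands start at the terms $X^+$ of $S$ and $X^-$ of $T$, and end at the terms $X^-$ of $S$ and $X^+$ of $T$. Any other endpoint of an interval is an inner endpoint: the edge that starts at an inner endpoint is labelled by an element of $\mathcal I^0$, and the edge that ends at an inner endpoint by an element of $\mathcal I^1$.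 Morphisms $S\to T$ in $\mathcal B$ are the equivalence classes of diagrams, for the equivalence relation generated by isomorphism of diagrams and by erasing a vertex at which an edge labelled $\beta$ ends and a different edge labelled $\gamma$ starts, these two edges being replaced by one edge labelled $\gamma\beta$. Composition is given by gluing diagrams; the tensor product by concatenating sequences and juxtaposing diagrams; the unit object $\mathbf 1$ is the empty sequence. Then: 1. $\mathcal B$, with these operations, is a strict monoidal category. It is symmetric, with symmetry $S\otimes T\to T\otimes S$ given by identity-labelled strands that move $S$ past $T$, and it is rigid: the dual of $S$ is the reversed sequence with all signs changed, with coevaluation and evaluation given by identity-labelled nested cups and caps. 2. $\mathcal B$ contains $\mathcal C$ as a subcategory: sending $X$ to $X^+$ and $\beta\colon X\to Y$ to the strand $X^+\to Y^+$ labelled by $\beta$ defines a faithful functor $\mathcal C\to\mathcal B$ that is injective on objects. 3. Let $L(\mathcal C)$ be the set of loops of $\mathcal C$, that is, of pairs $(X,\beta)$ with $\beta\in\mathsf{End}_{\mathcal C}(X)$ modulo the equivalence relation generated by $(X,\gamma\beta)\sim(Y,\beta\gamma)$ for all $\beta\colon X\to Y$ and $\gamma\colon Y\to X$. The monoid $\mathsf{End}_{\mathcal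 B}(\mathbf 1)$ is the free commutative monoid on the disjoint union $L(\mathcal C)\sqcup(\mathcal I^0\cap\mathcal I^1)$; the generator of a loop $(X,\beta)$ is the circle with one vertex $X$ and one edge $\beta$, and the generator of $f\in\mathcal I^0\cap\mathcal I^1$ is the floating interval with one edge $f$. -/

import Mathlib

open CategoryTheory MonoidalCategory

universe u v

/-! # The Brauer category of a small category, with inner endpoints

Composition is written in diagrammatic order: `f ≫ g` is the composition usually written `g f`. -/

/-- A left ideal: a collection of morphisms closed under `f ↦ g f`. -/
structure LeftIdeal (C : Type u) [Category.{v} C] where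
  /-- the morphisms of the ideal -/
  mem : MorphismProperty C
  comp_mem : ∀ {X Y Z : C} (f : X ⟶ Y) (g : Y ⟶ Z), mem f → mem (f ≫ g)

/-- A right ideal: a collection of morphisms closed under `f ↦ f g`. -/
structure RightIdeal (C : Type u) [Category.{v} C] where
  /-- the morphisms of the ideal -/
  mem : MorphismProperty C
  comp_mem : ∀ {X Y Z : C} (g : X ⟶ Y) (f : Y ⟶ Z), mem f → mem (g ≫ f)

/-- `(X, γβ) ∼ (Y, βγ)` for `β : X ⟶ Y` and `γ : Y ⟶ X`. -/
inductive LoopRel (C : Type u) [Category.{v} C] : (Σ X : C, X ⟶ X) → (Σ X : C, X ⟶ X) → Prop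
  | rotate {X Y : C} (β : X ⟶ Y) (γ : Y ⟶ X) : LoopRel C ⟨X, β ≫ γ⟩ ⟨Y, γ ≫ β⟩

/-- The set `L(C)` of loops in `C`: endomorphisms modulo the equivalence relation
generated by `LoopRel`. -/
def LoopSet (C : Type u) [Category.{v} C] : Type (max u v) := Quot (LoopRel C)

/-- The set of morphisms of `C` that lie in both ideals. -/
def IdealInter {C : Type u} [Category.{v} C] (I₀ : LeftIdeal C) (I₁ : RightIdeal C) :
    Type (max u v) := {f : Arrow C // I₀.mem f.hom ∧ I₁.mem f.hom}

/-- The objects of the Brauer category: finite sequences of signed objects `(X, ε)`, where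
`true` is the sign `+` and `false` is the sign `-`. -/
def BrauerCat {C : Type u} [Category.{v} C] (_I₀ : LeftIdeal C) (_I₁ : RightIdeal C) : Type u :=
  List (C × Bool)

namespace BrauerCat

/-! ## Boundary points -/

section Boundary

variable {C : Type u}

/-- The boundary points of a cobordism from `S` (at the bottom) to `T` (at the top). -/
abbrev Bd (S T : List (C × Bool)) : Type := Fin S.length ⊕ Fin T.length

/-- The object that labels a boundary point. -/
def Bd.ob {S T : List (C × Bool)} (b : Bd S T) : C :=
  Sum.elim (fun i => (S.get i).1) (fun j => (T.get j).1) b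

/-- Whether the strand at a boundary point starts there (`true`) or ends there (`false`):
it starts at a point of sign `+` at the bottom and at a point of sign `-` at the top. -/
def Bd.starts {S T : List (C × Bool)} (b : Bd S T) : Bool :=
  Sum.elim (fun i => (S.get i).2) (fun j => !(T.get j).2) b

/-- The positions in a concatenation of two sequences. -/
def pos (S T : List (C × Bool)) : Fin S.length ⊕ Fin T.length ≃ Fin (S ++ T).length :=
  finSumFinEquiv.trans (finCongr List.length_append.symm)

theorem get_pos_inl (S T : List (C × Bool)) (i : Fin S.length) :
    (S ++ T).get (pos S T (Sum.inl i)) = S.get i := by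
  simp [pos]

theorem get_pos_inr (S T : List (C × Bool)) (j : Fin T.length) :
    (S ++ T).get (pos S T (Sum.inr j)) = T.get j := by
  simp [pos]

/-- The dual sequence: reversed, with all signs changed. -/
def dualSeq (S : List (C × Bool)) : List (C × Bool) :=
  (S.map fun x => (x.1, !x.2)).reverse

/-- The position in the dual sequence that corresponds to a position in the sequence. -/
def dualPos (S : List (C × Bool)) : Fin S.length ≃ Fin (dualSeq S).length :=
  Fin.revPerm.trans (finCongr (by simp [dualSeq]))

theorem get_dualPos (S : List (C × Bool)) (i : Fin S.length) :
    (dualSeq S).get (dualPos S i) = ((S.get i).1, !(S.get i).2) := by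
  have h : S.length - 1 - (S.length - (i.1 + 1)) = i.1 := by omega
  have hlt : S.length - (i.1 + 1) < (dualSeq S).length := (dualPos S i).2
  change (dualSeq S)[S.length - (i.1 + 1)] = _
  simp [dualSeq, h]

variable {S T U S' T' : List (C × Bool)}

/-- The vertices of the lower diagram in the glued diagram. -/
def lower {A B : Type} : A ⊕ Bd S T → ((A ⊕ B) ⊕ Fin T.length) ⊕ Bd S U
  | Sum.inl v => Sum.inl (Sum.inl (Sum.inl v))
  | Sum.inr (Sum.inl s) => Sum.inr (Sum.inl s)
  | Sum.inr (Sum.inr t) => Sum.inl (Sum.inr t)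

/-- The vertices of the upper diagram in the glued diagram. -/
def upper {A B : Type} : B ⊕ Bd T U → ((A ⊕ B) ⊕ Fin T.length) ⊕ Bd S U
  | Sum.inl v => Sum.inl (Sum.inl (Sum.inr v))
  | Sum.inr (Sum.inl t) => Sum.inl (Sum.inr t)
  | Sum.inr (Sum.inr r) => Sum.inr (Sum.inr r)

theorem lower_inj {A B : Type} :
    Function.Injective (lower : A ⊕ Bd S T → ((A ⊕ B) ⊕ Fin T.length) ⊕ Bd S U) := by
  rintro (a | a | a) (b | b | b) h <;> simp_all [lower]

theorem upper_inj {A B : Type} :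
    Function.Injective (upper : B ⊕ Bd T U → ((A ⊕ B) ⊕ Fin T.length) ⊕ Bd S U) := by
  rintro (a | a | a) (b | b | b) h <;> simp_all [upper]

theorem lower_map {A A' B : Type} (j : A → A') (x : A ⊕ Bd S T) :
    (lower (Sum.map j id x) : ((A' ⊕ B) ⊕ Fin T.length) ⊕ Bd S U) =
      Sum.map (Sum.map (Sum.map j id) id) id (lower x) := by
  rcases x with a | a | a <;> rfl

theorem upper_map {A B B' : Type} (j : B → B') (x : B ⊕ Bd T U) :
    (upper (Sum.map j id x) : ((A ⊕ B') ⊕ Fin T.length) ⊕ Bd S U) =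
      Sum.map (Sum.map (Sum.map id j) id) id (upper x) := by
  rcases x with a | a | a <;> rfl

theorem upper_map' {A A' B : Type} (j : A → A') (x : B ⊕ Bd T U) :
    (upper x : ((A' ⊕ B) ⊕ Fin T.length) ⊕ Bd S U) =
      Sum.map (Sum.map (Sum.map j id) id) id (upper x) := by
  rcases x with a | a | a <;> rfl

theorem lower_map' {A B B' : Type} (j : B → B') (x : A ⊕ Bd S T) :
    (lower x : ((A ⊕ B') ⊕ Fin T.length) ⊕ Bd S U) =
      Sum.map (Sum.map (Sum.map id j) id) id (lower x) := by
  rcases x with a | a | a <;> rfl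

/-- The boundary points of two diagrams in their juxtaposition. -/
def sideBd (S T S' T' : List (C × Bool)) : Bd S T ⊕ Bd S' T' ≃ Bd (S ++ S') (T ++ T') :=
  (Equiv.sumSumSumComm _ _ _ _).trans ((pos S S').sumCongr (pos T T'))

theorem ob_sideBd (b : Bd S T ⊕ Bd S' T') :
    (sideBd S T S' T' b).ob = Sum.elim Bd.ob Bd.ob b := by
  rcases b with (b | b) | (b | b)
  · exact congrArg Prod.fst (get_pos_inl S S' b)
  · exact congrArg Prod.fst (get_pos_inl T T' b)
  · exact congrArg Prod.fst (get_pos_inr S S' b)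
  · exact congrArg Prod.fst (get_pos_inr T T' b)

theorem starts_sideBd (b : Bd S T ⊕ Bd S' T') :
    (sideBd S T S' T' b).starts = Sum.elim Bd.starts Bd.starts b := by
  rcases b with (b | b) | (b | b)
  · exact congrArg Prod.snd (get_pos_inl S S' b)
  · exact congrArg (fun x => !x.2) (get_pos_inl T T' b)
  · exact congrArg Prod.snd (get_pos_inr S S' b)
  · exact congrArg (fun x => !x.2) (get_pos_inr T T' b)

/-- The vertices of two diagrams in their juxtaposition. -/
def sidePt (A B : Type) (S T S' T' : List (C × Bool)) :
    (A ⊕ Bd S T) ⊕ (B ⊕ Bd S' T') ≃ (A ⊕ B) ⊕ Bd (S ++ S') (T ++ T') :=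
  (Equiv.sumSumSumComm _ _ _ _).trans ((Equiv.refl _).sumCongr (sideBd S T S' T'))

theorem sidePt_map {A B A' B' : Type} (i : A → A') (j : B → B')
    (x : (A ⊕ Bd S T) ⊕ (B ⊕ Bd S' T')) :
    sidePt A' B' S T S' T' (Sum.map (Sum.map i id) (Sum.map j id) x) =
      Sum.map (Sum.map i j) id (sidePt A B S T S' T' x) := by
  rcases x with (x | x) | (x | x) <;> rfl

theorem sidePt_inl_eq {A B : Type} (x : A ⊕ Bd S T) (v : A) :
    sidePt A B S T S' T' (Sum.inl x) = Sum.inl (Sum.inl v) ↔ x = Sum.inl v := by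
  rcases x with x | x <;> simp [sidePt]

theorem sidePt_inr_eq {A B : Type} (x : B ⊕ Bd S' T') (v : B) :
    sidePt A B S T S' T' (Sum.inr x) = Sum.inl (Sum.inr v) ↔ x = Sum.inl v := by
  rcases x with x | x <;> simp [sidePt]

theorem sidePt_inl_ne {A B : Type} (x : A ⊕ Bd S T) (v : B) :
    sidePt A B S T S' T' (Sum.inl x) ≠ Sum.inl (Sum.inr v) := by
  rcases x with x | x <;> simp [sidePt]

theorem sidePt_inr_ne {A B : Type} (x : B ⊕ Bd S' T') (v : A) :
    sidePt A B S T S' T' (Sum.inr x) ≠ Sum.inl (Sum.inl v) := by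
  rcases x with x | x <;> simp [sidePt]

theorem exists_sidePt_bd {A B E E' : Type} (f : E → A ⊕ Bd S T) (f' : E' → B ⊕ Bd S' T')
    (b : Bd S T ⊕ Bd S' T') :
    (∃ e, sidePt A B S T S' T' (Sum.map f f' e) = Sum.inr (sideBd S T S' T' b)) ↔
      Sum.elim (fun b => ∃ e, f e = Sum.inr b) (fun b => ∃ e, f' e = Sum.inr b) b := by
  have h : ∀ x, sidePt A B S T S' T' x = Sum.inr (sideBd S T S' T' b) ↔
      x = Sum.elim (fun b => Sum.inl (Sum.inr b)) (fun b => Sum.inr (Sum.inr b)) b := by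
    intro x
    rw [← (sidePt A B S T S' T').injective.eq_iff]
    rcases b with b | b <;> rfl
  simp only [h]
  rcases b with b | b <;> simp

theorem range_map_left {A A' B : Type} {j : A → A'} {v : A'} (h : Set.range j = {v}ᶜ) :
    Set.range (Sum.map j id : A ⊕ B → A' ⊕ B) = {Sum.inl v}ᶜ := by
  ext (a | a)
  · have := Set.ext_iff.1 h a
    simpa using this
  · simp

theorem range_map_right {A B B' : Type} {j : B → B'} {v : B'} (h : Set.range j = {v}ᶜ) :
    Set.range (Sum.map id j : A ⊕ B → A ⊕ B') = {Sum.inr v}ᶜ := by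
  ext (a | a)
  · simp
  · have := Set.ext_iff.1 h a
    simpa using this

end Boundary

variable {C : Type u} [Category.{v} C] {I₀ : LeftIdeal C} {I₁ : RightIdeal C}

/-! ## Diagrams -/

/-- A diagram from `S` to `T`: a compact oriented one-manifold (a finite disjoint union of
intervals and circles), cut by finitely many vertices into oriented edges. The vertices are the
boundary points, given by `S` and `T`, and the vertices in the interior of the cobordism.
They are labelled by objects of `C`, and the edges by morphisms of `C`. An interval may end in
the interior of the cobordism: there it starts with an edge labelled by an element of `I₀`, or
ends with an edge labelled by an element of `I₁`. -/
structure Diagram (I₀ : LeftIdeal C) (I₁ : RightIdeal C) (S T : List (C × Bool)) where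
  /-- the vertices that are not boundary points -/
  V : Type
  /-- the edges -/
  E : Type
  finite_V : Finite V
  finite_E : Finite E
  /-- the labels of the vertices `V` -/
  vlab : V → C
  /-- the vertex where an edge starts -/
  src : E → V ⊕ Bd S T
  /-- the vertex where an edge ends -/
  tgt : E → V ⊕ Bd S T
  /-- the label of an edge -/
  lab : E → Arrow C
  lab_left : ∀ e, (lab e).left = Sum.elim vlab Bd.ob (src e)
  lab_right : ∀ e, (lab e).right = Sum.elim vlab Bd.ob (tgt e)
  /-- at most one edge starts at each vertex -/
  src_inj : Function.Injective src
  /-- at most one edge ends at each vertex -/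
  tgt_inj : Function.Injective tgt
  bd_src : ∀ b : Bd S T, (∃ e, src e = Sum.inr b) ↔ b.starts = true
  bd_tgt : ∀ b : Bd S T, (∃ e, tgt e = Sum.inr b) ↔ b.starts = false
  /-- there are no isolated vertices -/
  not_isolated : ∀ v : V, (∃ e, src e = Sum.inl v) ∨ (∃ e, tgt e = Sum.inl v)
  /-- the label at an inner endpoint where an interval starts -/
  start_mem : ∀ (e : E) (v : V), src e = Sum.inl v → (∀ e', tgt e' ≠ Sum.inl v) →
    I₀.mem (lab e).hom
  /-- the label at an inner endpoint where an interval ends -/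
  end_mem : ∀ (e : E) (v : V), tgt e = Sum.inl v → (∀ e', src e' ≠ Sum.inl v) →
    I₁.mem (lab e).hom

namespace Diagram

variable {S T U S' T' : List (C × Bool)}

/-- `D` and `D'` are isomorphic as decorated one-manifolds with boundary. -/
def Iso (D D' : Diagram I₀ I₁ S T) : Prop :=
  ∃ (j : D.V ≃ D'.V) (k : D.E ≃ D'.E),
    (∀ v, D'.vlab (j v) = D.vlab v) ∧
    (∀ e, D'.src (k e) = Sum.map j id (D.src e)) ∧
    (∀ e, D'.tgt (k e) = Sum.map j id (D.tgt e)) ∧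
    (∀ e, D'.lab (k e) = D.lab e)

/-- `D'` is obtained from `D` by erasing a vertex `v` at which an edge `e` ends and another
edge `g` starts: the edges `e` and `g` are replaced by a single one (called `e'` in `D'`), which is
labelled by the composition of the labels of `e` and `g`. The maps `j` and `k` identify the
vertices of `D'` with the vertices of `D` other than `v`, and the edges of `D'` with the edges of
`D` other than `g`. -/
def Erase (D D' : Diagram I₀ I₁ S T) : Prop :=
  ∃ (v : D.V) (e g : D.E) (j : D'.V → D.V) (k : D'.E → D.E) (e' : D'.E),
    D.tgt e = Sum.inl v ∧ D.src g = Sum.inl v ∧ k e' = e ∧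
    Function.Injective j ∧ Set.range j = {v}ᶜ ∧
    Function.Injective k ∧ Set.range k = {g}ᶜ ∧
    (∀ w, D.vlab (j w) = D'.vlab w) ∧
    (∀ a, D.src (k a) = Sum.map j id (D'.src a)) ∧
    (∀ a, a ≠ e' → D.tgt (k a) = Sum.map j id (D'.tgt a)) ∧
    D.tgt g = Sum.map j id (D'.tgt e') ∧
    (∀ a, a ≠ e' → D.lab (k a) = D'.lab a) ∧
    ∃ (X Y Z : C) (β : X ⟶ Y) (γ : Y ⟶ Z),
      D.lab e = Arrow.mk β ∧ D.lab g = Arrow.mk γ ∧ D'.lab e' = Arrow.mk (β ≫ γ)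

/-- The relation that generates the equivalence of diagrams. -/
inductive Rel : Diagram I₀ I₁ S T → Diagram I₀ I₁ S T → Prop
  | iso {D D' : Diagram I₀ I₁ S T} : Iso D D' → Rel D D'
  | erase {D D' : Diagram I₀ I₁ S T} : Erase D D' → Rel D D'

/-! ### Gluing -/

/-- The diagram obtained by putting `D'` on top of `D`. The points of `T` become vertices in the
interior of the cobordism. -/
def glue (D : Diagram I₀ I₁ S T) (D' : Diagram I₀ I₁ T U) : Diagram I₀ I₁ S U where
  V := (D.V ⊕ D'.V) ⊕ Fin T.length
  E := D.E ⊕ D'.E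
  finite_V := by have := D.finite_V; have := D'.finite_V; infer_instance
  finite_E := by have := D.finite_E; have := D'.finite_E; infer_instance
  vlab := Sum.elim (Sum.elim D.vlab D'.vlab) (fun t => (T.get t).1)
  src := Sum.elim (fun e => lower (D.src e)) (fun e => upper (D'.src e))
  tgt := Sum.elim (fun e => lower (D.tgt e)) (fun e => upper (D'.tgt e))
  lab := Sum.elim D.lab D'.lab
  lab_left := by
    rintro (e | e)
    · have := D.lab_left e
      rcases h : D.src e with a | a | a <;> simp_all [lower, Bd.ob]
    · have := D'.lab_left e
      rcases h : D'.src e with a | a | a <;> simp_all [upper, Bd.ob]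
  lab_right := by
    rintro (e | e)
    · have := D.lab_right e
      rcases h : D.tgt e with a | a | a <;> simp_all [lower, Bd.ob]
    · have := D'.lab_right e
      rcases h : D'.tgt e with a | a | a <;> simp_all [upper, Bd.ob]
  src_inj := by
    have key : ∀ (e : D.E) (e' : D'.E), lower (D.src e) ≠
        (upper (D'.src e') : ((D.V ⊕ D'.V) ⊕ Fin T.length) ⊕ Bd S U) := by
      intro e e' h
      rcases h1 : D.src e with a | a | a <;> rcases h2 : D'.src e' with b | b | b <;>
        simp [h1, h2, lower, upper] at h
      subst h
      have h3 := (D.bd_src _).1 ⟨e, h1⟩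
      have h4 := (D'.bd_src _).1 ⟨e', h2⟩
      simp_all [Bd.starts]
    rintro (a | a) (b | b) h
    · exact congrArg Sum.inl (D.src_inj (lower_inj h))
    · exact absurd h (key a b)
    · exact absurd h.symm (key b a)
    · exact congrArg Sum.inr (D'.src_inj (upper_inj h))
  tgt_inj := by
    have key : ∀ (e : D.E) (e' : D'.E), lower (D.tgt e) ≠
        (upper (D'.tgt e') : ((D.V ⊕ D'.V) ⊕ Fin T.length) ⊕ Bd S U) := by
      intro e e' h
      rcases h1 : D.tgt e with a | a | a <;> rcases h2 : D'.tgt e' with b | b | b <;>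
        simp [h1, h2, lower, upper] at h
      subst h
      have h3 := (D.bd_tgt _).1 ⟨e, h1⟩
      have h4 := (D'.bd_tgt _).1 ⟨e', h2⟩
      simp_all [Bd.starts]
    rintro (a | a) (b | b) h
    · exact congrArg Sum.inl (D.tgt_inj (lower_inj h))
    · exact absurd h (key a b)
    · exact absurd h.symm (key b a)
    · exact congrArg Sum.inr (D'.tgt_inj (upper_inj h))
  bd_src := by
    rintro (s | r)
    · refine Iff.trans ?_ (D.bd_src (Sum.inl s))
      constructor
      · rintro ⟨e | e, h⟩
        · exact ⟨e, lower_inj h⟩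
        · rcases h1 : D'.src e with a | a | a <;> simp [h1, upper] at h
      · rintro ⟨e, h⟩
        exact ⟨Sum.inl e, by simp [h, lower]⟩
    · refine Iff.trans ?_ (D'.bd_src (Sum.inr r))
      constructor
      · rintro ⟨e | e, h⟩
        · rcases h1 : D.src e with a | a | a <;> simp [h1, lower] at h
        · exact ⟨e, upper_inj h⟩
      · rintro ⟨e, h⟩
        exact ⟨Sum.inr e, by simp [h, upper]⟩
  bd_tgt := by
    rintro (s | r)
    · refine Iff.trans ?_ (D.bd_tgt (Sum.inl s))
      constructor
      · rintro ⟨e | e, h⟩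
        · exact ⟨e, lower_inj h⟩
        · rcases h1 : D'.tgt e with a | a | a <;> simp [h1, upper] at h
      · rintro ⟨e, h⟩
        exact ⟨Sum.inl e, by simp [h, lower]⟩
    · refine Iff.trans ?_ (D'.bd_tgt (Sum.inr r))
      constructor
      · rintro ⟨e | e, h⟩
        · rcases h1 : D.tgt e with a | a | a <;> simp [h1, lower] at h
        · exact ⟨e, upper_inj h⟩
      · rintro ⟨e, h⟩
        exact ⟨Sum.inr e, by simp [h, upper]⟩
  not_isolated := by
    rintro ((v | v) | t)
    · rcases D.not_isolated v with ⟨e, h⟩ | ⟨e, h⟩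
      · exact Or.inl ⟨Sum.inl e, by simp [h, lower]⟩
      · exact Or.inr ⟨Sum.inl e, by simp [h, lower]⟩
    · rcases D'.not_isolated v with ⟨e, h⟩ | ⟨e, h⟩
      · exact Or.inl ⟨Sum.inr e, by simp [h, upper]⟩
      · exact Or.inr ⟨Sum.inr e, by simp [h, upper]⟩
    · cases h : (T.get t).2
      · obtain ⟨e, he⟩ := (D.bd_src (Sum.inr t)).2 (by simpa [Bd.starts] using h)
        exact Or.inl ⟨Sum.inl e, by simp [he, lower]⟩
      · obtain ⟨e, he⟩ := (D'.bd_src (Sum.inl t)).2 (by simpa [Bd.starts] using h)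
        exact Or.inl ⟨Sum.inr e, by simp [he, upper]⟩
  start_mem := by
    rintro (e | e) ((v | v) | t) h h'
    · refine D.start_mem e v (lower_inj h) fun a ha => h' (Sum.inl a) (by simp [ha, lower])
    · rcases h1 : D.src e with a | a | a <;> simp [h1, lower] at h
    · exfalso
      have h1 : D.src e = Sum.inr (Sum.inr t) := lower_inj h
      have h2 := (D.bd_src _).1 ⟨e, h1⟩
      obtain ⟨a, ha⟩ := (D'.bd_tgt (Sum.inl t)).2 (by simpa [Bd.starts] using h2)
      exact h' (Sum.inr a) (by simp [ha, upper])
    · rcases h1 : D'.src e with a | a | a <;> simp [h1, upper] at h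
    · refine D'.start_mem e v (upper_inj h) fun a ha => h' (Sum.inr a) (by simp [ha, upper])
    · exfalso
      have h1 : D'.src e = Sum.inr (Sum.inl t) := upper_inj h
      have h2 := (D'.bd_src _).1 ⟨e, h1⟩
      obtain ⟨a, ha⟩ := (D.bd_tgt (Sum.inr t)).2 (by simpa [Bd.starts] using h2)
      exact h' (Sum.inl a) (by simp [ha, lower])
  end_mem := by
    rintro (e | e) ((v | v) | t) h h'
    · refine D.end_mem e v (lower_inj h) fun a ha => h' (Sum.inl a) (by simp [ha, lower])
    · rcases h1 : D.tgt e with a | a | a <;> simp [h1, lower] at h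
    · exfalso
      have h1 : D.tgt e = Sum.inr (Sum.inr t) := lower_inj h
      have h2 := (D.bd_tgt _).1 ⟨e, h1⟩
      obtain ⟨a, ha⟩ := (D'.bd_src (Sum.inl t)).2 (by simpa [Bd.starts] using h2)
      exact h' (Sum.inr a) (by simp [ha, upper])
    · rcases h1 : D'.tgt e with a | a | a <;> simp [h1, upper] at h
    · refine D'.end_mem e v (upper_inj h) fun a ha => h' (Sum.inr a) (by simp [ha, upper])
    · exfalso
      have h1 : D'.tgt e = Sum.inr (Sum.inl t) := upper_inj h
      have h2 := (D'.bd_tgt _).1 ⟨e, h1⟩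
      obtain ⟨a, ha⟩ := (D.bd_src (Sum.inr t)).2 (by simpa [Bd.starts] using h2)
      exact h' (Sum.inl a) (by simp [ha, lower])

theorem glue_rel_left {D₁ D₂ : Diagram I₀ I₁ S T} (h : Rel D₁ D₂) (D' : Diagram I₀ I₁ T U) :
    Rel (D₁.glue D') (D₂.glue D') := by
  rcases h with ⟨j, k, h1, h2, h3, h4⟩ | ⟨v, e, g, j, k, e', h1, h2, rfl, hj, hj', hk, hk', h3, h4,
    h5, h6, h7, X, Y, Z, β, γ, h8, h9, h10⟩
  · refine .iso ⟨(j.sumCongr (.refl _)).sumCongr (.refl _), k.sumCongr (.refl _), ?_, ?_, ?_, ?_⟩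
    · rintro ((a | a) | a)
      exacts [h1 a, rfl, rfl]
    · rintro (a | a)
      · exact (congrArg lower (h2 a)).trans (lower_map j _)
      · exact upper_map' j _
    · rintro (a | a)
      · exact (congrArg lower (h3 a)).trans (lower_map j _)
      · exact upper_map' j _
    · rintro (a | a)
      exacts [h4 a, rfl]
  · refine .erase ⟨Sum.inl (Sum.inl v), Sum.inl (k e'), Sum.inl g, Sum.map (Sum.map j id) id,
      Sum.map k id, Sum.inl e', ?_, ?_, rfl, ?_, ?_, ?_, ?_, ?_, ?_, ?_, ?_, ?_,
      X, Y, Z, β, γ, h8, h9, h10⟩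
    · simp [glue, h1, lower]
    · simp [glue, h2, lower]
    · exact (hj.sumMap Function.injective_id).sumMap Function.injective_id
    · exact range_map_left (range_map_left hj')
    · exact hk.sumMap Function.injective_id
    · exact range_map_left hk'
    · rintro ((a | a) | a)
      exacts [h3 a, rfl, rfl]
    · rintro (a | a)
      · exact (congrArg lower (h4 a)).trans (lower_map j _)
      · exact upper_map' j _
    · rintro (a | a) ha
      · exact (congrArg lower (h5 a (fun h => ha (congrArg Sum.inl h)))).trans (lower_map j _)
      · exact upper_map' j _
    · exact (congrArg lower h6).trans (lower_map j _)
    · rintro (a | a) ha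
      · exact h7 a (fun h => ha (congrArg Sum.inl h))
      · rfl

theorem glue_rel_right (D' : Diagram I₀ I₁ S T) {D₁ D₂ : Diagram I₀ I₁ T U} (h : Rel D₁ D₂) :
    Rel (D'.glue D₁) (D'.glue D₂) := by
  rcases h with ⟨j, k, h1, h2, h3, h4⟩ | ⟨v, e, g, j, k, e', h1, h2, rfl, hj, hj', hk, hk', h3, h4,
    h5, h6, h7, X, Y, Z, β, γ, h8, h9, h10⟩
  · refine .iso ⟨((Equiv.refl _).sumCongr j).sumCongr (.refl _), (Equiv.refl _).sumCongr k,
      ?_, ?_, ?_, ?_⟩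
    · rintro ((a | a) | a)
      exacts [rfl, h1 a, rfl]
    · rintro (a | a)
      · exact lower_map' j _
      · exact (congrArg upper (h2 a)).trans (upper_map j _)
    · rintro (a | a)
      · exact lower_map' j _
      · exact (congrArg upper (h3 a)).trans (upper_map j _)
    · rintro (a | a)
      exacts [rfl, h4 a]
  · refine .erase ⟨Sum.inl (Sum.inr v), Sum.inr (k e'), Sum.inr g, Sum.map (Sum.map id j) id,
      Sum.map id k, Sum.inr e', ?_, ?_, rfl, ?_, ?_, ?_, ?_, ?_, ?_, ?_, ?_, ?_,
      X, Y, Z, β, γ, h8, h9, h10⟩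
    · simp [glue, h1, upper]
    · simp [glue, h2, upper]
    · exact (Function.injective_id.sumMap hj).sumMap Function.injective_id
    · exact range_map_left (range_map_right hj')
    · exact Function.injective_id.sumMap hk
    · exact range_map_right hk'
    · rintro ((a | a) | a)
      exacts [rfl, h3 a, rfl]
    · rintro (a | a)
      · exact lower_map' j _
      · exact (congrArg upper (h4 a)).trans (upper_map j _)
    · rintro (a | a) ha
      · exact lower_map' j _
      · exact (congrArg upper (h5 a (fun h => ha (congrArg Sum.inr h)))).trans (upper_map j _)
    · exact (congrArg upper h6).trans (upper_map j _)
    · rintro (a | a) ha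
      · rfl
      · exact h7 a (fun h => ha (congrArg Sum.inr h))

/-! ### Juxtaposition -/

/-- The diagram obtained by putting `D'` to the right of `D`. -/
def side (D : Diagram I₀ I₁ S T) (D' : Diagram I₀ I₁ S' T') :
    Diagram I₀ I₁ (S ++ S') (T ++ T') where
  V := D.V ⊕ D'.V
  E := D.E ⊕ D'.E
  finite_V := by have := D.finite_V; have := D'.finite_V; infer_instance
  finite_E := by have := D.finite_E; have := D'.finite_E; infer_instance
  vlab := Sum.elim D.vlab D'.vlab
  src e := sidePt D.V D'.V S T S' T' (Sum.map D.src D'.src e)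
  tgt e := sidePt D.V D'.V S T S' T' (Sum.map D.tgt D'.tgt e)
  lab := Sum.elim D.lab D'.lab
  lab_left := by
    rintro (e | e)
    · have := D.lab_left e
      rcases h : D.src e with a | a
      · simp_all [sidePt]
      · have := ob_sideBd (S' := S') (T' := T') (Sum.inl a)
        simp_all [sidePt]
    · have := D'.lab_left e
      rcases h : D'.src e with a | a
      · simp_all [sidePt]
      · have := ob_sideBd (S := S) (T := T) (Sum.inr a)
        simp_all [sidePt]
  lab_right := by
    rintro (e | e)
    · have := D.lab_right e
      rcases h : D.tgt e with a | a
      · simp_all [sidePt]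
      · have := ob_sideBd (S' := S') (T' := T') (Sum.inl a)
        simp_all [sidePt]
    · have := D'.lab_right e
      rcases h : D'.tgt e with a | a
      · simp_all [sidePt]
      · have := ob_sideBd (S := S) (T := T) (Sum.inr a)
        simp_all [sidePt]
  src_inj := (sidePt _ _ _ _ _ _).injective.comp (D.src_inj.sumMap D'.src_inj)
  tgt_inj := (sidePt _ _ _ _ _ _).injective.comp (D.tgt_inj.sumMap D'.tgt_inj)
  bd_src := by
    intro b
    obtain ⟨b, rfl⟩ := (sideBd S T S' T').surjective b
    rw [exists_sidePt_bd, starts_sideBd]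
    rcases b with b | b
    · exact D.bd_src b
    · exact D'.bd_src b
  bd_tgt := by
    intro b
    obtain ⟨b, rfl⟩ := (sideBd S T S' T').surjective b
    rw [exists_sidePt_bd, starts_sideBd]
    rcases b with b | b
    · exact D.bd_tgt b
    · exact D'.bd_tgt b
  not_isolated := by
    rintro (v | v)
    · rcases D.not_isolated v with ⟨e, h⟩ | ⟨e, h⟩
      · exact Or.inl ⟨Sum.inl e, (sidePt_inl_eq _ _).2 h⟩
      · exact Or.inr ⟨Sum.inl e, (sidePt_inl_eq _ _).2 h⟩
    · rcases D'.not_isolated v with ⟨e, h⟩ | ⟨e, h⟩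
      · exact Or.inl ⟨Sum.inr e, (sidePt_inr_eq _ _).2 h⟩
      · exact Or.inr ⟨Sum.inr e, (sidePt_inr_eq _ _).2 h⟩
  start_mem := by
    rintro (e | e) (v | v) h h'
    · exact D.start_mem e v ((sidePt_inl_eq _ _).1 h)
        fun a ha => h' (Sum.inl a) ((sidePt_inl_eq _ _).2 ha)
    · exact absurd h (sidePt_inl_ne _ _)
    · exact absurd h (sidePt_inr_ne _ _)
    · exact D'.start_mem e v ((sidePt_inr_eq _ _).1 h)
        fun a ha => h' (Sum.inr a) ((sidePt_inr_eq _ _).2 ha)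
  end_mem := by
    rintro (e | e) (v | v) h h'
    · exact D.end_mem e v ((sidePt_inl_eq _ _).1 h)
        fun a ha => h' (Sum.inl a) ((sidePt_inl_eq _ _).2 ha)
    · exact absurd h (sidePt_inl_ne _ _)
    · exact absurd h (sidePt_inr_ne _ _)
    · exact D'.end_mem e v ((sidePt_inr_eq _ _).1 h)
        fun a ha => h' (Sum.inr a) ((sidePt_inr_eq _ _).2 ha)

theorem side_rel_left {D₁ D₂ : Diagram I₀ I₁ S T} (h : Rel D₁ D₂) (D' : Diagram I₀ I₁ S' T') :
    Rel (D₁.side D') (D₂.side D') := by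
  have key : ∀ {A A' B : Type} (j : A → A') (x : A ⊕ Bd S T) (y : A' ⊕ Bd S T),
      y = Sum.map j id x → sidePt A' B S T S' T' (Sum.inl y) =
        Sum.map (Sum.map j id) id (sidePt A B S T S' T' (Sum.inl x)) := by
    rintro A A' B j x _ rfl
    exact sidePt_map j id (Sum.inl x)
  have key' : ∀ {A A' B : Type} (j : A → A') (x : B ⊕ Bd S' T'),
      sidePt A' B S T S' T' (Sum.inr x) =
        Sum.map (Sum.map j id) id (sidePt A B S T S' T' (Sum.inr x)) := by
    rintro A A' B j (x | x) <;> rfl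
  rcases h with ⟨j, k, h1, h2, h3, h4⟩ | ⟨v, e, g, j, k, e', h1, h2, rfl, hj, hj', hk, hk', h3, h4,
    h5, h6, h7, X, Y, Z, β, γ, h8, h9, h10⟩
  · refine .iso ⟨j.sumCongr (.refl _), k.sumCongr (.refl _), ?_, ?_, ?_, ?_⟩
    · rintro (a | a)
      exacts [h1 a, rfl]
    · rintro (a | a)
      · exact key j _ _ (h2 a)
      · exact key' j _
    · rintro (a | a)
      · exact key j _ _ (h3 a)
      · exact key' j _
    · rintro (a | a)
      exacts [h4 a, rfl]
  · refine .erase ⟨Sum.inl v, Sum.inl (k e'), Sum.inl g, Sum.map j id,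
      Sum.map k id, Sum.inl e', (sidePt_inl_eq _ _).2 h1, (sidePt_inl_eq _ _).2 h2, rfl,
      hj.sumMap Function.injective_id, ?_, hk.sumMap Function.injective_id, ?_, ?_, ?_, ?_,
      key j _ _ h6, ?_, X, Y, Z, β, γ, h8, h9, h10⟩
    · exact range_map_left hj'
    · exact range_map_left hk'
    · rintro (a | a)
      exacts [h3 a, rfl]
    · rintro (a | a)
      · exact key j _ _ (h4 a)
      · exact key' j _
    · rintro (a | a) ha
      · exact key j _ _ (h5 a (fun h => ha (congrArg Sum.inl h)))
      · exact key' j _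
    · rintro (a | a) ha
      · exact h7 a (fun h => ha (congrArg Sum.inl h))
      · rfl

theorem side_rel_right (D' : Diagram I₀ I₁ S T) {D₁ D₂ : Diagram I₀ I₁ S' T'} (h : Rel D₁ D₂) :
    Rel (D'.side D₁) (D'.side D₂) := by
  have key : ∀ {A B B' : Type} (j : B → B') (x : B ⊕ Bd S' T') (y : B' ⊕ Bd S' T'),
      y = Sum.map j id x → sidePt A B' S T S' T' (Sum.inr y) =
        Sum.map (Sum.map id j) id (sidePt A B S T S' T' (Sum.inr x)) := by
    rintro A B B' j x _ rfl
    exact sidePt_map id j (Sum.inr x)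
  have key' : ∀ {A B B' : Type} (j : B → B') (x : A ⊕ Bd S T),
      sidePt A B' S T S' T' (Sum.inl x) =
        Sum.map (Sum.map id j) id (sidePt A B S T S' T' (Sum.inl x)) := by
    rintro A B B' j (x | x) <;> rfl
  rcases h with ⟨j, k, h1, h2, h3, h4⟩ | ⟨v, e, g, j, k, e', h1, h2, rfl, hj, hj', hk, hk', h3, h4,
    h5, h6, h7, X, Y, Z, β, γ, h8, h9, h10⟩
  · refine .iso ⟨(Equiv.refl _).sumCongr j, (Equiv.refl _).sumCongr k, ?_, ?_, ?_, ?_⟩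
    · rintro (a | a)
      exacts [rfl, h1 a]
    · rintro (a | a)
      · exact key' j _
      · exact key j _ _ (h2 a)
    · rintro (a | a)
      · exact key' j _
      · exact key j _ _ (h3 a)
    · rintro (a | a)
      exacts [rfl, h4 a]
  · refine .erase ⟨Sum.inr v, Sum.inr (k e'), Sum.inr g, Sum.map id j,
      Sum.map id k, Sum.inr e', (sidePt_inr_eq _ _).2 h1, (sidePt_inr_eq _ _).2 h2, rfl,
      Function.injective_id.sumMap hj, ?_, Function.injective_id.sumMap hk, ?_, ?_, ?_, ?_,
      key j _ _ h6, ?_, X, Y, Z, β, γ, h8, h9, h10⟩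
    · exact range_map_right hj'
    · exact range_map_right hk'
    · rintro (a | a)
      exacts [rfl, h3 a]
    · rintro (a | a)
      · exact key' j _
      · exact key j _ _ (h4 a)
    · rintro (a | a) ha
      · exact key' j _
      · exact key j _ _ (h5 a (fun h => ha (congrArg Sum.inr h)))
    · rintro (a | a) ha
      · rfl
      · exact h7 a (fun h => ha (congrArg Sum.inr h))

/-! ### Particular diagrams -/

/-- The diagram with one edge for each `e : E`, which joins the boundary points `p e` and `q e`
and is labelled by an identity morphism. -/
def wiring (E : Type) [Finite E] (p q : E → Bd S T)
    (bij : Function.Bijective (Sum.elim p q : E ⊕ E → Bd S T))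
    (hob : ∀ e, (p e).ob = (q e).ob) (hst : ∀ e, (q e).starts = !(p e).starts) :
    Diagram I₀ I₁ S T where
  V := Empty
  E := E
  finite_V := inferInstance
  finite_E := inferInstance
  vlab := Empty.elim
  src e := Sum.inr (if (p e).starts then p e else q e)
  tgt e := Sum.inr (if (p e).starts then q e else p e)
  lab e := Arrow.mk (𝟙 (p e).ob)
  lab_left e := by
    cases h : (p e).starts <;> simp [hob]
  lab_right e := by
    cases h : (p e).starts <;> simp [hob]
  src_inj a b hab := by
    have h1 := @bij.1 (Sum.inl a) (Sum.inl b)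
    have h2 := @bij.1 (Sum.inl a) (Sum.inr b)
    have h3 := @bij.1 (Sum.inr a) (Sum.inl b)
    have h4 := @bij.1 (Sum.inr a) (Sum.inr b)
    cases ha : (p a).starts <;> cases hb : (p b).starts <;> simp_all
  tgt_inj a b hab := by
    have h1 := @bij.1 (Sum.inl a) (Sum.inl b)
    have h2 := @bij.1 (Sum.inl a) (Sum.inr b)
    have h3 := @bij.1 (Sum.inr a) (Sum.inl b)
    have h4 := @bij.1 (Sum.inr a) (Sum.inr b)
    cases ha : (p a).starts <;> cases hb : (p b).starts <;> simp_all
  bd_src b := by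
    constructor
    · rintro ⟨e, h⟩
      obtain rfl := Sum.inr_injective h
      cases he : (p e).starts <;> simp_all
    · intro h
      obtain ⟨e | e, rfl⟩ := bij.2 b
      · exact ⟨e, by simp_all⟩
      · exact ⟨e, by simp_all⟩
  bd_tgt b := by
    constructor
    · rintro ⟨e, h⟩
      obtain rfl := Sum.inr_injective h
      cases he : (p e).starts <;> simp_all
    · intro h
      obtain ⟨e | e, rfl⟩ := bij.2 b
      · exact ⟨e, by simp_all⟩
      · exact ⟨e, by simp_all⟩
  not_isolated v := v.elim
  start_mem _ v := v.elim
  end_mem _ v := v.elim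

/-- The identity diagram: vertical strands. -/
def ident (S : List (C × Bool)) : Diagram I₀ I₁ S S :=
  wiring (Fin S.length) Sum.inl Sum.inr
    (by
      have : (Sum.elim Sum.inl Sum.inr : Bd S S → Bd S S) = id := by ext (x | x) <;> rfl
      rw [this]
      exact Function.bijective_id)
    (fun _ => rfl) (fun _ => rfl)

/-- The diagram that moves the sequence `S` past the sequence `T`. -/
def swap (S T : List (C × Bool)) : Diagram I₀ I₁ (S ++ T) (T ++ S) :=
  wiring (Fin S.length ⊕ Fin T.length) (fun x => Sum.inl (pos S T x))
    (fun x => Sum.inr (pos T S x.swap))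
    (by
      have : (Sum.elim (fun x => Sum.inl (pos S T x)) (fun x => Sum.inr (pos T S x.swap)) :
          (Fin S.length ⊕ Fin T.length) ⊕ (Fin S.length ⊕ Fin T.length) →
            Bd (S ++ T) (T ++ S)) =
          (pos S T).sumCongr ((Equiv.sumComm _ _).trans (pos T S)) := by
        ext (x | x) <;> rfl
      rw [this]
      exact Equiv.bijective _)
    (by
      rintro (i | j)
      · exact congrArg Prod.fst ((get_pos_inl S T i).trans (get_pos_inr T S i).symm)
      · exact congrArg Prod.fst ((get_pos_inr S T j).trans (get_pos_inl T S j).symm))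
    (by
      rintro (i | j)
      · exact congrArg (fun x => !x.2) ((get_pos_inr T S i).trans (get_pos_inl S T i).symm)
      · exact congrArg (fun x => !x.2) ((get_pos_inl T S j).trans (get_pos_inr S T j).symm))

/-- Nested cups, from the empty sequence to `S` followed by its dual. -/
def cup (S : List (C × Bool)) : Diagram I₀ I₁ [] (S ++ dualSeq S) :=
  wiring (Fin S.length) (fun i => Sum.inr (pos S (dualSeq S) (Sum.inl i)))
    (fun i => Sum.inr (pos S (dualSeq S) (Sum.inr (dualPos S i))))
    (by
      constructor
      · rintro (a | a) (b | b) h <;> simp_all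
      · rintro (x | x)
        · exact x.elim0
        · obtain ⟨i | i, rfl⟩ := (pos S (dualSeq S)).surjective x
          · exact ⟨Sum.inl i, rfl⟩
          · obtain ⟨i, rfl⟩ := (dualPos S).surjective i
            exact ⟨Sum.inr i, rfl⟩)
    (fun i => by
      simp only [Bd.ob, Sum.elim_inr, get_pos_inl, get_pos_inr, get_dualPos])
    (fun i => by
      simp only [Bd.starts, Sum.elim_inr, get_pos_inl, get_pos_inr, get_dualPos])

/-- Nested caps, from the dual of `S` followed by `S` to the empty sequence. -/
def cap (S : List (C × Bool)) : Diagram I₀ I₁ (dualSeq S ++ S) [] :=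
  wiring (Fin S.length) (fun i => Sum.inl (pos (dualSeq S) S (Sum.inr i)))
    (fun i => Sum.inl (pos (dualSeq S) S (Sum.inl (dualPos S i))))
    (by
      constructor
      · rintro (a | a) (b | b) h <;> simp_all
      · rintro (x | x)
        · obtain ⟨i | i, rfl⟩ := (pos (dualSeq S) S).surjective x
          · obtain ⟨i, rfl⟩ := (dualPos S).surjective i
            exact ⟨Sum.inr i, rfl⟩
          · exact ⟨Sum.inl i, rfl⟩
        · exact x.elim0)
    (fun i => by
      simp only [Bd.ob, Sum.elim_inl, get_pos_inl, get_pos_inr, get_dualPos])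
    (fun i => by
      simp only [Bd.starts, Sum.elim_inl, get_pos_inl, get_pos_inr, get_dualPos])

/-- The diagram `β₊`: a vertical strand labelled by `β`. -/
def strand {X Y : C} (β : X ⟶ Y) : Diagram I₀ I₁ [(X, true)] [(Y, true)] where
  V := Empty
  E := Unit
  finite_V := inferInstance
  finite_E := inferInstance
  vlab := Empty.elim
  src _ := Sum.inr (Sum.inl ⟨0, Nat.one_pos⟩)
  tgt _ := Sum.inr (Sum.inr ⟨0, Nat.one_pos⟩)
  lab _ := Arrow.mk β
  lab_left _ := rfl
  lab_right _ := rfl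
  src_inj _ _ _ := rfl
  tgt_inj _ _ _ := rfl
  bd_src := by
    rintro (⟨i, hi⟩ | ⟨i, hi⟩) <;> obtain rfl := Nat.lt_one_iff.1 hi <;> simp [Bd.starts]
  bd_tgt := by
    rintro (⟨i, hi⟩ | ⟨i, hi⟩) <;> obtain rfl := Nat.lt_one_iff.1 hi <;> simp [Bd.starts]
  not_isolated v := v.elim
  start_mem _ v := v.elim
  end_mem _ v := v.elim

/-- The circle with one vertex, labelled by `X`, and one edge, labelled by `β`. -/
def circle {X : C} (β : X ⟶ X) : Diagram I₀ I₁ [] [] where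
  V := Unit
  E := Unit
  finite_V := inferInstance
  finite_E := inferInstance
  vlab _ := X
  src _ := Sum.inl ()
  tgt _ := Sum.inl ()
  lab _ := Arrow.mk β
  lab_left _ := rfl
  lab_right _ := rfl
  src_inj _ _ _ := rfl
  tgt_inj _ _ _ := rfl
  bd_src := by rintro (i | i) <;> exact i.elim0
  bd_tgt := by rintro (i | i) <;> exact i.elim0
  not_isolated _ := Or.inl ⟨(), rfl⟩
  start_mem _ _ _ h := absurd rfl (h ())
  end_mem _ _ _ h := absurd rfl (h ())

/-- The floating interval with one edge, labelled by an element of both ideals. -/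
def interval (f : IdealInter I₀ I₁) : Diagram I₀ I₁ [] [] where
  V := Bool
  E := Unit
  finite_V := inferInstance
  finite_E := inferInstance
  vlab b := if b then f.1.right else f.1.left
  src _ := Sum.inl false
  tgt _ := Sum.inl true
  lab _ := f.1
  lab_left _ := rfl
  lab_right _ := rfl
  src_inj _ _ _ := rfl
  tgt_inj _ _ _ := rfl
  bd_src := by rintro (i | i) <;> exact i.elim0
  bd_tgt := by rintro (i | i) <;> exact i.elim0
  not_isolated := by
    rintro (_ | _)
    · exact Or.inl ⟨(), rfl⟩
    · exact Or.inr ⟨(), rfl⟩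
  start_mem _ _ _ _ := f.2.1
  end_mem _ _ _ _ := f.2.2

end Diagram

/-! ## Morphisms of the Brauer category -/

/-- Morphisms: diagrams modulo the equivalence relation generated by isomorphism and by
erasing vertices. -/
def Hom (X Y : BrauerCat I₀ I₁) : Type (max 1 u v) :=
  Quot (Diagram.Rel : Diagram I₀ I₁ X Y → Diagram I₀ I₁ X Y → Prop)

/-- The class of a diagram. -/
def Hom.mk {X Y : BrauerCat I₀ I₁} (D : Diagram I₀ I₁ X Y) : Hom X Y := Quot.mk _ D

/-- Composition of morphisms, by gluing of diagrams. -/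
def Hom.comp {X Y Z : BrauerCat I₀ I₁} (f : Hom X Y) (g : Hom Y Z) : Hom X Z :=
  Quot.map₂ Diagram.glue (fun D _ _ h => Diagram.glue_rel_right D h)
    (fun _ _ D h => Diagram.glue_rel_left h D) f g

/-- Tensor product of objects: concatenation of sequences. -/
def tensor (X Y : BrauerCat I₀ I₁) : BrauerCat I₀ I₁ := List.append X Y

/-- The unit object: the empty sequence. -/
def unit (I₀ : LeftIdeal C) (I₁ : RightIdeal C) : BrauerCat I₀ I₁ := []

/-- The dual object: the reversed sequence with all signs changed. -/
def dual (X : BrauerCat I₀ I₁) : BrauerCat I₀ I₁ := dualSeq X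

/-- Tensor product of morphisms, by juxtaposition of diagrams. -/
def Hom.tensor {X Y X' Y' : BrauerCat I₀ I₁} (f : Hom X Y) (g : Hom X' Y') :
    Hom (tensor X X') (tensor Y Y') :=
  Quot.map₂ Diagram.side (fun D _ _ h => Diagram.side_rel_right D h)
    (fun _ _ D h => Diagram.side_rel_left h D) f g

theorem tensor_assoc (X Y Z : BrauerCat I₀ I₁) :
    tensor (tensor X Y) Z = tensor X (tensor Y Z) := List.append_assoc X Y Z

theorem unit_tensor (X : BrauerCat I₀ I₁) : tensor (unit I₀ I₁) X = X := List.nil_append X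

theorem tensor_unit (X : BrauerCat I₀ I₁) : tensor X (unit I₀ I₁) = X := List.append_nil X

/-- Morphisms, identities and composition of the Brauer category. -/
@[reducible] def catStruct (I₀ : LeftIdeal C) (I₁ : RightIdeal C) :
    CategoryStruct.{max 1 u v} (BrauerCat I₀ I₁) where
  Hom X Y := Hom X Y
  id X := Hom.mk (Diagram.ident X)
  comp f g := Hom.comp f g

/-- The object `X⁺` for an object `X` of `C`. -/
def plus (I₀ : LeftIdeal C) (I₁ : RightIdeal C) (X : C) : BrauerCat I₀ I₁ := [(X, true)]

end BrauerCat

/-- The category with a given composition and given identities that satisfy the axioms. -/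
@[reducible] def categoryOfStruct {B : Type u} (s : CategoryStruct.{v} B)
    (h : ∃ K : Category.{v} B, K.toCategoryStruct = s) : Category.{v} B where
  toCategoryStruct := s
  id_comp := by obtain ⟨K, rfl⟩ := h; exact K.id_comp
  comp_id := by obtain ⟨K, rfl⟩ := h; exact K.comp_id
  assoc := by obtain ⟨K, rfl⟩ := h; exact K.assoc

/-- The monoidal category with a given tensor product, given associators and given unitors that
satisfy the axioms. -/
@[reducible] def monoidalOfStruct {B : Type u} [Category.{v} B] (s : MonoidalCategoryStruct B)
    (h : ∃ M : MonoidalCategory B, M.toMonoidalCategoryStruct = s) : MonoidalCategory B where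
  toMonoidalCategoryStruct := s
  tensorHom_def := by obtain ⟨M, rfl⟩ := h; exact M.tensorHom_def
  id_tensorHom_id := by obtain ⟨M, rfl⟩ := h; exact M.id_tensorHom_id
  tensorHom_comp_tensorHom := by obtain ⟨M, rfl⟩ := h; exact M.tensorHom_comp_tensorHom
  whiskerLeft_id := by obtain ⟨M, rfl⟩ := h; exact M.whiskerLeft_id
  id_whiskerRight := by obtain ⟨M, rfl⟩ := h; exact M.id_whiskerRight
  associator_naturality := by obtain ⟨M, rfl⟩ := h; exact M.associator_naturality
  leftUnitor_naturality := by obtain ⟨M, rfl⟩ := h; exact M.leftUnitor_naturality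
  rightUnitor_naturality := by obtain ⟨M, rfl⟩ := h; exact M.rightUnitor_naturality
  pentagon := by obtain ⟨M, rfl⟩ := h; exact M.pentagon
  triangle := by obtain ⟨M, rfl⟩ := h; exact M.triangle

/-- A monoidal category is strict if its tensor product is strictly associative and unital and
its associators and unitors are identities (that is, `eqToIso` of the equalities of objects). -/
structure IsStrictMonoidal (B : Type u) [Category.{v} B] [MonoidalCategory B] : Prop where
  assoc_eq : ∀ X Y Z : B, (X ⊗ Y) ⊗ Z = X ⊗ (Y ⊗ Z)
  unit_left_eq : ∀ X : B, 𝟙_ B ⊗ X = X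
  unit_right_eq : ∀ X : B, X ⊗ 𝟙_ B = X
  associator_eq : ∀ X Y Z : B, α_ X Y Z = eqToIso (assoc_eq X Y Z)
  leftUnitor_eq : ∀ X : B, λ_ X = eqToIso (unit_left_eq X)
  rightUnitor_eq : ∀ X : B, ρ_ X = eqToIso (unit_right_eq X)

namespace BrauerCat

variable {C : Type u} [Category.{v} C]

/-- The statement that gluing of diagrams is associative and unital. -/
def IsCategory (I₀ : LeftIdeal C) (I₁ : RightIdeal C) : Prop :=
  ∃ K : Category.{max 1 u v} (BrauerCat I₀ I₁), K.toCategoryStruct = catStruct I₀ I₁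

variable {I₀ : LeftIdeal C} {I₁ : RightIdeal C}

/-- The Brauer category `B(C, I₀, I₁)`. -/
@[reducible] def category (h : IsCategory I₀ I₁) : Category.{max 1 u v} (BrauerCat I₀ I₁) :=
  categoryOfStruct (catStruct I₀ I₁) h

/-- The tensor product of the Brauer category: juxtaposition, with identities as associators and
unitors. -/
@[reducible] def monStruct (h : IsCategory I₀ I₁) :
    letI := category h
    MonoidalCategoryStruct (BrauerCat I₀ I₁) :=
  letI := category h
  { tensorObj := tensor
    whiskerLeft := fun X _ _ f => Hom.tensor (Hom.mk (Diagram.ident X)) f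
    whiskerRight := fun f Y => Hom.tensor f (Hom.mk (Diagram.ident Y))
    tensorHom := fun f g => Hom.tensor f g
    tensorUnit := unit I₀ I₁
    associator := fun X Y Z => eqToIso (tensor_assoc X Y Z)
    leftUnitor := fun X => eqToIso (unit_tensor X)
    rightUnitor := fun X => eqToIso (tensor_unit X) }

/-- The statement that juxtaposition of diagrams makes the Brauer category a monoidal category. -/
def IsMonoidal (h : IsCategory I₀ I₁) : Prop :=
  letI := category h
  ∃ M : MonoidalCategory (BrauerCat I₀ I₁), M.toMonoidalCategoryStruct = monStruct h

/-- The Brauer category as a monoidal category. -/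
@[reducible] def monoidal (h : IsCategory I₀ I₁) (hm : IsMonoidal h) :
    letI := category h
    MonoidalCategory (BrauerCat I₀ I₁) :=
  letI := category h
  monoidalOfStruct (monStruct h) hm

end BrauerCat

/-! Erasing vertices replaces a chain of edges by one edge that carries the composite label. A
morphism is therefore a record of components: the ends and the composite of each strand, the
composite along each circle up to rotation, the composite along each floating interval. The proof
does not build this normal form for all diagrams; it uses one criterion for equivalence and two
invariants.

The criterion is `sim_of_merge`: `D` is equivalent to `D'` if each edge of `D'` matches a walk in
`D` with the same ends and the same composite label, and these walks exhaust the edges of `D`.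
Vertices are erased one at a time; walks survive each erasure (`IsErase.walk_iff`) and the number of
edges drops.

For the monoidal structure, gluing on identity-labelled vertical strands only renames boundary
points (`glue_perm`, `perm_glue`). Hence identities are neutral, and diagrams built from such
strands are governed by bijections of positions (`Realises.sim`): the hexagons and the involutivity
of the symmetry become equalities of finite bijections, and naturality says that two juxtapositions
differ by a renaming (`glue_sim_glue`). Associativity of gluing and the interchange law are plain
isomorphisms of diagrams; pentagon and triangle are formal, since associators and unitors are
`eqToHom`. For rigidity, the criterion straightens zigzags (`realises_zigzag`).

For faithfulness, the set of composite labels of the strands from bottom to top is invariant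
(`Rel.strandLabels_eq`) and recovers a morphism from its strand.

For the endomorphisms of the unit, the number of components that contribute a given generator is
invariant (`Rel.mult_eq`), additive (`mult_glue`), and equal to a Kronecker delta on generators, so
a product of generators determines its multiset. Circles depend only on the loop, because a circle
with two vertices can be reduced at either one (`circle_comp_sim`). Conversely, a closed diagram in
which nothing can be erased is a disjoint union of one-edge circles and intervals
(`ofClosed_mem_mrange`). -/

namespace BrauerCat

/-! ### Composition of arrows as a relation -/

section Arrows

variable {C : Type u} [Category.{v} C]

/-- `c` is the composition of the composable arrows `a` and `b`. -/
def IsComp (a b c : Arrow C) : Prop :=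
  ∃ (X Y Z : C) (β : X ⟶ Y) (γ : Y ⟶ Z), a = Arrow.mk β ∧ b = Arrow.mk γ ∧ c = Arrow.mk (β ≫ γ)

theorem IsComp.mk {X Y Z : C} (β : X ⟶ Y) (γ : Y ⟶ Z) :
    IsComp (Arrow.mk β) (Arrow.mk γ) (Arrow.mk (β ≫ γ)) :=
  ⟨X, Y, Z, β, γ, rfl, rfl, rfl⟩

/-- Labels of consecutive edges have matching ends only up to an equality of objects. Treating
composition as a relation on arrows avoids transport: it is total on matching pairs by this lemma
and single-valued by `IsComp.unique`. -/
theorem exists_isComp {a b : Arrow C} (h : a.right = b.left) : ∃ c, IsComp a b c := by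
  rcases a with ⟨X, Y, β⟩
  rcases b with ⟨Y', Z, γ⟩
  obtain rfl : Y = Y' := h
  exact ⟨_, IsComp.mk (C := C) β γ⟩

theorem IsComp.left_eq {a b c : Arrow C} (h : IsComp a b c) : c.left = a.left := by
  obtain ⟨X, Y, Z, β, γ, rfl, rfl, rfl⟩ := h
  rfl

theorem IsComp.right_eq {a b c : Arrow C} (h : IsComp a b c) : c.right = b.right := by
  obtain ⟨X, Y, Z, β, γ, rfl, rfl, rfl⟩ := h
  rfl

theorem IsComp.unique {a b c c' : Arrow C} (h : IsComp a b c) (h' : IsComp a b c') : c = c' := by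
  obtain ⟨X, Y, Z, β, γ, rfl, rfl, rfl⟩ := h
  obtain ⟨X', Y', Z', β', γ', h1, h2, rfl⟩ := h'
  cases h1
  cases h2
  rfl

theorem IsComp.assoc {a b c ab abc : Arrow C} (h : IsComp a b ab) (h' : IsComp ab c abc) :
    ∃ bc, IsComp b c bc ∧ IsComp a bc abc := by
  obtain ⟨X, Y, Z, β, γ, rfl, rfl, rfl⟩ := h
  obtain ⟨X', Z', W, βγ, δ, h1, rfl, rfl⟩ := h'
  cases h1
  refine ⟨_, IsComp.mk γ δ, ?_⟩
  rw [Category.assoc]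
  exact IsComp.mk _ _

theorem IsComp.assoc_symm {a b c bc abc : Arrow C} (h : IsComp b c bc) (h' : IsComp a bc abc) :
    ∃ ab, IsComp a b ab ∧ IsComp ab c abc := by
  obtain ⟨X, Y, Z, β, γ, rfl, rfl, rfl⟩ := h
  obtain ⟨X', Z', W, α, βγ, rfl, h1, rfl⟩ := h'
  cases h1
  refine ⟨_, IsComp.mk α β, ?_⟩
  rw [← Category.assoc]
  exact IsComp.mk _ _

theorem IsComp.id_left {a : Arrow C} {X : C} (h : a.left = X) :
    IsComp (Arrow.mk (𝟙 X)) a a := by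
  subst h
  exact ⟨_, _, _, 𝟙 _, a.hom, rfl, rfl, by simp⟩

theorem IsComp.id_right {a : Arrow C} {X : C} (h : a.right = X) :
    IsComp a (Arrow.mk (𝟙 X)) a := by
  subst h
  exact ⟨_, _, _, a.hom, 𝟙 _, rfl, rfl, by simp⟩

end Arrows

/-! ### Equivalence of diagrams, walks and merging of edges -/

namespace Diagram

variable {C : Type u} [Category.{v} C] {I₀ : LeftIdeal C} {I₁ : RightIdeal C}
variable {S T U S' T' : List (C × Bool)}

/-- Two diagrams are equivalent if they represent the same morphism. -/
def Sim (D D' : Diagram I₀ I₁ S T) : Prop := Quot.mk Rel D = Quot.mk Rel D'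

theorem Sim.refl (D : Diagram I₀ I₁ S T) : Sim D D := rfl

theorem Sim.symm {D D' : Diagram I₀ I₁ S T} (h : Sim D D') : Sim D' D := Eq.symm h

theorem Sim.trans {D D' D'' : Diagram I₀ I₁ S T} (h : Sim D D') (h' : Sim D' D'') : Sim D D'' :=
  Eq.trans h h'

theorem Iso.sim {D D' : Diagram I₀ I₁ S T} (h : Iso D D') : Sim D D' := Quot.sound (.iso h)

theorem Erase.sim {D D' : Diagram I₀ I₁ S T} (h : Erase D D') : Sim D D' := Quot.sound (.erase h)

theorem Sim.map {D D' : Diagram I₀ I₁ S T} (F : Diagram I₀ I₁ S T → Diagram I₀ I₁ S' T')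
    (hF : ∀ {D₁ D₂}, Rel D₁ D₂ → Rel (F D₁) (F D₂)) (h : Sim D D') : Sim (F D) (F D') :=
  congrArg (Quot.map F fun _ _ h => hF h) h

theorem Sim.glue {D₁ D₂ : Diagram I₀ I₁ S T} {D₁' D₂' : Diagram I₀ I₁ T U} (h : Sim D₁ D₂)
    (h' : Sim D₁' D₂') : Sim (D₁.glue D₁') (D₂.glue D₂') :=
  (h.map (fun D => D.glue D₁') fun h => glue_rel_left h _).trans
    (h'.map (fun D => D₂.glue D) fun h => glue_rel_right _ h)

theorem Sim.side {D₁ D₂ : Diagram I₀ I₁ S T} {D₁' D₂' : Diagram I₀ I₁ S' T'} (h : Sim D₁ D₂)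
    (h' : Sim D₁' D₂') : Sim (D₁.side D₁') (D₂.side D₂') :=
  (h.map (fun D => D.side D₁') fun h => side_rel_left h _).trans
    (h'.map (fun D => D₂.side D) fun h => side_rel_right _ h)

/-! ### Walks -/

/-- The edge `f` can be reached from the edge `e` along the orientation, without entering an edge
of the set `K` on the way, and the composition of the labels of the traversed edges is `a`. -/
inductive Walk (D : Diagram I₀ I₁ S T) (K : Set D.E) (e : D.E) : D.E → Arrow C → Prop
  | start : Walk D K e e (D.lab e)
  | step {f g : D.E} {a b : Arrow C} : Walk D K e f a → D.tgt f = D.src g → g ∉ K →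
      IsComp a (D.lab g) b → Walk D K e g b

/-- A strand either starts or ends at a boundary point, never both, so two consecutive edges always
meet at an inner vertex, which can then be erased. -/
theorem tgt_ne_bd_src (D : Diagram I₀ I₁ S T) {e g : D.E} (h : D.tgt e = D.src g) :
    ∃ v, D.src g = Sum.inl v := by
  rcases h' : D.src g with v | b
  · exact ⟨v, rfl⟩
  · have h1 := (D.bd_src b).1 ⟨g, h'⟩
    have h2 := (D.bd_tgt b).1 ⟨e, h.trans h'⟩
    simp [h1] at h2

theorem Walk.right_eq {D : Diagram I₀ I₁ S T} {K : Set D.E} {e f : D.E} {a : Arrow C}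
    (h : Walk D K e f a) : a.right = (D.lab f).right := by
  cases h with
  | start => rfl
  | step _ _ _ h => exact h.right_eq

theorem lab_comm (D : Diagram I₀ I₁ S T) {e g : D.E} (h : D.tgt e = D.src g) :
    (D.lab e).right = (D.lab g).left := by
  rw [D.lab_left, D.lab_right, h]

theorem Walk.exists_step {D : Diagram I₀ I₁ S T} {K : Set D.E} {e f g : D.E} {a : Arrow C}
    (h : Walk D K e f a) (hfg : D.tgt f = D.src g) (hg : g ∉ K) :
    ∃ b, IsComp a (D.lab g) b ∧ Walk D K e g b := by
  obtain ⟨b, hb⟩ := exists_isComp (h.right_eq.trans (D.lab_comm hfg))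
  exact ⟨b, hb, h.step hfg hg hb⟩

theorem Walk.iso {D D' : Diagram I₀ I₁ S T} {j : D.V ≃ D'.V} {k : D.E ≃ D'.E}
    (hs : ∀ e, D'.src (k e) = Sum.map j id (D.src e))
    (ht : ∀ e, D'.tgt (k e) = Sum.map j id (D.tgt e))
    (hl : ∀ e, D'.lab (k e) = D.lab e) {K : Set D.E} {e f : D.E} {a : Arrow C}
    (h : Walk D K e f a) : Walk D' (k.symm ⁻¹' K) (k e) (k f) a := by
  induction h with
  | start =>
    rw [← hl]
    exact .start
  | @step f g _ _ _ h1 h2 h3 ih =>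
    refine ih.step ?_ (by simpa using h2) (by rwa [hl])
    rw [hs, ht, h1]

/-! ### Erasing a vertex -/

/-- The data of `Erase`, made explicit. -/
structure IsErase (D D' : Diagram I₀ I₁ S T) (v : D.V) (e g : D.E) (j : D'.V → D.V)
    (k : D'.E → D.E) (e' : D'.E) : Prop where
  tgt_e : D.tgt e = Sum.inl v
  src_g : D.src g = Sum.inl v
  k_e : k e' = e
  j_inj : Function.Injective j
  range_j : Set.range j = {v}ᶜ
  k_inj : Function.Injective k
  range_k : Set.range k = {g}ᶜ
  vlab_j : ∀ w, D.vlab (j w) = D'.vlab w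
  src_k : ∀ a, D.src (k a) = Sum.map j id (D'.src a)
  tgt_k : ∀ a, a ≠ e' → D.tgt (k a) = Sum.map j id (D'.tgt a)
  tgt_g : D.tgt g = Sum.map j id (D'.tgt e')
  lab_k : ∀ a, a ≠ e' → D.lab (k a) = D'.lab a
  isComp : IsComp (D.lab e) (D.lab g) (D'.lab e')

theorem erase_iff {D D' : Diagram I₀ I₁ S T} :
    Erase D D' ↔ ∃ v e g j k e', IsErase D D' v e g j k e' := by
  constructor
  · rintro ⟨v, e, g, j, k, e', h1, h2, h3, h4, h5, h6, h7, h8, h9, h10, h11, h12, h13⟩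
    exact ⟨v, e, g, j, k, e', h1, h2, h3, h4, h5, h6, h7, h8, h9, h10, h11, h12, h13⟩
  · rintro ⟨v, e, g, j, k, e', h1, h2, h3, h4, h5, h6, h7, h8, h9, h10, h11, h12, h13⟩
    exact ⟨v, e, g, j, k, e', h1, h2, h3, h4, h5, h6, h7, h8, h9, h10, h11, h12, h13⟩

open Classical in
/-- The last of the edges that are merged into an edge. -/
noncomputable def lastEdge {D D' : Diagram I₀ I₁ S T} (g : D.E) (k : D'.E → D.E) (e' f : D'.E) :
    D.E :=
  if f = e' then g else k f

namespace IsErase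

variable {D D' : Diagram I₀ I₁ S T} {v : D.V} {e g : D.E} {j : D'.V → D.V} {k : D'.E → D.E}
  {e' : D'.E}

theorem k_ne (h : IsErase D D' v e g j k e') (a : D'.E) : k a ≠ g := by
  have : k a ∈ Set.range k := ⟨a, rfl⟩
  rw [h.range_k] at this
  exact this

theorem e_ne_g (h : IsErase D D' v e g j k e') : e ≠ g := h.k_e ▸ h.k_ne e'

theorem exists_k (h : IsErase D D' v e g j k e') {a : D.E} (ha : a ≠ g) : ∃ b, k b = a := by
  have : a ∈ Set.range k := by
    rw [h.range_k]
    exact ha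
  exact this

theorem map_j_injective (h : IsErase D D' v e g j k e') :
    Function.Injective (Sum.map j id : D'.V ⊕ Bd S T → D.V ⊕ Bd S T) :=
  h.j_inj.sumMap Function.injective_id

theorem map_j_ne (h : IsErase D D' v e g j k e') (x : D'.V ⊕ Bd S T) :
    Sum.map j id x ≠ Sum.inl v := by
  rcases x with w | b
  · have : j w ∈ Set.range j := ⟨w, rfl⟩
    rw [h.range_j] at this
    simpa using this
  · simp

theorem tgt_eq_src (h : IsErase D D' v e g j k e') : D.tgt e = D.src g :=
  h.tgt_e.trans h.src_g.symm

theorem tgt_lastEdge (h : IsErase D D' v e g j k e') (f : D'.E) :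
    D.tgt (lastEdge g k e' f) = Sum.map j id (D'.tgt f) := by
  unfold lastEdge
  split_ifs with hf
  · rw [hf, h.tgt_g]
  · exact h.tgt_k f hf

theorem exists_lastEdge (h : IsErase D D' v e g j k e') {f : D.E} (hf : f ≠ e) :
    ∃ f', f = lastEdge g k e' f' := by
  by_cases hg : f = g
  · exact ⟨e', by simp [lastEdge, hg]⟩
  · obtain ⟨b, rfl⟩ := h.exists_k hg
    refine ⟨b, ?_⟩
    rw [lastEdge, if_neg]
    rintro rfl
    exact hf h.k_e

/-- Extend a walk that arrives at an edge of `D'` by the edge `g`, if necessary. -/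
theorem walk_last (h : IsErase D D' v e g j k e') {K : Set D.E} (hg : g ∉ K) {s : D.E} {f : D'.E}
    {a b x : Arrow C} (hw : f = e' → Walk D K s e a) (hw' : f ≠ e' → Walk D K s (k f) x)
    (hab : f = e' → IsComp b (D'.lab e') x ∧ IsComp b (D.lab e) a) :
    Walk D K s (lastEdge g k e' f) x := by
  unfold lastEdge
  split_ifs with hf
  · obtain ⟨h1, h2⟩ := hab hf
    obtain ⟨ab, h3, h4⟩ := h.isComp.assoc_symm h1
    obtain rfl := h2.unique h3
    exact (hw hf).step h.tgt_eq_src hg h4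
  · exact hw' hf

/-- Each passage through the merged edge `e'` is expanded into the two steps `e`, `g`; `lastEdge` is
where the expanded walk stands. -/
theorem walk_of_walk (h : IsErase D D' v e g j k e') {K : Set D.E} (hg : g ∉ K) {a f : D'.E}
    {x : Arrow C} (hw : Walk D' (k ⁻¹' K) a f x) : Walk D K (k a) (lastEdge g k e' f) x := by
  induction hw with
  | start =>
    unfold lastEdge
    split_ifs with ha
    · subst ha
      rw [h.k_e]
      exact Walk.start.step h.tgt_eq_src hg h.isComp
    · rw [← h.lab_k a ha]
      exact .start
  | @step f f₁ y z _ h1 h2 h3 ih =>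
    have h4 : D.tgt (lastEdge g k e' f) = D.src (k f₁) := by
      rw [h.tgt_lastEdge, h1, h.src_k]
    obtain ⟨b, hb, hw⟩ := ih.exists_step h4 h2
    refine h.walk_last hg (a := b) (b := y) ?_ ?_ ?_
    · rintro rfl
      rwa [← h.k_e]
    · intro hf
      rw [h.lab_k _ hf] at hb
      rwa [h3.unique hb]
    · rintro rfl
      rw [← h.k_e]
      exact ⟨h3, hb⟩

/-- A walk in `D` may pause at `e`, between the two merged edges, where no walk of `D'` can end. The
second clause is the induction hypothesis for that position: it describes the walk as completed by
`g`. -/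
theorem walk_imp (h : IsErase D D' v e g j k e') {K : Set D.E} {a : D'.E} {f : D.E}
    {x : Arrow C} (hw : Walk D K (k a) f x) :
    (∀ f', f = lastEdge g k e' f' → Walk D' (k ⁻¹' K) a f' x) ∧
      (f = e → ∀ y, IsComp x (D.lab g) y → Walk D' (k ⁻¹' K) a e' y) := by
  induction hw with
  | start =>
    constructor
    · intro f' hf'
      unfold lastEdge at hf'
      split_ifs at hf' with hfe
      · exact absurd hf' (h.k_ne a)
      · obtain rfl := h.k_inj hf'
        rw [h.lab_k a hfe]
        exact .start
    · intro ha y hy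
      have hae : a = e' := h.k_inj (ha.trans h.k_e.symm)
      subst hae
      rw [h.k_e] at hy
      rw [← h.isComp.unique hy]
      exact .start
  | @step f f₁ y z hw h1 h2 h3 ih =>
    have key : f₁ ≠ g → ∃ f', k f' = f₁ ∧ ∃ f₀, f = lastEdge g k e' f₀ ∧ D'.tgt f₀ = D'.src f' := by
      intro hne
      obtain ⟨f', rfl⟩ := h.exists_k hne
      have hfe : f ≠ e := by
        rintro rfl
        exact hne (D.src_inj (h1.symm.trans h.tgt_eq_src))
      obtain ⟨f₀, rfl⟩ := h.exists_lastEdge hfe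
      refine ⟨f', rfl, f₀, rfl, h.map_j_injective ?_⟩
      rw [← h.src_k, ← h1, h.tgt_lastEdge]
    constructor
    · rintro f' rfl
      by_cases hf' : f' = e'
      · have hl : lastEdge g k e' f' = g := by simp [lastEdge, hf']
        rw [hl] at h1 h3
        rw [hf']
        exact ih.2 (D.tgt_inj (h1.trans h.tgt_eq_src.symm)) _ h3
      · have hl : lastEdge g k e' f' = k f' := by simp [lastEdge, hf']
        rw [hl] at key h2 h3
        obtain ⟨f'', hf'', f₀, hf₀, h4⟩ := key (h.k_ne _)
        obtain rfl := h.k_inj hf''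
        exact (ih.1 _ hf₀).step h4 h2 (by rwa [← h.lab_k _ hf'])
    · rintro rfl w hw
      obtain ⟨f'', hf'', f₀, hf₀, h4⟩ := key h.e_ne_g
      obtain rfl := h.k_inj (hf''.trans h.k_e.symm)
      obtain ⟨bc, h5, h6⟩ := h3.assoc hw
      rw [h5.unique h.isComp] at h6
      exact (ih.1 _ hf₀).step h4 (by simpa [h.k_e] using h2) h6

/-- The condition `g ∉ K` is what allows the expanded walk to enter `g`. The edge `e` may lie in
`K`: it is then only used as a starting edge. -/
theorem walk_iff (h : IsErase D D' v e g j k e') {K : Set D.E} (hg : g ∉ K) {a f : D'.E}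
    {x : Arrow C} :
    Walk D' (k ⁻¹' K) a f x ↔ Walk D K (k a) (lastEdge g k e' f) x :=
  ⟨h.walk_of_walk hg, fun hw => (h.walk_imp hw).1 _ rfl⟩

end IsErase

/-- A point of a diagram other than a given vertex, as a point of the diagram without it. -/
def stripPt {A B : Type} (v : A) : (x : A ⊕ B) → x ≠ Sum.inl v → {w // w ≠ v} ⊕ B
  | Sum.inl w, h => Sum.inl ⟨w, fun hw => h (congrArg Sum.inl hw)⟩
  | Sum.inr b, _ => Sum.inr b

theorem map_stripPt {A B : Type} (v : A) (x : A ⊕ B) (h : x ≠ Sum.inl v) :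
    Sum.map Subtype.val id (stripPt v x h) = x := by
  rcases x with x | x <;> rfl

theorem map_val_injective {A B : Type} (p : A → Prop) :
    Function.Injective (Sum.map Subtype.val id : {w // p w} ⊕ B → A ⊕ B) :=
  Subtype.val_injective.sumMap Function.injective_id

theorem stripPt_eq_iff {A B : Type} (v : A) (x : A ⊕ B) (h : x ≠ Sum.inl v)
    (y : {w // w ≠ v} ⊕ B) : stripPt v x h = y ↔ x = Sum.map Subtype.val id y := by
  rw [← (map_val_injective _).eq_iff, map_stripPt]

/-- A vertex where two different edges meet can be erased. -/
theorem exists_isErase (D : Diagram I₀ I₁ S T) {v : D.V} {e g : D.E} (he : D.tgt e = Sum.inl v)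
    (hg : D.src g = Sum.inl v) (hne : e ≠ g) :
    ∃ (D' : Diagram I₀ I₁ S T) (j : D'.V → D.V) (k : D'.E → D.E) (e' : D'.E),
      IsErase D D' v e g j k e' := by
  classical
  have := D.finite_V
  have := D.finite_E
  obtain ⟨c, hc⟩ := exists_isComp (D.lab_comm (he.trans hg.symm))
  -- The edge `e` absorbs `g`: it keeps its own source and takes over the target of `g`. As `e ≠ g`,
  -- the circle with a single vertex is excluded.
  let t : D.E → D.V ⊕ Bd S T := fun a => if a = e then D.tgt g else D.tgt a
  have hs : ∀ a : {a // a ≠ g}, D.src a ≠ Sum.inl v := fun a h =>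
    a.2 (D.src_inj (h.trans hg.symm))
  have ht : ∀ a : {a // a ≠ g}, t a ≠ Sum.inl v := by
    intro a h
    simp only [t] at h
    split_ifs at h with h'
    · exact hne (D.tgt_inj (he.trans h.symm))
    · exact h' (D.tgt_inj (h.trans he.symm))
  have ht' : ∀ x, x ≠ Sum.inl v → ((∃ a : {a // a ≠ g}, t a = x) ↔ ∃ a, D.tgt a = x) := by
    intro x hx
    constructor
    · rintro ⟨a, ha⟩
      simp only [t] at ha
      split_ifs at ha with h'
      exacts [⟨g, ha⟩, ⟨a, ha⟩]
    · rintro ⟨a, ha⟩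
      by_cases hag : a = g
      · exact ⟨⟨e, hne⟩, by simp [t, ← ha, hag]⟩
      · refine ⟨⟨a, hag⟩, ?_⟩
        simp only [t]
        rw [if_neg, ha]
        rintro rfl
        exact hx (ha.symm.trans he)
  have hs' : ∀ x, x ≠ Sum.inl v → ((∃ a : {a // a ≠ g}, D.src a = x) ↔ ∃ a, D.src a = x) := by
    intro x hx
    constructor
    · rintro ⟨a, ha⟩
      exact ⟨a, ha⟩
    · rintro ⟨a, ha⟩
      refine ⟨⟨a, ?_⟩, ha⟩
      rintro rfl
      exact hx (ha.symm.trans hg)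
  let l : D.E → Arrow C := fun a => if a = e then c else D.lab a
  have hv : ∀ (w : {w // w ≠ v}), (Sum.inl w.1 : D.V ⊕ Bd S T) ≠ Sum.inl v := fun w h =>
    w.2 (Sum.inl_injective h)
  let D' : Diagram I₀ I₁ S T :=
    { V := {w // w ≠ v}
      E := {a // a ≠ g}
      finite_V := inferInstance
      finite_E := inferInstance
      vlab := fun w => D.vlab w
      src := fun a => stripPt v (D.src a) (hs a)
      tgt := fun a => stripPt v (t a) (ht a)
      lab := fun a => l a
      lab_left := by
        intro a
        have h1 : (l a).left = (D.lab a).left := by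
          simp only [l]
          split_ifs with h
          · rw [h, hc.left_eq]
          · rfl
        rw [h1, D.lab_left]
        conv_lhs => rw [← map_stripPt v _ (hs a)]
        rcases stripPt v (D.src a) (hs a) with w | b <;> rfl
      lab_right := by
        intro a
        have h1 : (l a).right = Sum.elim D.vlab Bd.ob (t a) := by
          simp only [l, t]
          split_ifs with h
          · rw [hc.right_eq, D.lab_right]
          · rw [D.lab_right]
        rw [h1]
        conv_lhs => rw [← map_stripPt v _ (ht a)]
        rcases stripPt v (t a) (ht a) with w | b <;> rfl
      src_inj := by
        intro a b hab
        rw [stripPt_eq_iff, map_stripPt] at hab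
        exact Subtype.ext (D.src_inj hab)
      tgt_inj := by
        intro a b hab
        rw [stripPt_eq_iff, map_stripPt] at hab
        have h1 := a.2
        have h2 := b.2
        simp only [t] at hab
        split_ifs at hab with h3 h4 h4
        · exact Subtype.ext (h3.trans h4.symm)
        · exact absurd (D.tgt_inj hab).symm h2
        · exact absurd (D.tgt_inj hab) h1
        · exact Subtype.ext (D.tgt_inj hab)
      bd_src := by
        intro b
        simp only [stripPt_eq_iff, Sum.map_inr, id]
        rw [hs' _ (by simp), D.bd_src]
      bd_tgt := by
        intro b
        simp only [stripPt_eq_iff, Sum.map_inr, id]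
        rw [ht' _ (by simp), D.bd_tgt]
      not_isolated := by
        intro w
        simp only [stripPt_eq_iff, Sum.map_inl]
        rw [hs' _ (hv w), ht' _ (hv w)]
        exact D.not_isolated w
      start_mem := by
        intro a w ha hw
        simp only [stripPt_eq_iff, Sum.map_inl] at ha
        have h1 : I₀.mem (D.lab a).hom := by
          refine D.start_mem a w ha fun a' ha' => ?_
          obtain ⟨b, hb⟩ := (ht' _ (hv w)).2 ⟨a', ha'⟩
          exact hw b ((stripPt_eq_iff _ _ _ _).2 hb)
        -- If the merged edge starts at an inner endpoint, so did `e`; a left ideal is stable under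
        -- the further composition with the label of `g`.
        by_cases h : a.1 = e
        · rw [h] at h1
          rw [show l a = c from if_pos h]
          obtain ⟨X, Y, Z, β, γ, h2, h3, rfl⟩ := hc
          rw [h2] at h1
          exact I₀.comp_mem β γ h1
        · rwa [show l a = D.lab a from if_neg h]
      end_mem := by
        intro a w ha hw
        simp only [stripPt_eq_iff, Sum.map_inl] at ha
        have hw' : ∀ e', D.src e' ≠ Sum.inl w.1 := fun a' ha' => by
          obtain ⟨b, hb⟩ := (hs' _ (hv w)).2 ⟨a', ha'⟩
          exact hw b ((stripPt_eq_iff _ _ _ _).2 hb)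
        -- If the merged edge ends at an inner endpoint, so did `g`; here the right ideal absorbs
        -- the label of `e`.
        by_cases h : a.1 = e
        · rw [show t a = D.tgt g from if_pos h] at ha
          rw [show l a = c from if_pos h]
          have h1 := D.end_mem _ _ ha hw'
          obtain ⟨X, Y, Z, β, γ, h2, h3, rfl⟩ := hc
          rw [h3] at h1
          exact I₁.comp_mem β γ h1
        · rw [show t a = D.tgt a from if_neg h] at ha
          rw [show l a = D.lab a from if_neg h]
          exact D.end_mem _ _ ha hw' }
  refine ⟨D', Subtype.val, Subtype.val, ⟨e, hne⟩, he, hg, rfl, Subtype.val_injective, ?_,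
    Subtype.val_injective, ?_, fun _ => rfl, ?_, ?_, ?_, ?_, ?_⟩
  · exact Subtype.range_val
  · exact Subtype.range_val
  · intro a
    exact (map_stripPt v _ (hs a)).symm
  · intro a ha
    have h1 : t a = D.tgt a := if_neg fun h => ha (Subtype.ext h)
    exact h1.symm.trans (map_stripPt v _ (ht a)).symm
  · have h1 : t e = D.tgt g := if_pos rfl
    exact h1.symm.trans (map_stripPt v _ (ht ⟨e, hne⟩)).symm
  · intro a ha
    exact (if_neg fun h => ha (Subtype.ext h) : l a = D.lab a).symm
  · have h1 : l e = c := if_pos rfl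
    change IsComp _ _ (l e)
    rwa [h1]

/-! ### Erasing many vertices -/

/-- A walk from an edge of `K` to an edge outside `K` has a first step, and every edge entered by a
step avoids `K`. -/
theorem Walk.exists_next {D : Diagram I₀ I₁ S T} {K : Set D.E} {e g : D.E} {a : Arrow C}
    (h : Walk D K e g a) (he : e ∈ K) (hg : g ∉ K) : ∃ g', g' ∉ K ∧ D.tgt e = D.src g' := by
  induction h with
  | start => exact absurd he hg
  | @step f g _ _ hw h1 h2 _ ih =>
    by_cases hf : f ∈ K
    · cases hw with
      | start => exact ⟨g, hg, h1⟩
      | step _ _ h3 _ => exact absurd hf h3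
    · exact ih hf

theorem card_lt_of_injective (D : Diagram I₀ I₁ S T) {E : Type}
    {g : D.E} (k : E → D.E) (hk : Function.Injective k) (hg : ∀ a, k a ≠ g) :
    Nat.card E < Nat.card D.E := by
  have := D.finite_E
  have := Finite.of_injective k hk
  have := Fintype.ofFinite E
  have := Fintype.ofFinite D.E
  rw [Nat.card_eq_fintype_card, Nat.card_eq_fintype_card]
  exact Fintype.card_lt_of_injective_not_surjective k hk fun h => (h g).elim hg

/-- Here `k a` is the first of the edges of `D` that are to be merged into `a`, and `Set.range k`
acts as the stop set, so that a walk never runs into the next merged edge. By `hV` the vertices to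
be erased are those where an edge starts that is not a first edge. Induction on the number of edges
of `D`: erasing one vertex preserves all the hypotheses, by `IsErase.walk_iff`. -/
theorem sim_of_merge (D D' : Diagram I₀ I₁ S T) (j : D'.V → D.V)
    (k : D'.E → D.E) (hj : Function.Injective j)
    (hV : ∀ v, v ∈ Set.range j ↔ ∀ g, D.src g = Sum.inl v → g ∈ Set.range k)
    (hl : ∀ w, D.vlab (j w) = D'.vlab w)
    (hs : ∀ a, D.src (k a) = Sum.map j id (D'.src a))
    (ht : ∀ a, ∃ f, Walk D (Set.range k) (k a) f (D'.lab a) ∧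
      D.tgt f = Sum.map j id (D'.tgt a))
    (hc : ∀ g, ∃ a x, Walk D (Set.range k) (k a) g x) :
    Sim D D' := by
  have hk : Function.Injective k := fun a b hab => D'.src_inj <|
    (hj.sumMap Function.injective_id) <| (hs a).symm.trans ((congrArg D.src hab).trans (hs b))
  generalize hn : Nat.card D.E = n
  induction n using Nat.strong_induction_on generalizing D with
  | _ n ih =>
  by_cases hsurj : Function.Surjective k
  · have hjs : Function.Surjective j := fun v => (hV v).2 fun g _ => hsurj g
    -- Every edge now lies in the stop set, so no walk can take a step and the matching is an
    -- isomorphism.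
    have hw : ∀ {e f x}, Walk D (Set.range k) e f x → f = e ∧ x = D.lab e := by
      intro e f x h
      cases h with
      | start => exact ⟨rfl, rfl⟩
      | step _ _ h _ => exact absurd (hsurj _) h
    refine (Iso.sim ⟨Equiv.ofBijective j ⟨hj, hjs⟩, Equiv.ofBijective k ⟨hk, hsurj⟩, hl, hs,
      ?_, ?_⟩).symm
    · intro a
      obtain ⟨f, h1, h2⟩ := ht a
      rw [(hw h1).1] at h2
      exact h2
    · intro a
      obtain ⟨f, h1, h2⟩ := ht a
      exact (hw h1).2.symm
  · obtain ⟨g₀, hg₀⟩ := not_forall.1 hsurj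
    obtain ⟨a₀, x₀, hx₀⟩ := hc g₀
    -- The walk from `k a₀` to `g₀` leaves the range of `k` at its first step. The vertex crossed
    -- there is the one to erase, and `k a₀` absorbs `g`.
    obtain ⟨g, hg, hag⟩ := hx₀.exists_next ⟨a₀, rfl⟩ hg₀
    obtain ⟨v, hv⟩ := D.tgt_ne_bd_src hag
    have hne : k a₀ ≠ g := fun h => hg ⟨a₀, h⟩
    obtain ⟨D₁, j₁, k₁, e', h⟩ := D.exists_isErase (hag.trans hv) hv hne
    have hvj : ∀ w, j w ≠ v := fun w hw => hg ((hV v).1 ⟨w, hw⟩ g hv)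
    have hj' : ∀ w, ∃ w', j₁ w' = j w := fun w => by
      have : j w ∈ Set.range j₁ := by
        rw [h.range_j]
        exact hvj w
      exact this
    choose j' hj' using hj'
    choose k' hk' using fun a => h.exists_k (a := k a) fun h => hg ⟨a, h⟩
    -- The stop set pulled back to `D₁` is again the set of first edges, so that the walks required
    -- by the induction hypothesis are those given by `walk_iff`.
    have hK : k₁ ⁻¹' Set.range k = Set.range k' := by
      ext a
      constructor
      · rintro ⟨b, hb⟩
        exact ⟨b, h.k_inj ((hk' b).trans hb)⟩
      · rintro ⟨b, rfl⟩
        exact ⟨b, (hk' b).symm⟩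
    have hmap : ∀ x, Sum.map j id x = (Sum.map j₁ id (Sum.map j' id x) : D.V ⊕ Bd S T) := by
      rintro (x | x)
      · simp [hj']
      · rfl
    have hlt : Nat.card D₁.E < Nat.card D.E := D.card_lt_of_injective k₁ h.k_inj h.k_ne
    refine (Erase.sim (erase_iff.2 ⟨_, _, _, _, _, _, h⟩)).trans ?_
    refine ih _ (hn ▸ hlt) D₁ j' k' ?_ ?_ ?_ ?_ ?_ ?_ ?_ rfl
    · intro a b hab
      apply hj
      rw [← hj', ← hj', hab]
    · intro w
      have h1 : w ∈ Set.range j' ↔ j₁ w ∈ Set.range j := by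
        constructor
        · rintro ⟨b, rfl⟩
          exact ⟨b, (hj' b).symm⟩
        · rintro ⟨b, hb⟩
          exact ⟨b, h.j_inj ((hj' b).trans hb)⟩
      rw [h1, hV, ← hK]
      constructor
      · intro h2 a ha
        apply h2
        rw [h.src_k, ha]
        rfl
      · intro h2 a ha
        have hag : a ≠ g := by
          rintro rfl
          exact h.map_j_ne (Sum.inl w) (ha.symm.trans hv)
        obtain ⟨b, rfl⟩ := h.exists_k hag
        apply h2
        apply h.map_j_injective
        rw [← h.src_k, ha]
        rfl
    · intro w
      rw [← h.vlab_j, hj', hl]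
    · intro a
      apply h.map_j_injective
      rw [← hmap, ← h.src_k, hk', hs]
    · intro a
      obtain ⟨f, h1, h2⟩ := ht a
      -- A walk that realises a whole edge of `D'` ends at a surviving point, hence not at the
      -- erased vertex `v`.
      have hfe : f ≠ k a₀ := by
        rintro rfl
        rw [hag, hv] at h2
        rw [hmap] at h2
        exact h.map_j_ne _ h2.symm
      obtain ⟨f', rfl⟩ := h.exists_lastEdge hfe
      refine ⟨f', ?_, ?_⟩
      · rw [← hK, h.walk_iff hg, hk']
        exact h1
      · apply h.map_j_injective
        rw [← h.tgt_lastEdge, h2, hmap]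
    · intro g₁
      obtain ⟨a, x, h1⟩ := hc (lastEdge g k₁ e' g₁)
      refine ⟨a, x, ?_⟩
      rw [← hK, h.walk_iff hg, hk']
      exact h1
    · intro a b hab
      apply hk
      rw [← hk', ← hk', hab]

end Diagram

end BrauerCat
-- Permutation diagrams act by renaming the boundary
namespace BrauerCat

namespace Diagram

variable {C : Type u} [Category.{v} C] {I₀ : LeftIdeal C} {I₁ : RightIdeal C}
variable {S T U S' T' : List (C × Bool)}

/-! ### Changing the boundary -/

theorem map_id_eq_inl {A B B' : Type} (f : B → B') (x : A ⊕ B) (v : A) :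
    Sum.map id f x = Sum.inl v ↔ x = Sum.inl v := by
  rcases x with x | x <;> simp

theorem map_id_eq_inr {A B B' : Type} (σ : B ≃ B') (x : A ⊕ B) (b : B) :
    Sum.map id σ x = Sum.inr (σ b) ↔ x = Sum.inr b := by
  rcases x with x | x <;> simp

/-- The diagram with its boundary points renamed. -/
def relabel (D : Diagram I₀ I₁ S T) (σ : Bd S T ≃ Bd S' T') (hob : ∀ b, (σ b).ob = b.ob)
    (hst : ∀ b, (σ b).starts = b.starts) : Diagram I₀ I₁ S' T' where
  V := D.V
  E := D.E
  finite_V := D.finite_V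
  finite_E := D.finite_E
  vlab := D.vlab
  src e := Sum.map id σ (D.src e)
  tgt e := Sum.map id σ (D.tgt e)
  lab := D.lab
  lab_left e := by
    rw [D.lab_left]
    rcases D.src e with v | b
    · rfl
    · exact (hob b).symm
  lab_right e := by
    rw [D.lab_right]
    rcases D.tgt e with v | b
    · rfl
    · exact (hob b).symm
  src_inj := (Function.injective_id.sumMap σ.injective).comp D.src_inj
  tgt_inj := (Function.injective_id.sumMap σ.injective).comp D.tgt_inj
  bd_src b := by
    obtain ⟨b, rfl⟩ := σ.surjective b
    simp only [map_id_eq_inr]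
    rw [D.bd_src, hst]
  bd_tgt b := by
    obtain ⟨b, rfl⟩ := σ.surjective b
    simp only [map_id_eq_inr]
    rw [D.bd_tgt, hst]
  not_isolated v := by
    simp only [map_id_eq_inl]
    exact D.not_isolated v
  start_mem e v := by
    simp only [map_id_eq_inl, ne_eq]
    exact D.start_mem e v
  end_mem e v := by
    simp only [map_id_eq_inl, ne_eq]
    exact D.end_mem e v

/-- The diagram without inner vertices, with identity-labelled strands that go from the bottom
to the top. -/
def perm {E : Type} [Finite E] (p : E ≃ Fin S.length) (q : E ≃ Fin T.length)
    (h : ∀ e, S.get (p e) = T.get (q e)) : Diagram I₀ I₁ S T :=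
  wiring E (fun e => Sum.inl (p e)) (fun e => Sum.inr (q e))
    (by
      have : (Sum.elim (fun e => Sum.inl (p e)) (fun e => Sum.inr (q e)) : E ⊕ E → Bd S T) =
          p.sumCongr q := by
        ext (x | x) <;> rfl
      rw [this]
      exact Equiv.bijective _)
    (fun e => congrArg Prod.fst (h e)) (fun e => congrArg (fun x : C × Bool => !x.2) (h e).symm)

theorem top_of_src (D : Diagram I₀ I₁ S T) {e : D.E} {t : Fin T.length}
    (h : D.src e = Sum.inr (Sum.inr t)) : (T.get t).2 = false := by
  simpa [Bd.starts] using (D.bd_src _).1 ⟨e, h⟩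

theorem top_of_tgt (D : Diagram I₀ I₁ S T) {e : D.E} {t : Fin T.length}
    (h : D.tgt e = Sum.inr (Sum.inr t)) : (T.get t).2 = true := by
  simpa [Bd.starts] using (D.bd_tgt _).1 ⟨e, h⟩

theorem bot_of_src (D : Diagram I₀ I₁ S T) {e : D.E} {s : Fin S.length}
    (h : D.src e = Sum.inr (Sum.inl s)) : (S.get s).2 = true :=
  (D.bd_src _).1 ⟨e, h⟩

theorem bot_of_tgt (D : Diagram I₀ I₁ S T) {e : D.E} {s : Fin S.length}
    (h : D.tgt e = Sum.inr (Sum.inl s)) : (S.get s).2 = false :=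
  (D.bd_tgt _).1 ⟨e, h⟩

theorem exists_src_top (D : Diagram I₀ I₁ S T) {t : Fin T.length} (h : (T.get t).2 = false) :
    ∃ e, D.src e = Sum.inr (Sum.inr t) :=
  (D.bd_src _).2 (by change (!(T.get t).2) = _; rw [h]; rfl)

theorem exists_tgt_top (D : Diagram I₀ I₁ S T) {t : Fin T.length} (h : (T.get t).2 = true) :
    ∃ e, D.tgt e = Sum.inr (Sum.inr t) :=
  (D.bd_tgt _).2 (by change (!(T.get t).2) = _; rw [h]; rfl)

theorem exists_src_bot (D : Diagram I₀ I₁ S T) {s : Fin S.length} (h : (S.get s).2 = true) :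
    ∃ e, D.src e = Sum.inr (Sum.inl s) :=
  (D.bd_src _).2 h

theorem exists_tgt_bot (D : Diagram I₀ I₁ S T) {s : Fin S.length} (h : (S.get s).2 = false) :
    ∃ e, D.tgt e = Sum.inr (Sum.inl s) :=
  (D.bd_tgt _).2 h

/-- A diagram without inner vertices that consists of identity-labelled strands from the bottom to
the top. -/
structure IsPerm (P : Diagram I₀ I₁ S T) (p : P.E ≃ Fin S.length) (q : P.E ≃ Fin T.length) :
    Prop where
  isEmpty : IsEmpty P.V
  get_eq : ∀ e, S.get (p e) = T.get (q e)
  src_true : ∀ e, (S.get (p e)).2 = true → P.src e = Sum.inr (Sum.inl (p e))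
  tgt_true : ∀ e, (S.get (p e)).2 = true → P.tgt e = Sum.inr (Sum.inr (q e))
  src_false : ∀ e, (S.get (p e)).2 = false → P.src e = Sum.inr (Sum.inr (q e))
  tgt_false : ∀ e, (S.get (p e)).2 = false → P.tgt e = Sum.inr (Sum.inl (p e))
  lab_eq : ∀ e, P.lab e = Arrow.mk (𝟙 (S.get (p e)).1)

theorem isPerm_perm {E : Type} [Finite E] (p : E ≃ Fin S.length) (q : E ≃ Fin T.length)
    (h : ∀ e, S.get (p e) = T.get (q e)) :
    IsPerm (perm (I₀ := I₀) (I₁ := I₁) p q h) p q where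
  isEmpty := inferInstanceAs (IsEmpty Empty)
  get_eq := h
  src_true _ he := congrArg Sum.inr (if_pos he)
  tgt_true _ he := congrArg Sum.inr (if_pos he)
  src_false _ he := congrArg Sum.inr (if_neg (Bool.eq_false_iff.1 he))
  tgt_false _ he := congrArg Sum.inr (if_neg (Bool.eq_false_iff.1 he))
  lab_eq _ := rfl

/-- Renaming the points at the top. -/
def relabelTop (D : Diagram I₀ I₁ S T) (σ : Fin T.length ≃ Fin U.length)
    (h : ∀ t, U.get (σ t) = T.get t) : Diagram I₀ I₁ S U :=
  D.relabel ((Equiv.refl _).sumCongr σ)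
    (by
      rintro (b | b)
      · rfl
      · exact congrArg Prod.fst (h b))
    (by
      rintro (b | b)
      · rfl
      · exact congrArg (fun x => !x.2) (h b))

/-- Renaming the points at the bottom. -/
def relabelBot (D : Diagram I₀ I₁ T U) (σ : Fin T.length ≃ Fin S.length)
    (h : ∀ t, S.get (σ t) = T.get t) : Diagram I₀ I₁ S U :=
  D.relabel (σ.sumCongr (Equiv.refl _))
    (by
      rintro (b | b)
      · exact congrArg Prod.fst (h b)
      · rfl)
    (by
      rintro (b | b)
      · exact congrArg Prod.snd (h b)
      · rfl)

theorem IsPerm.symm_get {P : Diagram I₀ I₁ S T} {p : P.E ≃ Fin S.length} {q : P.E ≃ Fin T.length}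
    (h : IsPerm P p q) (s : Fin S.length) : T.get (p.symm.trans q s) = S.get s := by
  have := h.get_eq (p.symm s)
  rw [Equiv.apply_symm_apply] at this
  exact this.symm

theorem IsPerm.symm_get' {P : Diagram I₀ I₁ S T} {p : P.E ≃ Fin S.length} {q : P.E ≃ Fin T.length}
    (h : IsPerm P p q) (t : Fin T.length) : S.get (q.symm.trans p t) = T.get t := by
  have := h.get_eq (q.symm t)
  rw [Equiv.apply_symm_apply] at this
  exact this

/-- Each strand of `P` prolongs exactly one end of a strand of `D` by an identity label. Merging the
two edges leaves the labels of `D` unchanged and moves the end from `t` to the partner of `t`. -/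
theorem glue_perm (D : Diagram I₀ I₁ S T) {P : Diagram I₀ I₁ T U} {p : P.E ≃ Fin T.length}
    {q : P.E ≃ Fin U.length} (h : IsPerm P p q) :
    Sim (D.glue P) (D.relabelTop (p.symm.trans q) h.symm_get) := by
  have := h.isEmpty
  -- The first edge of each merged chain. An edge of `D` that starts at a point of `T` is now
  -- preceded by the strand of `P` that runs down to this point.
  let k : D.E → (D.glue P).E := fun e => match D.src e with
    | Sum.inr (Sum.inr t) => Sum.inr (p.symm t)
    | _ => Sum.inl e
  have hk_top : ∀ {e t}, D.src e = Sum.inr (Sum.inr t) → k e = Sum.inr (p.symm t) := by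
    intro e t het
    simp only [k, het]
    rfl
  have hk_ne : ∀ {e}, (∀ t, D.src e ≠ Sum.inr (Sum.inr t)) → k e = Sum.inl e := by
    intro e het
    rcases hs : D.src e with a | a | a
    · simp only [k, hs]
      rfl
    · simp only [k, hs]
      rfl
    · exact absurd hs (het a)
  clear_value k
  have hK_inl : ∀ {e t}, D.src e = Sum.inr (Sum.inr t) →
      (Sum.inl e : (D.glue P).E) ∉ Set.range k := by
    rintro e t het ⟨a, ha⟩
    by_cases hat : ∃ t, D.src a = Sum.inr (Sum.inr t)
    · obtain ⟨t', hat⟩ := hat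
      rw [hk_top hat] at ha
      exact absurd ha Sum.inr_ne_inl
    · push Not at hat
      rw [hk_ne hat] at ha
      obtain rfl := Sum.inl_injective ha
      exact hat _ het
  have hK_inr : ∀ {ε}, (T.get (p ε)).2 = true → (Sum.inr ε : (D.glue P).E) ∉ Set.range k := by
    rintro ε hε ⟨a, ha⟩
    by_cases hat : ∃ t, D.src a = Sum.inr (Sum.inr t)
    · obtain ⟨t', hat⟩ := hat
      rw [hk_top hat] at ha
      obtain rfl := Sum.inr_injective ha
      have := D.top_of_src hat
      simp_all
    · push Not at hat
      rw [hk_ne hat] at ha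
      exact absurd ha Sum.inl_ne_inr
  have hw : ∀ a, Walk (D.glue P) (Set.range k) (k a) (Sum.inl a) (D.lab a) := by
    intro a
    by_cases hat : ∃ t, D.src a = Sum.inr (Sum.inr t)
    · obtain ⟨t, hat⟩ := hat
      have hsg := D.top_of_src hat
      rw [hk_top hat]
      have hl : (D.glue P).lab (Sum.inr (p.symm t)) = Arrow.mk (𝟙 (T.get t).1) := by
        refine (h.lab_eq _).trans ?_
        rw [Equiv.apply_symm_apply]
      refine (Walk.start (D := D.glue P) (K := Set.range k)).step (g := Sum.inl a) ?_ (hK_inl hat) ?_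
      · change upper (P.tgt (p.symm t)) = lower (D.src a)
        rw [hat, h.tgt_false _ (by simpa using hsg)]
        simp [upper, lower]
      · rw [hl]
        refine IsComp.id_left ?_
        change (D.lab a).left = _
        rw [D.lab_left, hat]
        rfl
    · push Not at hat
      rw [hk_ne hat]
      exact .start
  have hw' : ∀ a t, D.tgt a = Sum.inr (Sum.inr t) →
      Walk (D.glue P) (Set.range k) (k a) (Sum.inr (p.symm t)) (D.lab a) := by
    intro a t hat
    have hsg := D.top_of_tgt hat
    have hl : (D.glue P).lab (Sum.inr (p.symm t)) = Arrow.mk (𝟙 (T.get t).1) := by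
      refine (h.lab_eq _).trans ?_
      rw [Equiv.apply_symm_apply]
    refine (hw a).step (g := Sum.inr (p.symm t)) ?_ (hK_inr (by simpa using hsg)) ?_
    · change lower (D.tgt a) = upper (P.src (p.symm t))
      rw [hat, h.src_true _ (by simpa using hsg)]
      simp [upper, lower]
    · rw [hl]
      refine IsComp.id_right ?_
      rw [D.lab_right, hat]
      rfl
  refine sim_of_merge _ _ (fun v => Sum.inl (Sum.inl v)) k ?_ ?_ (fun _ => rfl) ?_ ?_ ?_
  · exact Sum.inl_injective.comp Sum.inl_injective
  · rintro ((v | v) | t)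
    · refine ⟨fun _ => ?_, fun _ => ⟨v, rfl⟩⟩
      rintro (e | ε) he
      · change lower (D.src e) = _ at he
        refine ⟨e, hk_ne fun t ht => ?_⟩
        rw [ht] at he
        exact absurd (Sum.inl_injective he) Sum.inr_ne_inl
      · change upper (P.src ε) = _ at he
        rcases hs : P.src ε with x | x | x
        · exact isEmptyElim x
        · rw [hs] at he
          exact absurd (Sum.inl_injective he) Sum.inr_ne_inl
        · rw [hs] at he
          exact absurd he Sum.inr_ne_inl
    · exact isEmptyElim v
    -- Points of `T` do not survive: the edge that starts there, in `D` or in `P` according to the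
    -- sign, is not a first edge.
    · refine ⟨fun ⟨w, hw⟩ => absurd hw Sum.inl_ne_inr, fun hK => ?_⟩
      cases hsg : (T.get t).2
      · obtain ⟨e, he⟩ := D.exists_src_top hsg
        refine absurd (hK (Sum.inl e) ?_) (hK_inl he)
        change lower (D.src e) = _
        rw [he]
        rfl
      · refine absurd (hK (Sum.inr (p.symm t)) ?_) (hK_inr (by simpa using hsg))
        change upper (P.src (p.symm t)) = _
        rw [h.src_true _ (by simpa using hsg)]
        simp [upper]
        rfl
  · intro (a : D.E)
    change _ = Sum.map _ id (Sum.map id _ (D.src a))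
    rcases hs : D.src a with w | b | t
    · rw [hk_ne (by simp [hs])]
      change lower (D.src a) = _
      rw [hs]
      rfl
    · rw [hk_ne (by simp [hs])]
      change lower (D.src a) = _
      rw [hs]
      rfl
    · rw [hk_top hs]
      change upper (P.src (p.symm t)) = _
      rw [h.src_false _ (by simpa using D.top_of_src hs)]
      rfl
  · intro (a : D.E)
    change ∃ f, Walk _ _ _ _ (D.lab a) ∧ _ = Sum.map _ id (Sum.map id _ (D.tgt a))
    rcases hs : D.tgt a with w | b | t
    · refine ⟨Sum.inl a, hw a, ?_⟩
      change lower (D.tgt a) = _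
      rw [hs]
      rfl
    · refine ⟨Sum.inl a, hw a, ?_⟩
      change lower (D.tgt a) = _
      rw [hs]
      rfl
    · refine ⟨Sum.inr (p.symm t), hw' a t hs, ?_⟩
      change upper (P.tgt (p.symm t)) = _
      rw [h.tgt_true _ (by simpa using D.top_of_tgt hs)]
      rfl
  · rintro (e | ε)
    · exact ⟨e, _, hw e⟩
    -- For the sign `-` the strand of `P` is the first edge of a chain; for `+` it is appended to
    -- the edge of `D` that ends at its lower point.
    · cases hsg : (T.get (p ε)).2
      · obtain ⟨e, he⟩ := D.exists_src_top hsg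
        have hke := hk_top he
        rw [Equiv.symm_apply_apply] at hke
        refine ⟨e, (D.glue P).lab (k e), ?_⟩
        rw [hke]
        exact .start
      · obtain ⟨e, he⟩ := D.exists_tgt_top hsg
        have hwe := hw' e _ he
        rw [Equiv.symm_apply_apply] at hwe
        exact ⟨e, _, hwe⟩

/-- The mirror image of `glue_perm`: now the strands of sign `+` precede the edges of `D`, and those
of sign `-` follow them. -/
theorem perm_glue {P : Diagram I₀ I₁ S T} {p : P.E ≃ Fin S.length} {q : P.E ≃ Fin T.length}
    (h : IsPerm P p q) (D : Diagram I₀ I₁ T U) :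
    Sim (P.glue D) (D.relabelBot (q.symm.trans p) h.symm_get') := by
  have := h.isEmpty
  let k : D.E → (P.glue D).E := fun e => match D.src e with
    | Sum.inr (Sum.inl t) => Sum.inl (q.symm t)
    | _ => Sum.inr e
  have hk_top : ∀ {e t}, D.src e = Sum.inr (Sum.inl t) → k e = Sum.inl (q.symm t) := by
    intro e t het
    simp only [k, het]
    rfl
  have hk_ne : ∀ {e}, (∀ t, D.src e ≠ Sum.inr (Sum.inl t)) → k e = Sum.inr e := by
    intro e het
    rcases hs : D.src e with a | a | a
    · simp only [k, hs]
      rfl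
    · exact absurd hs (het a)
    · simp only [k, hs]
      rfl
  clear_value k
  have hK_inl : ∀ {e t}, D.src e = Sum.inr (Sum.inl t) →
      (Sum.inr e : (P.glue D).E) ∉ Set.range k := by
    rintro e t het ⟨a, ha⟩
    by_cases hat : ∃ t, D.src a = Sum.inr (Sum.inl t)
    · obtain ⟨t', hat⟩ := hat
      rw [hk_top hat] at ha
      exact absurd ha Sum.inl_ne_inr
    · push Not at hat
      rw [hk_ne hat] at ha
      obtain rfl := Sum.inr_injective ha
      exact hat _ het
  have hK_inr : ∀ {ε}, (T.get (q ε)).2 = false → (Sum.inl ε : (P.glue D).E) ∉ Set.range k := by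
    rintro ε hε ⟨a, ha⟩
    by_cases hat : ∃ t, D.src a = Sum.inr (Sum.inl t)
    · obtain ⟨t', hat⟩ := hat
      rw [hk_top hat] at ha
      obtain rfl := Sum.inl_injective ha
      have := D.bot_of_src hat
      simp_all
    · push Not at hat
      rw [hk_ne hat] at ha
      exact absurd ha Sum.inr_ne_inl
  have hw : ∀ a, Walk (P.glue D) (Set.range k) (k a) (Sum.inr a) (D.lab a) := by
    intro a
    by_cases hat : ∃ t, D.src a = Sum.inr (Sum.inl t)
    · obtain ⟨t, hat⟩ := hat
      have hsg := D.bot_of_src hat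
      rw [hk_top hat]
      have hl : (P.glue D).lab (Sum.inl (q.symm t)) = Arrow.mk (𝟙 (T.get t).1) := by
        refine (h.lab_eq _).trans ?_
        rw [h.get_eq, Equiv.apply_symm_apply]
      refine (Walk.start (D := P.glue D) (K := Set.range k)).step (g := Sum.inr a) ?_ (hK_inl hat) ?_
      · change lower (P.tgt (q.symm t)) = upper (D.src a)
        rw [hat, h.tgt_true _ (by rw [h.get_eq]; simpa using hsg)]
        simp [lower, upper]
      · rw [hl]
        refine IsComp.id_left ?_
        change (D.lab a).left = _
        rw [D.lab_left, hat]
        rfl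
    · push Not at hat
      rw [hk_ne hat]
      exact .start
  have hw' : ∀ a t, D.tgt a = Sum.inr (Sum.inl t) →
      Walk (P.glue D) (Set.range k) (k a) (Sum.inl (q.symm t)) (D.lab a) := by
    intro a t hat
    have hsg := D.bot_of_tgt hat
    have hl : (P.glue D).lab (Sum.inl (q.symm t)) = Arrow.mk (𝟙 (T.get t).1) := by
      refine (h.lab_eq _).trans ?_
      rw [h.get_eq, Equiv.apply_symm_apply]
    refine (hw a).step (g := Sum.inl (q.symm t)) ?_ (hK_inr (by simpa using hsg)) ?_
    · change upper (D.tgt a) = lower (P.src (q.symm t))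
      rw [hat, h.src_false _ (by rw [h.get_eq]; simpa using hsg)]
      simp [lower, upper]
    · rw [hl]
      refine IsComp.id_right ?_
      rw [D.lab_right, hat]
      rfl
  refine sim_of_merge _ _ (fun v => Sum.inl (Sum.inr v)) k ?_ ?_ (fun _ => rfl) ?_ ?_ ?_
  · exact Sum.inl_injective.comp Sum.inr_injective
  · rintro ((v | v) | t)
    · exact isEmptyElim v
    · refine ⟨fun _ => ?_, fun _ => ⟨v, rfl⟩⟩
      rintro (ε | e) he
      · change lower (P.src ε) = _ at he
        rcases hs : P.src ε with x | x | x
        · exact isEmptyElim x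
        · rw [hs] at he
          exact absurd he Sum.inr_ne_inl
        · rw [hs] at he
          exact absurd (Sum.inl_injective he) Sum.inr_ne_inl
      · change upper (D.src e) = _ at he
        refine ⟨e, hk_ne fun t ht => ?_⟩
        rw [ht] at he
        exact absurd (Sum.inl_injective he) Sum.inr_ne_inl
    · refine ⟨fun ⟨w, hw⟩ => absurd hw Sum.inl_ne_inr, fun hK => ?_⟩
      cases hsg : (T.get t).2
      · refine absurd (hK (Sum.inl (q.symm t)) ?_) (hK_inr (by simpa using hsg))
        change lower (P.src (q.symm t)) = _
        rw [h.src_false _ (by rw [h.get_eq]; simpa using hsg)]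
        simp [lower]
        rfl
      · obtain ⟨e, he⟩ := D.exists_src_bot hsg
        refine absurd (hK (Sum.inr e) ?_) (hK_inl he)
        change upper (D.src e) = _
        rw [he]
        rfl
  · intro (a : D.E)
    change _ = Sum.map _ id (Sum.map id _ (D.src a))
    rcases hs : D.src a with w | t | b
    · rw [hk_ne (by simp [hs])]
      change upper (D.src a) = _
      rw [hs]
      rfl
    · rw [hk_top hs]
      change lower (P.src (q.symm t)) = _
      rw [h.src_true _ (by rw [h.get_eq]; simpa using D.bot_of_src hs)]
      rfl
    · rw [hk_ne (by simp [hs])]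
      change upper (D.src a) = _
      rw [hs]
      rfl
  · intro (a : D.E)
    change ∃ f, Walk _ _ _ _ (D.lab a) ∧ _ = Sum.map _ id (Sum.map id _ (D.tgt a))
    rcases hs : D.tgt a with w | t | b
    · refine ⟨Sum.inr a, hw a, ?_⟩
      change upper (D.tgt a) = _
      rw [hs]
      rfl
    · refine ⟨Sum.inl (q.symm t), hw' a t hs, ?_⟩
      change lower (P.tgt (q.symm t)) = _
      rw [h.tgt_false _ (by rw [h.get_eq]; simpa using D.bot_of_tgt hs)]
      rfl
    · refine ⟨Sum.inr a, hw a, ?_⟩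
      change upper (D.tgt a) = _
      rw [hs]
      rfl
  · rintro (ε | e)
    · cases hsg : (T.get (q ε)).2
      · obtain ⟨e, he⟩ := D.exists_tgt_bot hsg
        have hwe := hw' e _ he
        rw [Equiv.symm_apply_apply] at hwe
        exact ⟨e, _, hwe⟩
      · obtain ⟨e, he⟩ := D.exists_src_bot hsg
        have hke := hk_top he
        rw [Equiv.symm_apply_apply] at hke
        refine ⟨e, (P.glue D).lab (k e), ?_⟩
        rw [hke]
        exact .start
    · exact ⟨e, _, hw e⟩

end Diagram

end BrauerCat
-- Associativity, interchange and calculus of permutation diagrams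
namespace BrauerCat

section Positions

variable {C : Type u} {S T S' T' : List (C × Bool)}

/-- The juxtaposition of two bijections. -/
def sideEquiv (σ : Fin S.length ≃ Fin T.length) (τ : Fin S'.length ≃ Fin T'.length) :
    Fin (S ++ S').length ≃ Fin (T ++ T').length :=
  (pos S S').symm.trans ((σ.sumCongr τ).trans (pos T T'))

theorem sideEquiv_symm_trans {E E' : Type} (p : E ≃ Fin S.length) (q : E ≃ Fin T.length)
    (p' : E' ≃ Fin S'.length) (q' : E' ≃ Fin T'.length) :
    ((p.sumCongr p').trans (pos S S')).symm.trans ((q.sumCongr q').trans (pos T T')) =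
      sideEquiv (p.symm.trans q) (p'.symm.trans q') := by
  ext x
  obtain ⟨x | x, rfl⟩ := (pos S S').surjective x <;> simp [sideEquiv]

end Positions

namespace Diagram

variable {C : Type u} [Category.{v} C] {I₀ : LeftIdeal C} {I₁ : RightIdeal C}
variable {S T U S' T' U' : List (C × Bool)}

/-! ### Axioms of a monoidal category -/

/-- No vertex has to be erased: both bracketings have the same edges, and the points of `T` and `U`
are inner vertices in both. Only the disjoint unions are regrouped. -/
theorem glue_assoc {W : List (C × Bool)} (D₁ : Diagram I₀ I₁ S T) (D₂ : Diagram I₀ I₁ T U)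
    (D₃ : Diagram I₀ I₁ U W) : Iso ((D₁.glue D₂).glue D₃) (D₁.glue (D₂.glue D₃)) := by
  let j : ((((D₁.V ⊕ D₂.V) ⊕ Fin T.length) ⊕ D₃.V) ⊕ Fin U.length) ≃
      ((D₁.V ⊕ ((D₂.V ⊕ D₃.V) ⊕ Fin U.length)) ⊕ Fin T.length) :=
    { toFun := fun x => match x with
        | Sum.inl (Sum.inl (Sum.inl (Sum.inl a))) => Sum.inl (Sum.inl a)
        | Sum.inl (Sum.inl (Sum.inl (Sum.inr a))) => Sum.inl (Sum.inr (Sum.inl (Sum.inl a)))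
        | Sum.inl (Sum.inl (Sum.inr a)) => Sum.inr a
        | Sum.inl (Sum.inr a) => Sum.inl (Sum.inr (Sum.inl (Sum.inr a)))
        | Sum.inr a => Sum.inl (Sum.inr (Sum.inr a))
      invFun := fun x => match x with
        | Sum.inl (Sum.inl a) => Sum.inl (Sum.inl (Sum.inl (Sum.inl a)))
        | Sum.inl (Sum.inr (Sum.inl (Sum.inl a))) => Sum.inl (Sum.inl (Sum.inl (Sum.inr a)))
        | Sum.inr a => Sum.inl (Sum.inl (Sum.inr a))
        | Sum.inl (Sum.inr (Sum.inl (Sum.inr a))) => Sum.inl (Sum.inr a)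
        | Sum.inl (Sum.inr (Sum.inr a)) => Sum.inr a
      left_inv := by rintro ((((a | a) | a) | a) | a) <;> rfl
      right_inv := by rintro ((a | ((a | a) | a)) | a) <;> rfl }
  have h₁ : ∀ x : D₁.V ⊕ Bd S T, (lower x : ((D₁.V ⊕ (D₂.glue D₃).V) ⊕ _) ⊕ Bd S W) =
      Sum.map j id (lower (lower x : ((D₁.V ⊕ D₂.V) ⊕ _) ⊕ Bd S U)) := by
    rintro (a | a | a) <;> rfl
  have h₂ : ∀ x : D₂.V ⊕ Bd T U, (upper (lower x : ((D₂.V ⊕ D₃.V) ⊕ _) ⊕ Bd T W) :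
      ((D₁.V ⊕ (D₂.glue D₃).V) ⊕ _) ⊕ Bd S W) =
      Sum.map j id (lower (upper x : ((D₁.V ⊕ D₂.V) ⊕ _) ⊕ Bd S U)) := by
    rintro (a | a | a) <;> rfl
  have h₃ : ∀ x : D₃.V ⊕ Bd U W, (upper (upper x : ((D₂.V ⊕ D₃.V) ⊕ _) ⊕ Bd T W) :
      ((D₁.V ⊕ (D₂.glue D₃).V) ⊕ _) ⊕ Bd S W) =
      Sum.map j id (upper x : (((D₁.glue D₂).V ⊕ D₃.V) ⊕ _) ⊕ Bd S W) := by
    rintro (a | a | a) <;> rfl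
  refine ⟨j, Equiv.sumAssoc _ _ _, ?_, ?_, ?_, ?_⟩
  · rintro ((((a | a) | a) | a) | a) <;> rfl
  · rintro ((e | e) | e)
    exacts [h₁ _, h₂ _, h₃ _]
  · rintro ((e | e) | e)
    exacts [h₁ _, h₂ _, h₃ _]
  · rintro ((e | e) | e) <;> rfl

/-- Again a regrouping of disjoint unions; the points of `T ++ T'` where the right-hand side is
glued are split by `pos` into those of `T` and of `T'`. -/
theorem side_glue_side (D₁ : Diagram I₀ I₁ S T) (D₂ : Diagram I₀ I₁ T U)
    (D₁' : Diagram I₀ I₁ S' T') (D₂' : Diagram I₀ I₁ T' U') :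
    Iso ((D₁.glue D₂).side (D₁'.glue D₂')) ((D₁.side D₁').glue (D₂.side D₂')) := by
  let j : (((D₁.V ⊕ D₂.V) ⊕ Fin T.length) ⊕ ((D₁'.V ⊕ D₂'.V) ⊕ Fin T'.length)) ≃
      (((D₁.V ⊕ D₁'.V) ⊕ (D₂.V ⊕ D₂'.V)) ⊕ Fin (T ++ T').length) :=
    (Equiv.sumSumSumComm _ _ _ _).trans
      ((Equiv.sumSumSumComm _ _ _ _).sumCongr (pos T T'))
  have h₁ : ∀ x : D₁.V ⊕ Bd S T,
      (lower (sidePt D₁.V D₁'.V S T S' T' (Sum.inl x)) :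
        ((_ ⊕ (D₂.side D₂').V) ⊕ _) ⊕ Bd (S ++ S') (U ++ U')) =
      Sum.map j id (sidePt (D₁.glue D₂).V (D₁'.glue D₂').V S U S' U' (Sum.inl (lower x))) := by
    rintro (a | a | a) <;> rfl
  have h₂ : ∀ x : D₂.V ⊕ Bd T U,
      (upper (sidePt D₂.V D₂'.V T U T' U' (Sum.inl x)) :
        (((D₁.side D₁').V ⊕ _) ⊕ _) ⊕ Bd (S ++ S') (U ++ U')) =
      Sum.map j id (sidePt (D₁.glue D₂).V (D₁'.glue D₂').V S U S' U' (Sum.inl (upper x))) := by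
    rintro (a | a | a) <;> rfl
  have h₃ : ∀ x : D₁'.V ⊕ Bd S' T',
      (lower (sidePt D₁.V D₁'.V S T S' T' (Sum.inr x)) :
        ((_ ⊕ (D₂.side D₂').V) ⊕ _) ⊕ Bd (S ++ S') (U ++ U')) =
      Sum.map j id (sidePt (D₁.glue D₂).V (D₁'.glue D₂').V S U S' U' (Sum.inr (lower x))) := by
    rintro (a | a | a) <;> rfl
  have h₄ : ∀ x : D₂'.V ⊕ Bd T' U',
      (upper (sidePt D₂.V D₂'.V T U T' U' (Sum.inr x)) :
        (((D₁.side D₁').V ⊕ _) ⊕ _) ⊕ Bd (S ++ S') (U ++ U')) =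
      Sum.map j id (sidePt (D₁.glue D₂).V (D₁'.glue D₂').V S U S' U' (Sum.inr (upper x))) := by
    rintro (a | a | a) <;> rfl
  refine ⟨j, Equiv.sumSumSumComm _ _ _ _, ?_, ?_, ?_, ?_⟩
  · rintro (((a | a) | a) | ((a | a) | a))
    · rfl
    · rfl
    · exact congrArg Prod.fst (get_pos_inl T T' a)
    · rfl
    · rfl
    · exact congrArg Prod.fst (get_pos_inr T T' a)
  · rintro ((e | e) | (e | e))
    exacts [h₁ _, h₂ _, h₃ _, h₄ _]
  · rintro ((e | e) | (e | e))
    exacts [h₁ _, h₂ _, h₃ _, h₄ _]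
  · rintro ((e | e) | (e | e)) <;> rfl

/-! ### Permutation diagrams -/

/-- A bijection between the points at the bottom and those at the top is realised by a diagram,
if the diagram is equivalent to identity-labelled strands that join the corresponding points. -/
def Realises (D : Diagram I₀ I₁ S T) (σ : Fin S.length ≃ Fin T.length) : Prop :=
  ∃ (P : Diagram I₀ I₁ S T) (p : P.E ≃ Fin S.length) (q : P.E ≃ Fin T.length),
    IsPerm P p q ∧ p.symm.trans q = σ ∧ Sim D P

/-- The bijection fixes the ends of every strand, and the signs fix its direction, so nothing else
is left to compare. -/
theorem IsPerm.iso {P P' : Diagram I₀ I₁ S T} {p : P.E ≃ Fin S.length} {q : P.E ≃ Fin T.length}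
    {p' : P'.E ≃ Fin S.length} {q' : P'.E ≃ Fin T.length} (h : IsPerm P p q)
    (h' : IsPerm P' p' q') (hσ : p.symm.trans q = p'.symm.trans q') : Iso P P' := by
  have := h.isEmpty
  have := h'.isEmpty
  have hp : ∀ e, p' (p.trans p'.symm e) = p e := fun e => by simp
  have hq : ∀ e, q' (p.trans p'.symm e) = q e := fun e => by
    have := Equiv.congr_fun hσ (p e)
    simpa using this.symm
  refine ⟨Equiv.equivOfIsEmpty _ _, p.trans p'.symm, isEmptyElim, ?_, ?_, ?_⟩
  · intro e
    cases hs : (S.get (p e)).2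
    · rw [h.src_false e hs, h'.src_false _ (by rwa [hp]), hq]
      rfl
    · rw [h.src_true e hs, h'.src_true _ (by rwa [hp]), hp]
      rfl
  · intro e
    cases hs : (S.get (p e)).2
    · rw [h.tgt_false e hs, h'.tgt_false _ (by rwa [hp]), hp]
      rfl
    · rw [h.tgt_true e hs, h'.tgt_true _ (by rwa [hp]), hq]
      rfl
  · intro e
    rw [h.lab_eq, h'.lab_eq, hp]

/-- This turns coherence into combinatorics: diagrams assembled from identities, reassociations and
swaps are equivalent once their bijections agree. -/
theorem Realises.sim {D D' : Diagram I₀ I₁ S T} {σ σ' : Fin S.length ≃ Fin T.length}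
    (h : Realises D σ) (h' : Realises D' σ') (hσ : σ = σ') : Sim D D' := by
  subst hσ
  obtain ⟨P, p, q, hP, hσ, hs⟩ := h
  obtain ⟨P', p', q', hP', hσ', hs'⟩ := h'
  exact hs.trans ((hP.iso hP' (hσ.trans hσ'.symm)).sim.trans hs'.symm)

theorem realises_perm {E : Type} [Finite E] (p : E ≃ Fin S.length) (q : E ≃ Fin T.length)
    (h : ∀ e, S.get (p e) = T.get (q e)) :
    Realises (perm (I₀ := I₀) (I₁ := I₁) p q h) (p.symm.trans q) :=
  ⟨_, _, _, isPerm_perm p q h, rfl, .refl _⟩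

theorem realises_ident (S : List (C × Bool)) :
    Realises (ident (I₀ := I₀) (I₁ := I₁) S) (Equiv.refl _) :=
  realises_perm (Equiv.refl _) (Equiv.refl _) fun _ => rfl

theorem realises_swap (S T : List (C × Bool)) :
    Realises (swap (I₀ := I₀) (I₁ := I₁) S T)
      ((pos S T).symm.trans ((Equiv.sumComm _ _).trans (pos T S))) :=
  realises_perm (pos S T) ((Equiv.sumComm _ _).trans (pos T S)) (by
    rintro (i | j)
    · exact (get_pos_inl S T i).trans (get_pos_inr T S i).symm
    · exact (get_pos_inr S T j).trans (get_pos_inl T S j).symm)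

theorem IsPerm.relabelTop {P : Diagram I₀ I₁ S T} {p : P.E ≃ Fin S.length}
    {q : P.E ≃ Fin T.length} (h : IsPerm P p q) (σ : Fin T.length ≃ Fin U.length)
    (hσ : ∀ t, U.get (σ t) = T.get t) : IsPerm (P.relabelTop σ hσ) p (q.trans σ) where
  isEmpty := h.isEmpty
  get_eq e := (h.get_eq e).trans (hσ _).symm
  src_true e he := congrArg (Sum.map id _) (h.src_true e he)
  tgt_true e he := congrArg (Sum.map id _) (h.tgt_true e he)
  src_false e he := congrArg (Sum.map id _) (h.src_false e he)
  tgt_false e he := congrArg (Sum.map id _) (h.tgt_false e he)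
  lab_eq := h.lab_eq

theorem Realises.glue {D : Diagram I₀ I₁ S T} {D' : Diagram I₀ I₁ T U}
    {σ : Fin S.length ≃ Fin T.length} {τ : Fin T.length ≃ Fin U.length} (h : Realises D σ)
    (h' : Realises D' τ) : Realises (D.glue D') (σ.trans τ) := by
  obtain ⟨P, p, q, hP, rfl, hs⟩ := h
  obtain ⟨P', p', q', hP', rfl, hs'⟩ := h'
  exact ⟨_, _, _, hP.relabelTop _ _, rfl, (hs.glue hs').trans (glue_perm P hP')⟩

theorem IsPerm.side {P : Diagram I₀ I₁ S T} {p : P.E ≃ Fin S.length} {q : P.E ≃ Fin T.length}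
    {P' : Diagram I₀ I₁ S' T'} {p' : P'.E ≃ Fin S'.length} {q' : P'.E ≃ Fin T'.length}
    (h : IsPerm P p q) (h' : IsPerm P' p' q') :
    IsPerm (P.side P') ((p.sumCongr p').trans (pos S S')) ((q.sumCongr q').trans (pos T T')) := by
  have := h.isEmpty
  have := h'.isEmpty
  have hl : ∀ e, (S ++ S').get (((p.sumCongr p').trans (pos S S')) (Sum.inl e)) = S.get (p e) :=
    fun e => get_pos_inl _ _ _
  have hr : ∀ e, (S ++ S').get (((p.sumCongr p').trans (pos S S')) (Sum.inr e)) = S'.get (p' e) :=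
    fun e => get_pos_inr _ _ _
  refine ⟨inferInstanceAs (IsEmpty (P.V ⊕ P'.V)), ?_, ?_, ?_, ?_, ?_, ?_⟩
  · rintro (e | e)
    · exact (hl e).trans ((h.get_eq e).trans (get_pos_inl _ _ _).symm)
    · exact (hr e).trans ((h'.get_eq e).trans (get_pos_inr _ _ _).symm)
  · rintro (e | e) he
    · exact congrArg (fun x => sidePt _ _ _ _ _ _ (Sum.inl x)) (h.src_true e (hl e ▸ he))
    · exact congrArg (fun x => sidePt _ _ _ _ _ _ (Sum.inr x)) (h'.src_true e (hr e ▸ he))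
  · rintro (e | e) he
    · exact congrArg (fun x => sidePt _ _ _ _ _ _ (Sum.inl x)) (h.tgt_true e (hl e ▸ he))
    · exact congrArg (fun x => sidePt _ _ _ _ _ _ (Sum.inr x)) (h'.tgt_true e (hr e ▸ he))
  · rintro (e | e) he
    · exact congrArg (fun x => sidePt _ _ _ _ _ _ (Sum.inl x)) (h.src_false e (hl e ▸ he))
    · exact congrArg (fun x => sidePt _ _ _ _ _ _ (Sum.inr x)) (h'.src_false e (hr e ▸ he))
  · rintro (e | e) he
    · exact congrArg (fun x => sidePt _ _ _ _ _ _ (Sum.inl x)) (h.tgt_false e (hl e ▸ he))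
    · exact congrArg (fun x => sidePt _ _ _ _ _ _ (Sum.inr x)) (h'.tgt_false e (hr e ▸ he))
  · rintro (e | e)
    · exact (h.lab_eq e).trans (congrArg (fun x : C × Bool => Arrow.mk (𝟙 x.1)) (hl e).symm)
    · exact (h'.lab_eq e).trans (congrArg (fun x : C × Bool => Arrow.mk (𝟙 x.1)) (hr e).symm)

theorem Realises.side {D : Diagram I₀ I₁ S T} {D' : Diagram I₀ I₁ S' T'}
    {σ : Fin S.length ≃ Fin T.length} {τ : Fin S'.length ≃ Fin T'.length} (h : Realises D σ)
    (h' : Realises D' τ) : Realises (D.side D') (sideEquiv σ τ) := by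
  obtain ⟨P, p, q, hP, rfl, hs⟩ := h
  obtain ⟨P', p', q', hP', rfl, hs'⟩ := h'
  exact ⟨_, _, _, hP.side hP', sideEquiv_symm_trans p q p' q', hs.side hs'⟩

/-- A diagram commutes with permutation diagrams, up to the corresponding change of the boundary. -/
theorem glue_sim_glue {D : Diagram I₀ I₁ S T} {D' : Diagram I₀ I₁ S' T'}
    {Q : Diagram I₀ I₁ T T'} {P : Diagram I₀ I₁ S S'} {τ : Fin T.length ≃ Fin T'.length}
    {σ : Fin S.length ≃ Fin S'.length} (hQ : Realises Q τ) (hP : Realises P σ)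
    (j : D.V ≃ D'.V) (k : D.E ≃ D'.E) (hv : ∀ v, D'.vlab (j v) = D.vlab v)
    (hs : ∀ e, D'.src (k e) = Sum.map j (Sum.map σ τ) (D.src e))
    (ht : ∀ e, D'.tgt (k e) = Sum.map j (Sum.map σ τ) (D.tgt e))
    (hl : ∀ e, D'.lab (k e) = D.lab e) : Sim (D.glue Q) (P.glue D') := by
  obtain ⟨P, p, q, hP, rfl, hP'⟩ := hP
  obtain ⟨Q, p', q', hQ, rfl, hQ'⟩ := hQ
  refine (Sim.glue (.refl _) hQ').trans (.trans ?_ (Sim.glue hP' (.refl _)).symm)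
  -- Both composites become renamings, of the top of `D` on the left and of the bottom of `D'` on
  -- the right, and the given `j` and `k` are an isomorphism between the renamed diagrams.
  refine (glue_perm D hQ).trans (.trans (Iso.sim ?_) (perm_glue hP D').symm)
  have key : ∀ x : D.V ⊕ Bd S T, (Sum.map id ((q.symm.trans p).sumCongr (Equiv.refl _))
      (Sum.map j (Sum.map (p.symm.trans q) (p'.symm.trans q')) x) : D'.V ⊕ Bd S T') =
      Sum.map j id (Sum.map id ((Equiv.refl _).sumCongr (p'.symm.trans q')) x) := by
    rintro (x | x | x) <;> simp
  exact ⟨j, k, hv, fun e => (congrArg _ (hs e)).trans (key _),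
    fun e => (congrArg _ (ht e)).trans (key _), hl⟩

theorem glue_ident (D : Diagram I₀ I₁ S T) : Sim (D.glue (ident T)) D := by
  refine (glue_perm D (isPerm_perm (Equiv.refl _) (Equiv.refl _) fun _ => rfl)).trans (Iso.sim ?_)
  have key : ∀ x : D.V ⊕ Bd S T, x = Sum.map (Equiv.refl D.V) id
      (Sum.map id (Equiv.sumCongr (Equiv.refl _) ((Equiv.refl _).symm.trans (Equiv.refl _))) x) := by
    rintro (x | x | x) <;> rfl
  exact ⟨Equiv.refl _, Equiv.refl _, fun _ => rfl, fun e => key _, fun e => key _, fun _ => rfl⟩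

theorem ident_glue (D : Diagram I₀ I₁ S T) : Sim ((ident S).glue D) D := by
  refine (perm_glue (isPerm_perm (Equiv.refl _) (Equiv.refl _) fun _ => rfl) D).trans (Iso.sim ?_)
  have key : ∀ x : D.V ⊕ Bd S T, x = Sum.map (Equiv.refl D.V) id
      (Sum.map id (Equiv.sumCongr ((Equiv.refl _).symm.trans (Equiv.refl _)) (Equiv.refl _)) x) := by
    rintro (x | x | x) <;> rfl
  exact ⟨Equiv.refl _, Equiv.refl _, fun _ => rfl, fun e => key _, fun e => key _, fun _ => rfl⟩

end Diagram

end BrauerCat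
-- The strict symmetric monoidal category
namespace BrauerCat

section Positions

variable {C : Type u} (S T U : List (C × Bool))

theorem finCongr_pos_inl_inl (h : ((S ++ T) ++ U).length = (S ++ (T ++ U)).length)
    (i : Fin S.length) : finCongr h (pos (S ++ T) U (Sum.inl (pos S T (Sum.inl i)))) =
      pos S (T ++ U) (Sum.inl i) := rfl

theorem finCongr_pos_inl_inr (h : ((S ++ T) ++ U).length = (S ++ (T ++ U)).length)
    (i : Fin T.length) : finCongr h (pos (S ++ T) U (Sum.inl (pos S T (Sum.inr i)))) =
      pos S (T ++ U) (Sum.inr (pos T U (Sum.inl i))) := rfl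

/-- In the last block the two positions have the values `|S ++ T| + i` and `|S| + (|T| + i)`, which
are equal only by an argument; in the other blocks they agree by definition. -/
theorem finCongr_pos_inr (h : ((S ++ T) ++ U).length = (S ++ (T ++ U)).length)
    (i : Fin U.length) : finCongr h (pos (S ++ T) U (Sum.inr i)) =
      pos S (T ++ U) (Sum.inr (pos T U (Sum.inr i))) := by
  apply Fin.ext
  change (S ++ T).length + i.1 = S.length + (T.length + i.1)
  rw [List.length_append, Nat.add_assoc]

theorem finCongr_pos_inl (h : (S ++ (T ++ U)).length = ((S ++ T) ++ U).length)
    (i : Fin S.length) : finCongr h (pos S (T ++ U) (Sum.inl i)) =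
      pos (S ++ T) U (Sum.inl (pos S T (Sum.inl i))) := rfl

theorem finCongr_pos_inr_inl (h : (S ++ (T ++ U)).length = ((S ++ T) ++ U).length)
    (i : Fin T.length) : finCongr h (pos S (T ++ U) (Sum.inr (pos T U (Sum.inl i)))) =
      pos (S ++ T) U (Sum.inl (pos S T (Sum.inr i))) := rfl

theorem finCongr_pos_inr_inr (h : (S ++ (T ++ U)).length = ((S ++ T) ++ U).length)
    (i : Fin U.length) : finCongr h (pos S (T ++ U) (Sum.inr (pos T U (Sum.inr i)))) =
      pos (S ++ T) U (Sum.inr i) := by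
  rw [← finCongr_pos_inr S T U h.symm]
  rfl

/-- The bijection of positions that moves a sequence past another one. -/
def swapEquiv : Fin (S ++ T).length ≃ Fin (T ++ S).length :=
  (pos S T).symm.trans ((Equiv.sumComm _ _).trans (pos T S))

theorem swapEquiv_inl (i : Fin S.length) :
    swapEquiv S T (pos S T (Sum.inl i)) = pos T S (Sum.inr i) := by
  simp [swapEquiv]

theorem swapEquiv_inr (i : Fin T.length) :
    swapEquiv S T (pos S T (Sum.inr i)) = pos T S (Sum.inl i) := by
  simp [swapEquiv]

variable {S T U} {S' T' : List (C × Bool)}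

theorem sideEquiv_inl (σ : Fin S.length ≃ Fin T.length) (τ : Fin S'.length ≃ Fin T'.length)
    (i : Fin S.length) : sideEquiv σ τ (pos S S' (Sum.inl i)) = pos T T' (Sum.inl (σ i)) := by
  simp [sideEquiv]

theorem sideEquiv_inr (σ : Fin S.length ≃ Fin T.length) (τ : Fin S'.length ≃ Fin T'.length)
    (i : Fin S'.length) : sideEquiv σ τ (pos S S' (Sum.inr i)) = pos T T' (Sum.inr (τ i)) := by
  simp [sideEquiv]

theorem sideEquiv_refl :
    sideEquiv (Equiv.refl (Fin S.length)) (Equiv.refl (Fin T.length)) = Equiv.refl _ := by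
  ext x
  obtain ⟨x | x, rfl⟩ := (pos S T).surjective x
  · rw [sideEquiv_inl]; rfl
  · rw [sideEquiv_inr]; rfl

variable (S T U)

theorem swapEquiv_swapEquiv : (swapEquiv S T).trans (swapEquiv T S) = Equiv.refl _ := by
  ext x
  obtain ⟨x | x, rfl⟩ := (pos S T).surjective x
  · simp [swapEquiv_inl, swapEquiv_inr]
  · simp [swapEquiv_inl, swapEquiv_inr]

/-- Both routes are followed on each of the three blocks of positions. The casts stand for the
associators. -/
theorem swapEquiv_hexagon (h₁ h₂ h₃) :
    (finCongr h₁).trans ((swapEquiv S (T ++ U)).trans (finCongr h₂)) =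
      (sideEquiv (swapEquiv S T) (Equiv.refl (Fin U.length))).trans
        ((finCongr h₃).trans (sideEquiv (Equiv.refl (Fin T.length)) (swapEquiv S U))) := by
  ext x
  obtain ⟨x | x, rfl⟩ := (pos (S ++ T) U).surjective x
  · obtain ⟨x | x, rfl⟩ := (pos S T).surjective x
    · simp only [Equiv.trans_apply, finCongr_pos_inl_inl, swapEquiv_inl, sideEquiv_inl,
        finCongr_pos_inl_inr, sideEquiv_inr, finCongr_pos_inr]
    · simp only [Equiv.trans_apply, finCongr_pos_inl_inr, swapEquiv_inr, sideEquiv_inl,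
        finCongr_pos_inl_inl, Equiv.refl_apply]
  · simp only [Equiv.trans_apply, finCongr_pos_inr, swapEquiv_inr, sideEquiv_inr,
      finCongr_pos_inl_inr, Equiv.refl_apply]

theorem swapEquiv_hexagon_symm (h₁ h₂ h₃) :
    (finCongr h₁).trans ((swapEquiv (S ++ T) U).trans (finCongr h₂)) =
      (sideEquiv (Equiv.refl (Fin S.length)) (swapEquiv T U)).trans
        ((finCongr h₃).trans (sideEquiv (swapEquiv S U) (Equiv.refl (Fin T.length)))) := by
  ext x
  obtain ⟨x | x, rfl⟩ := (pos S (T ++ U)).surjective x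
  · simp only [Equiv.trans_apply, finCongr_pos_inl, swapEquiv_inl, sideEquiv_inl,
      finCongr_pos_inr_inl, Equiv.refl_apply]
  · obtain ⟨x | x, rfl⟩ := (pos T U).surjective x
    · simp only [Equiv.trans_apply, finCongr_pos_inr_inl, swapEquiv_inl, sideEquiv_inr,
        finCongr_pos_inr_inr, Equiv.refl_apply]
    · simp only [Equiv.trans_apply, finCongr_pos_inr_inr, swapEquiv_inr, sideEquiv_inr,
        finCongr_pos_inl, sideEquiv_inl, finCongr_pos_inr_inl]

end Positions

variable {C : Type u} [Category.{v} C] {I₀ : LeftIdeal C} {I₁ : RightIdeal C}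

namespace Diagram

variable {S T U S' T' U' : List (C × Bool)}

/-- Naturality of the associator. `P` and `Q` are arbitrary diagrams realising the reassociation of
positions, because the associator is an `eqToHom` and comes with no explicit diagram. -/
theorem side_assoc_sim (D : Diagram I₀ I₁ S S') (D' : Diagram I₀ I₁ T T')
    (D'' : Diagram I₀ I₁ U U') {Q : Diagram I₀ I₁ ((S' ++ T') ++ U') (S' ++ (T' ++ U'))}
    {P : Diagram I₀ I₁ ((S ++ T) ++ U) (S ++ (T ++ U))} {hQ hP} (hQ' : Realises Q (finCongr hQ))
    (hP' : Realises P (finCongr hP)) :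
    Sim (((D.side D').side D'').glue Q) (P.glue (D.side (D'.side D''))) := by
  have h₁ : ∀ x : D.V ⊕ Bd S S', sidePt D.V (D'.side D'').V S S' (T ++ U) (T' ++ U') (Sum.inl x) =
      Sum.map (Equiv.sumAssoc D.V D'.V D''.V) (Sum.map (finCongr hP) (finCongr hQ))
        (sidePt (D.side D').V D''.V (S ++ T) (S' ++ T') U U'
          (Sum.inl (sidePt D.V D'.V S S' T T' (Sum.inl x)))) := by
    rintro (x | x | x) <;> rfl
  have h₂ : ∀ x : D'.V ⊕ Bd T T', sidePt D.V (D'.side D'').V S S' (T ++ U) (T' ++ U')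
      (Sum.inr (sidePt D'.V D''.V T T' U U' (Sum.inl x))) =
      Sum.map (Equiv.sumAssoc D.V D'.V D''.V) (Sum.map (finCongr hP) (finCongr hQ))
        (sidePt (D.side D').V D''.V (S ++ T) (S' ++ T') U U'
          (Sum.inl (sidePt D.V D'.V S S' T T' (Sum.inr x)))) := by
    rintro (x | x | x) <;> rfl
  have h₃ : ∀ x : D''.V ⊕ Bd U U', sidePt D.V (D'.side D'').V S S' (T ++ U) (T' ++ U')
      (Sum.inr (sidePt D'.V D''.V T T' U U' (Sum.inr x))) =
      Sum.map (Equiv.sumAssoc D.V D'.V D''.V) (Sum.map (finCongr hP) (finCongr hQ))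
        (sidePt (D.side D').V D''.V (S ++ T) (S' ++ T') U U' (Sum.inr x)) := by
    rintro (x | x | x)
    · rfl
    · exact congrArg (fun i => Sum.inr (Sum.inl i)) (finCongr_pos_inr S T U hP x).symm
    · exact congrArg (fun i => Sum.inr (Sum.inr i)) (finCongr_pos_inr S' T' U' hQ x).symm
  refine glue_sim_glue hQ' hP' (Equiv.sumAssoc _ _ _) (Equiv.sumAssoc _ _ _) ?_ ?_ ?_ ?_
  · rintro ((a | a) | a) <;> rfl
  · rintro ((e | e) | e)
    exacts [h₁ _, h₂ _, h₃ _]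
  · rintro ((e | e) | e)
    exacts [h₁ _, h₂ _, h₃ _]
  · rintro ((e | e) | e) <;> rfl

/-- Exchanging the two summands of vertices and edges identifies the juxtapositions, once the blocks
of boundary points are exchanged too. -/
theorem side_swap_sim (D : Diagram I₀ I₁ S T) (D' : Diagram I₀ I₁ S' T') :
    Sim ((D.side D').glue (swap T T')) ((swap S S').glue (D'.side D)) := by
  have h₁ : ∀ x : D.V ⊕ Bd S T, sidePt D'.V D.V S' T' S T (Sum.inr x) =
      Sum.map (Equiv.sumComm D.V D'.V) (Sum.map (swapEquiv S S') (swapEquiv T T'))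
        (sidePt D.V D'.V S T S' T' (Sum.inl x)) := by
    rintro (x | x | x)
    · rfl
    · exact congrArg (fun i => Sum.inr (Sum.inl i)) (swapEquiv_inl S S' x).symm
    · exact congrArg (fun i => Sum.inr (Sum.inr i)) (swapEquiv_inl T T' x).symm
  have h₂ : ∀ x : D'.V ⊕ Bd S' T', sidePt D'.V D.V S' T' S T (Sum.inl x) =
      Sum.map (Equiv.sumComm D.V D'.V) (Sum.map (swapEquiv S S') (swapEquiv T T'))
        (sidePt D.V D'.V S T S' T' (Sum.inr x)) := by
    rintro (x | x | x)
    · rfl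
    · exact congrArg (fun i => Sum.inr (Sum.inl i)) (swapEquiv_inr S S' x).symm
    · exact congrArg (fun i => Sum.inr (Sum.inr i)) (swapEquiv_inr T T' x).symm
  refine glue_sim_glue (realises_swap _ _) (realises_swap _ _) (Equiv.sumComm _ _)
    (Equiv.sumComm _ _) ?_ ?_ ?_ ?_
  · rintro (a | a) <;> rfl
  · rintro (e | e)
    exacts [h₁ _, h₂ _]
  · rintro (e | e)
    exacts [h₁ _, h₂ _]
  · rintro (e | e) <;> rfl

theorem ident_side_sim (D : Diagram I₀ I₁ S T) {Q : Diagram I₀ I₁ ([] ++ T) T}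
    {P : Diagram I₀ I₁ ([] ++ S) S} {hQ hP} (hQ' : Realises Q (finCongr hQ))
    (hP' : Realises P (finCongr hP)) : Sim (((ident []).side D).glue Q) (P.glue D) := by
  have h₁ : ∀ x : D.V ⊕ Bd S T, x = Sum.map (Equiv.emptySum Empty D.V)
      (Sum.map (finCongr hP) (finCongr hQ)) (sidePt Empty D.V [] [] S T (Sum.inr x)) := by
    rintro (x | x | x)
    · rfl
    · exact congrArg (fun i => Sum.inr (Sum.inl i)) (Fin.ext (Nat.zero_add _).symm)
    · exact congrArg (fun i => Sum.inr (Sum.inr i)) (Fin.ext (Nat.zero_add _).symm)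
  refine glue_sim_glue hQ' hP' (Equiv.emptySum Empty _) (Equiv.emptySum (Fin 0) _) ?_ ?_ ?_ ?_
  · rintro (a | a)
    exacts [a.elim, rfl]
  · rintro (e | e)
    exacts [Fin.elim0 e, h₁ _]
  · rintro (e | e)
    exacts [Fin.elim0 e, h₁ _]
  · rintro (e | e)
    exacts [Fin.elim0 e, rfl]

theorem side_ident_sim (D : Diagram I₀ I₁ S T) {Q : Diagram I₀ I₁ (T ++ []) T}
    {P : Diagram I₀ I₁ (S ++ []) S} {hQ hP} (hQ' : Realises Q (finCongr hQ))
    (hP' : Realises P (finCongr hP)) : Sim ((D.side (ident [])).glue Q) (P.glue D) := by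
  have h₁ : ∀ x : D.V ⊕ Bd S T, x = Sum.map (Equiv.sumEmpty D.V Empty)
      (Sum.map (finCongr hP) (finCongr hQ)) (sidePt D.V Empty S T [] [] (Sum.inl x)) := by
    rintro (x | x | x) <;> rfl
  refine glue_sim_glue hQ' hP' (Equiv.sumEmpty _ Empty) (Equiv.sumEmpty _ (Fin 0)) ?_ ?_ ?_ ?_
  · rintro (a | a)
    exacts [rfl, a.elim]
  · rintro (e | e)
    exacts [h₁ _, Fin.elim0 e]
  · rintro (e | e)
    exacts [h₁ _, Fin.elim0 e]
  · rintro (e | e)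
    exacts [rfl, Fin.elim0 e]

end Diagram

open Diagram

theorem isCategory (I₀ : LeftIdeal C) (I₁ : RightIdeal C) : IsCategory I₀ I₁ :=
  ⟨{ catStruct I₀ I₁ with
      id_comp := by
        rintro X Y ⟨D⟩
        exact ident_glue D
      comp_id := by
        rintro X Y ⟨D⟩
        exact glue_ident D
      assoc := by
        rintro W X Y Z ⟨D₁⟩ ⟨D₂⟩ ⟨D₃⟩
        exact (glue_assoc D₁ D₂ D₃).sim }, rfl⟩

instance : Category.{max 1 u v} (BrauerCat I₀ I₁) := category (isCategory I₀ I₁)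

/-- A morphism that is represented by identity-labelled strands which join the points at the
bottom and at the top according to a given bijection. -/
def Hom.Realises {X Y : BrauerCat I₀ I₁} (f : X ⟶ Y)
    (σ : Fin (List.length X) ≃ Fin (List.length Y)) : Prop :=
  ∃ D : Diagram I₀ I₁ X Y, f = Hom.mk D ∧ Diagram.Realises D σ

theorem realises_id (X : BrauerCat I₀ I₁) : Hom.Realises (𝟙 X) (Equiv.refl _) :=
  ⟨_, rfl, realises_ident X⟩

/-- Links the abstract `eqToHom` to diagrams: transport along an equality of sequences keeps the
value of each position. -/
theorem realises_eqToHom {X Y : BrauerCat I₀ I₁} (h : X = Y) :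
    Hom.Realises (eqToHom h) (finCongr (congrArg List.length h)) := by
  subst h
  exact realises_id X

theorem Hom.Realises.comp {X Y Z : BrauerCat I₀ I₁} {f : X ⟶ Y} {g : Y ⟶ Z} {σ τ}
    (hf : Hom.Realises f σ) (hg : Hom.Realises g τ) : Hom.Realises (f ≫ g) (σ.trans τ) := by
  obtain ⟨D, rfl, hD⟩ := hf
  obtain ⟨D', rfl, hD'⟩ := hg
  exact ⟨_, rfl, hD.glue hD'⟩

theorem Hom.Realises.tensor {X Y X' Y' : BrauerCat I₀ I₁} {f : X ⟶ Y} {g : X' ⟶ Y'} {σ τ}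
    (hf : Hom.Realises f σ) (hg : Hom.Realises g τ) :
    Hom.Realises (Hom.tensor f g) (sideEquiv σ τ) := by
  obtain ⟨D, rfl, hD⟩ := hf
  obtain ⟨D', rfl, hD'⟩ := hg
  exact ⟨_, rfl, hD.side hD'⟩

theorem Hom.Realises.ext {X Y : BrauerCat I₀ I₁} {f g : X ⟶ Y} {σ τ}
    (hf : Hom.Realises f σ) (hg : Hom.Realises g τ) (h : σ = τ) : f = g := by
  obtain ⟨D, rfl, hD⟩ := hf
  obtain ⟨D', rfl, hD'⟩ := hg
  exact hD.sim hD' h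

theorem tensor_comp_tensor {X Y Z X' Y' Z' : BrauerCat I₀ I₁} (f : X ⟶ Y) (g : X' ⟶ Y')
    (f' : Y ⟶ Z) (g' : Y' ⟶ Z') :
    (show tensor X X' ⟶ tensor Y Y' from Hom.tensor f g) ≫
      (show tensor Y Y' ⟶ tensor Z Z' from Hom.tensor f' g') =
        Hom.tensor (f ≫ f') (g ≫ g') := by
  obtain ⟨D₁⟩ := f
  obtain ⟨D₂⟩ := g
  obtain ⟨D₃⟩ := f'
  obtain ⟨D₄⟩ := g'
  exact (side_glue_side D₁ D₃ D₂ D₄).sim.symm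

theorem id_tensor_id (X Y : BrauerCat I₀ I₁) :
    Hom.tensor (𝟙 X) (𝟙 Y) = (𝟙 (tensor X Y) : tensor X Y ⟶ tensor X Y) :=
  ((realises_id X).tensor (realises_id Y)).ext (realises_id _) sideEquiv_refl

theorem tensor_eqToHom {X Y X' Y' : BrauerCat I₀ I₁} (h : X = Y) (h' : X' = Y') :
    Hom.tensor (eqToHom h) (eqToHom h') =
      (eqToHom (congrArg₂ tensor h h') : tensor X X' ⟶ tensor Y Y') := by
  subst h h'
  exact id_tensor_id X X'

/-- Functoriality of the tensor product is interchange, naturality comes from the renaming lemmas,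
and the coherence axioms compare composites of `eqToHom`. -/
theorem isMonoidal (I₀ : LeftIdeal C) (I₁ : RightIdeal C) : IsMonoidal (isCategory I₀ I₁) := by
  let _ : MonoidalCategoryStruct (BrauerCat I₀ I₁) := monStruct (isCategory I₀ I₁)
  refine ⟨MonoidalCategory.ofTensorHom ?_ ?_ ?_ ?_ ?_ ?_ ?_ ?_ ?_, rfl⟩
  · exact id_tensor_id
  · intro X Y Z f
    rfl
  · intro X Y f Z
    rfl
  · intro X Y Z X' Y' Z' f f' g g'
    exact tensor_comp_tensor f f' g g'
  · rintro X X' X'' Y Y' Y'' ⟨D⟩ ⟨D'⟩ ⟨D''⟩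
    obtain ⟨P, hP, hP'⟩ := realises_eqToHom (tensor_assoc X X' X'')
    obtain ⟨Q, hQ, hQ'⟩ := realises_eqToHom (tensor_assoc Y Y' Y'')
    refine (congrArg (Hom.mk ((D.side D').side D'') ≫ ·) hQ).trans
      (.trans ?_ (congrArg (· ≫ Hom.mk (D.side (D'.side D''))) hP).symm)
    exact side_assoc_sim D D' D'' hQ' hP'
  · rintro X Y ⟨D⟩
    obtain ⟨P, hP, hP'⟩ := realises_eqToHom (unit_tensor X)
    obtain ⟨Q, hQ, hQ'⟩ := realises_eqToHom (unit_tensor Y)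
    refine (congrArg (Hom.mk ((ident []).side D) ≫ ·) hQ).trans
      (.trans ?_ (congrArg (· ≫ Hom.mk D) hP).symm)
    exact ident_side_sim D hQ' hP'
  · rintro X Y ⟨D⟩
    obtain ⟨P, hP, hP'⟩ := realises_eqToHom (tensor_unit X)
    obtain ⟨Q, hQ, hQ'⟩ := realises_eqToHom (tensor_unit Y)
    refine (congrArg (Hom.mk (D.side (ident [])) ≫ ·) hQ).trans
      (.trans ?_ (congrArg (· ≫ Hom.mk D) hP).symm)
    exact side_ident_sim D hQ' hP'
  · intro W X Y Z
    -- A tensor product of `eqToHom` is an `eqToHom`; then both sides of the pentagon are `eqToHom`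
    -- between the same objects.
    have h₁ : (α_ W X Y).hom ⊗ₘ 𝟙 Z = eqToHom _ := tensor_eqToHom (tensor_assoc W X Y) rfl
    have h₂ : 𝟙 W ⊗ₘ (α_ X Y Z).hom = eqToHom _ := tensor_eqToHom rfl (tensor_assoc X Y Z)
    rw [h₁, h₂]
    change _ ≫ eqToHom (tensor_assoc W (X ⊗ Y) Z) ≫ _ =
      eqToHom (tensor_assoc (W ⊗ X) Y Z) ≫ eqToHom (tensor_assoc W X (Y ⊗ Z))
    simp only [eqToHom_trans]
  · intro X Y
    have h₁ : 𝟙 X ⊗ₘ (λ_ Y).hom = eqToHom _ := tensor_eqToHom rfl (unit_tensor Y)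
    have h₂ : (ρ_ X).hom ⊗ₘ 𝟙 Y = eqToHom _ := tensor_eqToHom (tensor_unit X) rfl
    rw [h₁, h₂]
    change eqToHom (tensor_assoc X (𝟙_ _) Y) ≫ _ = _
    simp only [eqToHom_trans]

instance : MonoidalCategory (BrauerCat I₀ I₁) := monoidal (isCategory I₀ I₁) (isMonoidal I₀ I₁)

theorem isStrictMonoidal (I₀ : LeftIdeal C) (I₁ : RightIdeal C) :
    IsStrictMonoidal (BrauerCat I₀ I₁) where
  assoc_eq := tensor_assoc
  unit_left_eq := unit_tensor
  unit_right_eq := tensor_unit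
  associator_eq _ _ _ := rfl
  leftUnitor_eq _ := rfl
  rightUnitor_eq _ := rfl

/-! ### The symmetry -/

theorem realises_swap (X Y : BrauerCat I₀ I₁) :
    Hom.Realises (show X ⊗ Y ⟶ Y ⊗ X from Hom.mk (swap X Y)) (swapEquiv (C := C) X Y) :=
  ⟨_, rfl, Diagram.realises_swap X Y⟩

theorem swap_comp_swap (X Y : BrauerCat I₀ I₁) :
    (show X ⊗ Y ⟶ Y ⊗ X from Hom.mk (swap X Y)) ≫ (show Y ⊗ X ⟶ X ⊗ Y from Hom.mk (swap Y X)) =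
      𝟙 (X ⊗ Y) :=
  ((realises_swap X Y).comp (realises_swap Y X)).ext (realises_id _)
    (swapEquiv_swapEquiv (C := C) X Y)

/-- The symmetry, which moves a sequence past another one. -/
def braidingIso (X Y : BrauerCat I₀ I₁) : X ⊗ Y ≅ Y ⊗ X where
  hom := Hom.mk (swap X Y)
  inv := Hom.mk (swap Y X)
  hom_inv_id := swap_comp_swap X Y
  inv_hom_id := swap_comp_swap Y X

theorem tensor_braidingIso {X Y X' Y' : BrauerCat I₀ I₁} (f : X ⟶ Y) (g : X' ⟶ Y') :
    (f ⊗ₘ g) ≫ (braidingIso Y Y').hom = (braidingIso X X').hom ≫ (g ⊗ₘ f) := by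
  obtain ⟨D⟩ := f
  obtain ⟨D'⟩ := g
  exact side_swap_sim D D'

/-- Naturality is `side_swap_sim`; in the hexagons and the symmetry axiom both sides realise
bijections, which are compared by `Hom.Realises.ext`. -/
instance symmetricCategory : SymmetricCategory (BrauerCat I₀ I₁) where
  braiding := braidingIso
  braiding_naturality_right X _ _ f := tensor_braidingIso (𝟙 X) f
  braiding_naturality_left f Z := tensor_braidingIso f (𝟙 Z)
  hexagon_forward X Y Z :=
    ((realises_eqToHom (tensor_assoc X Y Z)).comp ((realises_swap X (Y ⊗ Z)).comp
      (realises_eqToHom (tensor_assoc Y Z X)))).ext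
    (((realises_swap X Y).tensor (realises_id Z)).comp
      ((realises_eqToHom (tensor_assoc Y X Z)).comp
        ((realises_id Y).tensor (realises_swap X Z))))
    (swapEquiv_hexagon (C := C) X Y Z _ _ _)
  hexagon_reverse X Y Z :=
    ((realises_eqToHom (tensor_assoc X Y Z).symm).comp ((realises_swap (X ⊗ Y) Z).comp
      (realises_eqToHom (tensor_assoc Z X Y).symm))).ext
    (((realises_id X).tensor (realises_swap Y Z)).comp
      ((realises_eqToHom (tensor_assoc X Z Y).symm).comp
        ((realises_swap X Z).tensor (realises_id Y))))
    (swapEquiv_hexagon_symm (C := C) X Y Z _ _ _)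
  symmetry := swap_comp_swap

end BrauerCat
-- Duality: nested cups and caps
namespace BrauerCat

variable {C : Type u} [Category.{v} C] {I₀ : LeftIdeal C} {I₁ : RightIdeal C}

namespace Diagram

variable {S T U S' T' U' : List (C × Bool)}

/-! ### Zigzags -/

/-- The edge `e` joins the boundary points `x` and `y`, and is labelled by an identity. -/
structure Joins (D : Diagram I₀ I₁ S T) (e : D.E) (x y : Bd S T) : Prop where
  src_true : x.starts = true → D.src e = Sum.inr x
  tgt_true : x.starts = true → D.tgt e = Sum.inr y
  src_false : x.starts = false → D.src e = Sum.inr y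
  tgt_false : x.starts = false → D.tgt e = Sum.inr x
  lab_eq : D.lab e = Arrow.mk (𝟙 x.ob)

theorem joins_wiring {E : Type} [Finite E] {p q : E → Bd S T} (bij hob hst) (e : E) :
    Joins (wiring (I₀ := I₀) (I₁ := I₁) E p q bij hob hst) e (p e) (q e) where
  src_true h := congrArg Sum.inr (if_pos h)
  tgt_true h := congrArg Sum.inr (if_pos h)
  src_false h := congrArg Sum.inr (if_neg (Bool.eq_false_iff.1 h))
  tgt_false h := congrArg Sum.inr (if_neg (Bool.eq_false_iff.1 h))
  lab_eq := rfl

/-- `Joins` only fixes which points are joined; the orientation is read off from `x.starts`. Hence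
the two ends can be interchanged, as the second zigzag requires. -/
theorem Joins.symm {D : Diagram I₀ I₁ S T} {e : D.E} {x y : Bd S T} (h : Joins D e x y)
    (hob : y.ob = x.ob) (hst : y.starts = !x.starts) : Joins D e y x where
  src_true hy := h.src_false (by simpa [hst] using hy)
  tgt_true hy := h.tgt_false (by simpa [hst] using hy)
  src_false hy := h.src_true (by simpa [hst] using hy)
  tgt_false hy := h.tgt_true (by simpa [hst] using hy)
  lab_eq := by rw [h.lab_eq, hob]

theorem Joins.relabel {D : Diagram I₀ I₁ S T} {e : D.E} {x y : Bd S T} (h : Joins D e x y)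
    (σ : Bd S T ≃ Bd S' T') (hob hst) : Joins (D.relabel σ hob hst) e (σ x) (σ y) where
  src_true hx := congrArg (Sum.map id σ) (h.src_true (hst x ▸ hx))
  tgt_true hx := congrArg (Sum.map id σ) (h.tgt_true (hst x ▸ hx))
  src_false hx := congrArg (Sum.map id σ) (h.src_false (hst x ▸ hx))
  tgt_false hx := congrArg (Sum.map id σ) (h.tgt_false (hst x ▸ hx))
  lab_eq := by
    rw [hob]
    exact h.lab_eq

theorem Joins.relabelTop {D : Diagram I₀ I₁ S T} {e : D.E} {x y : Bd S T} (h : Joins D e x y)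
    (σ : Fin T.length ≃ Fin U.length) (hσ) :
    Joins (D.relabelTop σ hσ) e ((Equiv.refl _).sumCongr σ x) ((Equiv.refl _).sumCongr σ y) :=
  h.relabel _ _ _

theorem joins_ident (S : List (C × Bool)) (i : Fin S.length) :
    Joins (ident (I₀ := I₀) (I₁ := I₁) S) i (Sum.inl i) (Sum.inr i) :=
  joins_wiring _ _ _ i

theorem joins_cup (S : List (C × Bool)) (i : Fin S.length) :
    Joins (cup (I₀ := I₀) (I₁ := I₁) S) i (Sum.inr (pos S (dualSeq S) (Sum.inl i)))
      (Sum.inr (pos S (dualSeq S) (Sum.inr (dualPos S i)))) :=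
  joins_wiring _ _ _ i

theorem joins_cap (S : List (C × Bool)) (i : Fin S.length) :
    Joins (cap (I₀ := I₀) (I₁ := I₁) S) i (Sum.inl (pos (dualSeq S) S (Sum.inr i)))
      (Sum.inl (pos (dualSeq S) S (Sum.inl (dualPos S i)))) :=
  joins_wiring _ _ _ i

theorem Joins.side_left {D : Diagram I₀ I₁ S T} {e : D.E} {x y : Bd S T} (h : Joins D e x y)
    (D' : Diagram I₀ I₁ S' T') :
    Joins (D.side D') (Sum.inl e) (sideBd S T S' T' (Sum.inl x))
      (sideBd S T S' T' (Sum.inl y)) where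
  src_true hx := congrArg (fun z => sidePt _ _ _ _ _ _ (Sum.inl z))
    (h.src_true ((starts_sideBd (Sum.inl x)).symm.trans hx))
  tgt_true hx := congrArg (fun z => sidePt _ _ _ _ _ _ (Sum.inl z))
    (h.tgt_true ((starts_sideBd (Sum.inl x)).symm.trans hx))
  src_false hx := congrArg (fun z => sidePt _ _ _ _ _ _ (Sum.inl z))
    (h.src_false ((starts_sideBd (Sum.inl x)).symm.trans hx))
  tgt_false hx := congrArg (fun z => sidePt _ _ _ _ _ _ (Sum.inl z))
    (h.tgt_false ((starts_sideBd (Sum.inl x)).symm.trans hx))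
  lab_eq := by
    rw [ob_sideBd]
    exact h.lab_eq

theorem Joins.side_right {D' : Diagram I₀ I₁ S' T'} {e : D'.E} {x y : Bd S' T'}
    (h : Joins D' e x y) (D : Diagram I₀ I₁ S T) :
    Joins (D.side D') (Sum.inr e) (sideBd S T S' T' (Sum.inr x))
      (sideBd S T S' T' (Sum.inr y)) where
  src_true hx := congrArg (fun z => sidePt _ _ _ _ _ _ (Sum.inr z))
    (h.src_true ((starts_sideBd (Sum.inr x)).symm.trans hx))
  tgt_true hx := congrArg (fun z => sidePt _ _ _ _ _ _ (Sum.inr z))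
    (h.tgt_true ((starts_sideBd (Sum.inr x)).symm.trans hx))
  src_false hx := congrArg (fun z => sidePt _ _ _ _ _ _ (Sum.inr z))
    (h.src_false ((starts_sideBd (Sum.inr x)).symm.trans hx))
  tgt_false hx := congrArg (fun z => sidePt _ _ _ _ _ _ (Sum.inr z))
    (h.tgt_false ((starts_sideBd (Sum.inr x)).symm.trans hx))
  lab_eq := by
    rw [ob_sideBd]
    exact h.lab_eq

/-- The strands that run up, down and up again are straightened. -/
theorem realises_zigzag {I : Type} [Finite I] (D : Diagram I₀ I₁ S T) (D' : Diagram I₀ I₁ T U)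
    [IsEmpty D.V] [IsEmpty D'.V] (s : I ≃ Fin S.length) (u : I ≃ Fin U.length)
    (t₁ t₂ t₃ : I → Fin T.length) (a b : I → D.E) (c d : I → D'.E)
    (ht : ∀ t, ∃ i, t = t₁ i ∨ t = t₂ i ∨ t = t₃ i)
    (hD : ∀ e, ∃ i, e = a i ∨ e = b i) (hD' : ∀ e, ∃ i, e = c i ∨ e = d i)
    (hu : ∀ i, U.get (u i) = S.get (s i)) (h₁ : ∀ i, T.get (t₁ i) = S.get (s i))
    (h₃ : ∀ i, T.get (t₃ i) = S.get (s i))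
    (ha : ∀ i, D.Joins (a i) (Sum.inl (s i)) (Sum.inr (t₃ i)))
    (hb : ∀ i, D.Joins (b i) (Sum.inr (t₁ i)) (Sum.inr (t₂ i)))
    (hc : ∀ i, D'.Joins (c i) (Sum.inl (t₃ i)) (Sum.inl (t₂ i)))
    (hd : ∀ i, D'.Joins (d i) (Sum.inl (t₁ i)) (Sum.inr (u i))) :
    Realises (D.glue D') (s.symm.trans u) := by
  have hP := isPerm_perm (I₀ := I₀) (I₁ := I₁) s u fun i => (hu i).symm
  refine ⟨perm s u fun i => (hu i).symm, s, u, hP, rfl, ?_⟩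
  let G := D.glue D'
  let A : I → G.E := fun i => Sum.inl (a i)
  let B : I → G.E := fun i => Sum.inl (b i)
  let A' : I → G.E := fun i => Sum.inr (d i)
  let B' : I → G.E := fun i => Sum.inr (c i)
  -- Strand `i` runs through `a i`, `c i`, `b i`, `d i` if its sign is `+`, and through the same
  -- edges in reverse order if it is `-`. Its first edge is accordingly `a i` or `d i`.
  let k : I → G.E := fun i => if (S.get (s i)).2 then A i else A' i
  have hk_true : ∀ {i}, (S.get (s i)).2 = true → k i = A i := fun h => if_pos h
  have hk_false : ∀ {i}, (S.get (s i)).2 = false → k i = A' i :=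
    fun h => if_neg (Bool.eq_false_iff.1 h)
  let m : Fin T.length → G.V ⊕ Bd S U := fun t => Sum.inl (Sum.inr t)
  have hD_src : ∀ {e t}, D.src e = Sum.inr (Sum.inr t) → G.src (Sum.inl e) = m t :=
    fun h => congrArg lower h
  have hD_tgt : ∀ {e t}, D.tgt e = Sum.inr (Sum.inr t) → G.tgt (Sum.inl e) = m t :=
    fun h => congrArg lower h
  have hD'_src : ∀ {e t}, D'.src e = Sum.inr (Sum.inl t) → G.src (Sum.inr e) = m t :=
    fun h => congrArg upper h
  have hD'_tgt : ∀ {e t}, D'.tgt e = Sum.inr (Sum.inl t) → G.tgt (Sum.inr e) = m t :=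
    fun h => congrArg upper h
  have st₁ : ∀ i, Bd.starts (Sum.inr (t₁ i) : Bd S T) = !(S.get (s i)).2 :=
    fun i => congrArg (fun x : C × Bool => !x.2) (h₁ i)
  have st₁' : ∀ i, Bd.starts (Sum.inl (t₁ i) : Bd T U) = (S.get (s i)).2 :=
    fun i => congrArg Prod.snd (h₁ i)
  have st₃ : ∀ i, Bd.starts (Sum.inl (t₃ i) : Bd T U) = (S.get (s i)).2 :=
    fun i => congrArg Prod.snd (h₃ i)
  have hs : ∀ i, G.src (k i) = Sum.map Empty.elim id ((perm (I₀ := I₀) (I₁ := I₁) s u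
      fun i => (hu i).symm).src i) := by
    intro i
    cases hi : (S.get (s i)).2
    · rw [hk_false hi, hP.src_false i hi]
      exact congrArg upper ((hd i).src_false ((st₁' i).trans hi))
    · rw [hk_true hi, hP.src_true i hi]
      exact congrArg lower ((ha i).src_true hi)
  -- First edges start at boundary points. An edge that starts at a point of `T` is therefore
  -- outside the stop set, and all points of `T` get erased.
  have hK : ∀ {g t}, G.src g = m t → g ∉ Set.range k := by
    rintro g t hg ⟨i, rfl⟩
    rw [hs] at hg
    cases hi : (S.get (s i)).2
    · rw [hP.src_false i hi] at hg
      exact absurd hg Sum.inr_ne_inl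
    · rw [hP.src_true i hi] at hg
      exact absurd hg Sum.inr_ne_inl
  let l : I → Arrow C := fun i => Arrow.mk (𝟙 (S.get (s i)).1)
  have hlA : ∀ i, G.lab (A i) = l i := fun i => (ha i).lab_eq
  have hlB : ∀ i, G.lab (B i) = l i := fun i => (hb i).lab_eq.trans
    (congrArg (fun x : C × Bool => Arrow.mk (𝟙 x.1)) (h₁ i))
  have hlA' : ∀ i, G.lab (A' i) = l i := fun i => (hd i).lab_eq.trans
    (congrArg (fun x : C × Bool => Arrow.mk (𝟙 x.1)) (h₁ i))
  have hlB' : ∀ i, G.lab (B' i) = l i := fun i => (hc i).lab_eq.trans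
    (congrArg (fun x : C × Bool => Arrow.mk (𝟙 x.1)) (h₃ i))
  have hcomp : ∀ i, IsComp (l i) (l i) (l i) := fun i => IsComp.id_left rfl
  have next : ∀ {i f g t}, Walk G (Set.range k) (k i) f (l i) → G.tgt f = m t → G.src g = m t →
      G.lab g = l i → Walk G (Set.range k) (k i) g (l i) := by
    intro i f g t hw hf hg hl
    refine hw.step (hf.trans hg.symm) (hK hg) ?_
    rw [hl]
    exact hcomp i
  -- the traversed edges, for both orientations
  have walks : ∀ i, Walk G (Set.range k) (k i) (A i) (l i) ∧ Walk G (Set.range k) (k i) (B i) (l i) ∧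
      Walk G (Set.range k) (k i) (A' i) (l i) ∧ Walk G (Set.range k) (k i) (B' i) (l i) := by
    intro i
    have hw : Walk G (Set.range k) (k i) (k i) (G.lab (k i)) := .start
    cases hi : (S.get (s i)).2
    · rw [hk_false hi, hlA', ← hk_false hi] at hw
      have w₁ : Walk G (Set.range k) (k i) (A' i) (l i) := by
        have := hw
        nth_rw 2 [hk_false hi] at this
        exact this
      have w₂ := next w₁ (hD'_tgt ((hd i).tgt_false ((st₁' i).trans hi)))
        (hD_src ((hb i).src_true ((st₁ i).trans (by rw [hi]; rfl)))) (hlB i)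
      have w₃ := next w₂ (hD_tgt ((hb i).tgt_true ((st₁ i).trans (by rw [hi]; rfl))))
        (hD'_src ((hc i).src_false ((st₃ i).trans hi))) (hlB' i)
      have w₄ := next w₃ (hD'_tgt ((hc i).tgt_false ((st₃ i).trans hi)))
        (hD_src ((ha i).src_false hi)) (hlA i)
      exact ⟨w₄, w₂, w₁, w₃⟩
    · rw [hk_true hi, hlA, ← hk_true hi] at hw
      have w₁ : Walk G (Set.range k) (k i) (A i) (l i) := by
        have := hw
        nth_rw 2 [hk_true hi] at this
        exact this
      have w₂ := next w₁ (hD_tgt ((ha i).tgt_true hi))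
        (hD'_src ((hc i).src_true ((st₃ i).trans hi))) (hlB' i)
      have w₃ := next w₂ (hD'_tgt ((hc i).tgt_true ((st₃ i).trans hi)))
        (hD_src ((hb i).src_false ((st₁ i).trans (by rw [hi]; rfl)))) (hlB i)
      have w₄ := next w₃ (hD_tgt ((hb i).tgt_false ((st₁ i).trans (by rw [hi]; rfl))))
        (hD'_src ((hd i).src_true ((st₁' i).trans hi))) (hlA' i)
      exact ⟨w₁, w₃, w₄, w₂⟩
  have hsrc : ∀ t, ∃ g, G.src g = m t := by
    intro t
    obtain ⟨i, rfl | rfl | rfl⟩ := ht t <;> cases hi : (S.get (s i)).2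
    · exact ⟨_, hD_src ((hb i).src_true ((st₁ i).trans (by rw [hi]; rfl)))⟩
    · exact ⟨_, hD'_src ((hd i).src_true ((st₁' i).trans hi))⟩
    · exact ⟨_, hD'_src ((hc i).src_false ((st₃ i).trans hi))⟩
    · exact ⟨_, hD_src ((hb i).src_false ((st₁ i).trans (by rw [hi]; rfl)))⟩
    · exact ⟨_, hD_src ((ha i).src_false hi)⟩
    · exact ⟨_, hD'_src ((hc i).src_true ((st₃ i).trans hi))⟩
  refine sim_of_merge G _ Empty.elim k (fun x => x.elim) ?_ (fun x => x.elim) hs ?_ ?_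
  · rintro ((v | v) | t)
    · exact isEmptyElim v
    · exact isEmptyElim v
    · refine ⟨fun ⟨w, _⟩ => w.elim, fun h => ?_⟩
      obtain ⟨g, hg⟩ := hsrc t
      exact absurd (h g hg) (hK hg)
  · intro (i : I)
    change ∃ f, Walk _ _ _ _ (l i) ∧ _
    obtain ⟨w₁, w₂, w₃, w₄⟩ := walks i
    cases hi : (S.get (s i)).2
    · refine ⟨A i, w₁, ?_⟩
      rw [hP.tgt_false i hi]
      exact congrArg lower ((ha i).tgt_false hi)
    · refine ⟨A' i, w₃, ?_⟩
      rw [hP.tgt_true i hi]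
      exact congrArg upper ((hd i).tgt_true ((st₁' i).trans hi))
  · rintro (e | e)
    · obtain ⟨i, rfl | rfl⟩ := hD e
      exacts [⟨i, _, (walks i).1⟩, ⟨i, _, (walks i).2.1⟩]
    · obtain ⟨i, rfl | rfl⟩ := hD' e
      exacts [⟨i, _, (walks i).2.2.2⟩, ⟨i, _, (walks i).2.2.1⟩]

variable (S)

/-- The first zigzag, up to the associator. -/
theorem realises_cup_cap {h h'} :
    Realises ((((cup S).side (ident S)).relabelTop
      (U := S ++ (dualSeq S ++ S)) (finCongr h) h').glue
        ((ident S).side (cap (I₀ := I₀) (I₁ := I₁) S)))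
      (finCongr (by simp : ([] ++ S).length = (S ++ []).length)) := by
  have hI : IsEmpty (Empty ⊕ Empty) := inferInstance
  have : IsEmpty (((cup (I₀ := I₀) (I₁ := I₁) S).side (ident S)).relabelTop
      (U := S ++ (dualSeq S ++ S)) (finCongr h) h').V := hI
  have : IsEmpty ((ident S).side (cap (I₀ := I₀) (I₁ := I₁) S)).V := hI
  let s : Fin S.length ≃ Fin ([] ++ S).length := finCongr rfl
  let u : Fin S.length ≃ Fin (S ++ []).length := finCongr (by simp)
  have hs : ∀ i, s i = pos [] S (Sum.inr i) := fun i => Fin.ext (Nat.zero_add _).symm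
  have hu : ∀ i, u i = pos S [] (Sum.inl i) := fun i => rfl
  -- In `S ++ (dualSeq S ++ S)` the bottom strand arrives in the third block, the cap leads to the
  -- second, the cup to the first, and the identity from there to the top.
  refine realises_zigzag _ _ s u (fun i => pos S _ (Sum.inl i))
    (fun i => pos S _ (Sum.inr (pos (dualSeq S) S (Sum.inl (dualPos S i)))))
    (fun i => pos S _ (Sum.inr (pos (dualSeq S) S (Sum.inr i)))) Sum.inr Sum.inl Sum.inr Sum.inl
    ?_ ?_ ?_ ?_ ?_ ?_ ?_ ?_ ?_ ?_
  · intro t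
    obtain ⟨i | i, rfl⟩ := (pos S (dualSeq S ++ S)).surjective t
    · exact ⟨i, .inl rfl⟩
    · obtain ⟨i | i, rfl⟩ := (pos (dualSeq S) S).surjective i
      · obtain ⟨i, rfl⟩ := (dualPos S).surjective i
        exact ⟨i, .inr (.inl rfl)⟩
      · exact ⟨i, .inr (.inr rfl)⟩
  · rintro (i | i)
    exacts [⟨i, .inr rfl⟩, ⟨i, .inl rfl⟩]
  · rintro (i | i)
    exacts [⟨i, .inr rfl⟩, ⟨i, .inl rfl⟩]
  · intro i
    rw [hs, hu, get_pos_inl, get_pos_inr]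
  · intro i
    rw [hs, get_pos_inl, get_pos_inr]
  · intro i
    rw [hs, get_pos_inr, get_pos_inr, get_pos_inr]
  · intro i
    rw [hs, ← finCongr_pos_inr S (dualSeq S) S h]
    exact ((joins_ident S i).side_right (cup S)).relabelTop (finCongr h) h'
  · intro i
    exact ((joins_cup S i).side_left (ident S)).relabelTop (finCongr h) h'
  · intro i
    exact (joins_cap S i).side_right (ident S)
  · intro i
    exact (joins_ident S i).side_left (cap S)

/-- The second zigzag, up to the associator. -/
theorem realises_cap_cup {h h'} :
    Realises ((((ident (dualSeq S)).side (cup S)).relabelTop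
      (U := (dualSeq S ++ S) ++ dualSeq S) (finCongr h) h').glue
        ((cap (I₀ := I₀) (I₁ := I₁) S).side (ident (dualSeq S))))
      (finCongr (by simp : (dualSeq S ++ []).length = ([] ++ dualSeq S).length)) := by
  have hI : IsEmpty (Empty ⊕ Empty) := inferInstance
  have : IsEmpty (((ident (I₀ := I₀) (I₁ := I₁) (dualSeq S)).side (cup S)).relabelTop
      (U := (dualSeq S ++ S) ++ dualSeq S) (finCongr h) h').V := hI
  have : IsEmpty ((cap (I₀ := I₀) (I₁ := I₁) S).side (ident (dualSeq S))).V := hI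
  let s : Fin S.length ≃ Fin (dualSeq S ++ []).length :=
    (dualPos S).trans (finCongr (by simp))
  let u : Fin S.length ≃ Fin ([] ++ dualSeq S).length := (dualPos S).trans (finCongr rfl)
  have hs : ∀ i, s i = pos (dualSeq S) [] (Sum.inl (dualPos S i)) := fun i => rfl
  have hu : ∀ i, u i = pos [] (dualSeq S) (Sum.inr (dualPos S i)) :=
    fun i => Fin.ext (Nat.zero_add _).symm
  have hsu : s.symm.trans u =
      finCongr (by simp : (dualSeq S ++ []).length = ([] ++ dualSeq S).length) := by
    ext x
    simp [s, u]
  -- In `(dualSeq S ++ S) ++ dualSeq S` the strand arrives in the first block and leaves from the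
  -- last. The cup and the cap are read from their dual ends, whence `Joins.symm` below.
  have key := realises_zigzag (((ident (I₀ := I₀) (I₁ := I₁) (dualSeq S)).side (cup S)).relabelTop
      (U := (dualSeq S ++ S) ++ dualSeq S) (finCongr h) h')
    ((cap (I₀ := I₀) (I₁ := I₁) S).side (ident (dualSeq S))) s u
    (fun i => pos (dualSeq S ++ S) _ (Sum.inr (dualPos S i)))
    (fun i => pos _ (dualSeq S) (Sum.inl (pos (dualSeq S) S (Sum.inr i))))
    (fun i => pos _ (dualSeq S) (Sum.inl (pos (dualSeq S) S (Sum.inl (dualPos S i)))))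
    (fun i => Sum.inl (dualPos S i)) Sum.inr Sum.inl (fun i => Sum.inr (dualPos S i))
    ?_ ?_ ?_ ?_ ?_ ?_ ?_ ?_ ?_ ?_
  · rwa [hsu] at key
  · intro t
    obtain ⟨i | i, rfl⟩ := (pos (dualSeq S ++ S) (dualSeq S)).surjective t
    · obtain ⟨i | i, rfl⟩ := (pos (dualSeq S) S).surjective i
      · obtain ⟨i, rfl⟩ := (dualPos S).surjective i
        exact ⟨i, .inr (.inr rfl)⟩
      · exact ⟨i, .inr (.inl rfl)⟩
    · obtain ⟨i, rfl⟩ := (dualPos S).surjective i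
      exact ⟨i, .inl rfl⟩
  · rintro (i | i)
    · obtain ⟨i, rfl⟩ := (dualPos S).surjective i
      exact ⟨i, .inl rfl⟩
    · exact ⟨i, .inr rfl⟩
  · rintro (i | i)
    · exact ⟨i, .inl rfl⟩
    · obtain ⟨i, rfl⟩ := (dualPos S).surjective i
      exact ⟨i, .inr rfl⟩
  · intro i
    rw [hs, hu, get_pos_inl, get_pos_inr]
  · intro i
    rw [hs, get_pos_inl, get_pos_inr]
  · intro i
    rw [hs, get_pos_inl, get_pos_inl, get_pos_inl]
  · intro i
    exact ((joins_ident (dualSeq S) (dualPos S i)).side_left (cup S)).relabelTop (finCongr h) h'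
  · intro i
    rw [← finCongr_pos_inr_inr (dualSeq S) S (dualSeq S) h]
    exact (((joins_cup S i).symm
      (by simp only [Bd.ob, Sum.elim_inr, get_pos_inl, get_pos_inr, get_dualPos])
      (by simp only [Bd.starts, Sum.elim_inr, get_pos_inl, get_pos_inr,
        get_dualPos])).side_right (ident (dualSeq S))).relabelTop (finCongr h) h'
  · intro i
    exact ((joins_cap S i).symm
      (by simp only [Bd.ob, Sum.elim_inl, get_pos_inl, get_pos_inr, get_dualPos])
      (by simp only [Bd.starts, Sum.elim_inl, get_pos_inl, get_pos_inr,
        get_dualPos])).side_left (ident (dualSeq S))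
  · intro i
    rw [hu]
    exact (joins_ident (dualSeq S) (dualPos S i)).side_right (cap S)

end Diagram

open Diagram

/-- Composition with the identification of equal objects changes the boundary. -/
theorem mk_comp_eqToHom {X Y Z : BrauerCat I₀ I₁} (D : Diagram I₀ I₁ X Y) (h : Y = Z) :
    ∃ h', (show X ⟶ Y from Hom.mk D) ≫ eqToHom h =
      Hom.mk (X := X) (Y := Z) (D.relabelTop (finCongr (congrArg List.length h)) h') := by
  subst h
  refine ⟨fun _ => rfl, ?_⟩
  exact glue_perm D (isPerm_perm (Equiv.refl _) (Equiv.refl _) fun _ => rfl)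

/-- The pairing of a sequence with its dual, given by nested cups and caps. -/
@[reducible] def exactPairing (X : BrauerCat I₀ I₁) : ExactPairing X X.dual where
  coevaluation' := Hom.mk (cup X)
  evaluation' := Hom.mk (cap X)
  coevaluation_evaluation' := by
    obtain ⟨h, h'⟩ := mk_comp_eqToHom ((ident (dualSeq X)).side (cup (I₀ := I₀) (I₁ := I₁) X))
      (tensor_assoc X.dual X X.dual).symm
    -- The inverse associator between the two factors is absorbed by the first one, as a renaming of
    -- its top.
    rw [← Category.assoc]
    refine (congrArg (· ≫ Hom.mk ((cap X).side (ident (dualSeq X)))) h').trans ?_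
    exact Hom.Realises.ext ⟨_, rfl, realises_cap_cup X⟩
      ((realises_eqToHom (tensor_unit X.dual)).comp (realises_eqToHom (unit_tensor X.dual).symm)) rfl
  evaluation_coevaluation' := by
    obtain ⟨h, h'⟩ := mk_comp_eqToHom ((cup (I₀ := I₀) (I₁ := I₁) X).side (ident X))
      (tensor_assoc X X.dual X)
    rw [← Category.assoc]
    refine (congrArg (· ≫ Hom.mk ((ident X).side (cap X))) h').trans ?_
    exact Hom.Realises.ext ⟨_, rfl, realises_cup_cap X⟩
      ((realises_eqToHom (unit_tensor X)).comp (realises_eqToHom (tensor_unit X).symm)) rfl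

/-- The cups and caps give right duals; the symmetry turns them into left duals. -/
theorem nonempty_rigidCategory (I₀ : LeftIdeal C) (I₁ : RightIdeal C) :
    Nonempty (RigidCategory (BrauerCat I₀ I₁)) :=
  letI : RightRigidCategory (BrauerCat I₀ I₁) :=
    { rightDual := fun X => { rightDual := X.dual, exact := exactPairing X } }
  ⟨BraidedCategory.rigidCategoryOfRightRigidCategory⟩

end BrauerCat
-- Faithfulness of the embedding of `C`
namespace BrauerCat

variable {C : Type u} [Category.{v} C] {I₀ : LeftIdeal C} {I₁ : RightIdeal C}

namespace Diagram

variable {S T U S' T' U' : List (C × Bool)}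

theorem Iso.symm {D D' : Diagram I₀ I₁ S T} (h : Iso D D') : Iso D' D := by
  obtain ⟨j, k, h₁, h₂, h₃, h₄⟩ := h
  have key : ∀ x : D.V ⊕ Bd S T, Sum.map j.symm id (Sum.map j id x) = x := by
    rintro (x | x) <;> simp
  refine ⟨j.symm, k.symm, fun v => ?_, fun e => ?_, fun e => ?_, fun e => ?_⟩
  · rw [← h₁, j.apply_symm_apply]
  · conv_rhs => rw [← k.apply_symm_apply e]
    rw [h₂, key]
  · conv_rhs => rw [← k.apply_symm_apply e]
    rw [h₃, key]
  · rw [← h₄, k.apply_symm_apply]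

/-! ### Labels of strands -/

/-- The labels of the strands from the bottom to the top. -/
def strandLabels (D : Diagram I₀ I₁ S T) : Set (Arrow C) :=
  {a | ∃ e f s t, D.src e = Sum.inr (Sum.inl s) ∧ D.tgt f = Sum.inr (Sum.inr t) ∧
    Walk D {e} e f a}

theorem Iso.strandLabels_subset {D D' : Diagram I₀ I₁ S T} (h : Iso D D') :
    D.strandLabels ⊆ D'.strandLabels := by
  obtain ⟨j, k, h₁, h₂, h₃, h₄⟩ := h
  rintro a ⟨e, f, s, t, he, hf, hw⟩
  refine ⟨k e, k f, s, t, ?_, ?_, ?_⟩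
  · rw [h₂, he]
    rfl
  · rw [h₃, hf]
    rfl
  · have := hw.iso h₂ h₃ h₄
    rwa [show k.symm ⁻¹' {e} = {k e} by ext x; simp [Equiv.symm_apply_eq]] at this

theorem IsErase.preimage_singleton {D D' : Diagram I₀ I₁ S T} {v e g j k e'}
    (h : IsErase D D' v e g j k e') (a : D'.E) : k ⁻¹' {k a} = {a} := by
  ext x
  simp [h.k_inj.eq_iff]

theorem IsErase.notMem_singleton {D D' : Diagram I₀ I₁ S T} {v e g j k e'}
    (h : IsErase D D' v e g j k e') (a : D'.E) : g ∉ ({k a} : Set D.E) :=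
  fun hg => h.k_ne a hg.symm

theorem IsErase.walk_singleton_iff {D D' : Diagram I₀ I₁ S T} {v e g j k e'}
    (h : IsErase D D' v e g j k e') {a f : D'.E} {x : Arrow C} :
    Walk D' {a} a f x ↔ Walk D {k a} (k a) (lastEdge g k e' f) x := by
  rw [← h.walk_iff (h.notMem_singleton a), h.preimage_singleton]

theorem map_eq_inr {A A' B : Type} (j : A → A') (x : A ⊕ B) (b : B) :
    (Sum.map j id x : A' ⊕ B) = Sum.inr b ↔ x = Sum.inr b := by
  rcases x with x | x <;> simp

/-- The erased vertex is inner. An edge that starts at a boundary point is thus not `g`, and one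
that ends at a boundary point is not `e`, so the ends of the strand have counterparts in `D'` and
the walks correspond with their composites. -/
theorem Rel.strandLabels_eq {D D' : Diagram I₀ I₁ S T} (h : Rel D D') :
    D.strandLabels = D'.strandLabels := by
  obtain h | h := h
  · exact h.strandLabels_subset.antisymm h.symm.strandLabels_subset
  · obtain ⟨v, e, g, j, k, e', h⟩ := erase_iff.1 h
    ext a
    constructor
    · rintro ⟨e₁, f, s, t, he, hf, hw⟩
      obtain ⟨e₁, rfl⟩ := h.exists_k (a := e₁) (by
        rintro rfl
        exact absurd (h.src_g.symm.trans he) Sum.inl_ne_inr)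
      obtain ⟨f, rfl⟩ := h.exists_lastEdge (f := f) (by
        rintro rfl
        exact absurd (h.tgt_e.symm.trans hf) Sum.inl_ne_inr)
      rw [h.src_k, map_eq_inr] at he
      rw [h.tgt_lastEdge, map_eq_inr] at hf
      exact ⟨e₁, f, s, t, he, hf, h.walk_singleton_iff.2 hw⟩
    · rintro ⟨e₁, f, s, t, he, hf, hw⟩
      refine ⟨k e₁, lastEdge g k e' f, s, t, ?_, ?_, h.walk_singleton_iff.1 hw⟩
      · rw [h.src_k, he]
        rfl
      · rw [h.tgt_lastEdge, hf]
        rfl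

theorem Sim.strandLabels_eq {D D' : Diagram I₀ I₁ S T} (h : Sim D D') :
    D.strandLabels = D'.strandLabels :=
  congrArg (Quot.lift strandLabels fun _ _ h => Rel.strandLabels_eq h) h

theorem strandLabels_strand {X Y : C} (β : X ⟶ Y) :
    (strand (I₀ := I₀) (I₁ := I₁) β).strandLabels = {Arrow.mk β} := by
  ext a
  constructor
  · rintro ⟨e, f, s, t, -, -, hw⟩
    cases hw with
    | start => rfl
    | step _ _ h => exact absurd rfl h
  · rintro rfl
    exact ⟨(), (), _, _, rfl, rfl, .start⟩

/-- The middle point is erased: the upper edge is not a first edge and is absorbed by the lower one.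
-/
theorem strand_glue_strand {X Y Z : C} (β : X ⟶ Y) (γ : Y ⟶ Z) :
    Sim ((strand (I₀ := I₀) (I₁ := I₁) β).glue (strand γ)) (strand (β ≫ γ)) := by
  let G := (strand (I₀ := I₀) (I₁ := I₁) β).glue (strand γ)
  let k : Unit → G.E := fun _ => Sum.inl ()
  have hk : (Sum.inr () : G.E) ∉ Set.range k := fun ⟨_, h⟩ => absurd h Sum.inl_ne_inr
  have hw : Walk G (Set.range k) (k ()) (Sum.inr ()) (Arrow.mk (β ≫ γ)) :=
    (Walk.start (D := G)).step rfl hk (IsComp.mk β γ)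
  refine sim_of_merge G _ Empty.elim k (fun x => x.elim) ?_ (fun x => x.elim) (fun _ => rfl)
    (fun _ => ⟨_, hw, rfl⟩) ?_
  · rintro ((v | v) | ⟨t, ht⟩)
    · exact v.elim
    · exact v.elim
    · obtain rfl := Nat.lt_one_iff.1 ht
      exact ⟨fun ⟨w, _⟩ => w.elim, fun h => absurd (h (Sum.inr ()) rfl) hk⟩
  · rintro (⟨⟩ | ⟨⟩)
    exacts [⟨(), _, .start⟩, ⟨(), _, hw⟩]

theorem strand_id_iso (X : C) :
    Iso (strand (I₀ := I₀) (I₁ := I₁) (𝟙 X)) (ident [(X, true)]) := by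
  refine ⟨Equiv.refl Empty, (Equiv.ofUnique Unit (Fin 1) : Unit ≃ Fin 1), fun v => v.elim,
    fun _ => rfl, fun _ => rfl, fun _ => rfl⟩

end Diagram

open Diagram

/-- The functor that sends `X` to `X⁺` and `β` to the strand labelled by `β`. -/
def strandFunctor (I₀ : LeftIdeal C) (I₁ : RightIdeal C) : C ⥤ BrauerCat I₀ I₁ where
  obj := plus I₀ I₁
  map β := Hom.mk (strand β)
  map_id X := (strand_id_iso X).sim
  map_comp β γ := (strand_glue_strand β γ).symm

theorem strandFunctor_obj_injective (I₀ : LeftIdeal C) (I₁ : RightIdeal C) :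
    Function.Injective (strandFunctor I₀ I₁).obj := fun X Y h => by
  have h' : [(X, true)] = [(Y, true)] := h
  simpa using h'

instance (I₀ : LeftIdeal C) (I₁ : RightIdeal C) : (strandFunctor I₀ I₁).Faithful where
  map_injective {X Y} β γ h := by
    have h' : Sim (strand (I₀ := I₀) (I₁ := I₁) β) (strand γ) := h
    have := h'.strandLabels_eq
    rw [strandLabels_strand, strandLabels_strand, Set.singleton_eq_singleton_iff] at this
    exact (Arrow.mk_inj _ _).1 this

end BrauerCat
-- Counting the closed components
namespace BrauerCat

variable {C : Type u} [Category.{v} C] {I₀ : LeftIdeal C} {I₁ : RightIdeal C}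

namespace Diagram

variable {S T : List (C × Bool)}

/-! ### The closed components of a diagram -/

/-- The edge `e` starts to traverse a circle, along which the labels compose to `a`. -/
def LoopAt (D : Diagram I₀ I₁ S T) (e : D.E) (a : Arrow C) : Prop :=
  ∃ f, Walk D {e} e f a ∧ D.tgt f = D.src e

/-- The edge `e` is the first one of an interval, along which the labels compose to `a`. -/
def IntervalAt (D : Diagram I₀ I₁ S T) (e : D.E) (a : Arrow C) : Prop :=
  ∃ f, Walk D {e} e f a ∧ (∀ h, D.tgt h ≠ D.src e) ∧ ∀ h, D.src h ≠ D.tgt f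

/-- The component of `e`, read from `e` on, contributes the generator `x`. -/
def HasValue (D : Diagram I₀ I₁ S T) (e : D.E) (x : LoopSet C ⊕ IdealInter I₀ I₁) : Prop :=
  (∃ (Y : C) (β : Y ⟶ Y), LoopAt D e (Arrow.mk β) ∧ x = Sum.inl (Quot.mk _ ⟨Y, β⟩)) ∨
    ∃ i : IdealInter I₀ I₁, IntervalAt D e i.1 ∧ x = Sum.inr i

theorem HasValue.imp {D D' : Diagram I₀ I₁ S T} {e : D.E} {e' : D'.E}
    {x : LoopSet C ⊕ IdealInter I₀ I₁} (h : HasValue D e x)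
    (hl : ∀ a, LoopAt D e a → LoopAt D' e' a)
    (hi : ∀ a, IntervalAt D e a → IntervalAt D' e' a) : HasValue D' e' x := by
  obtain ⟨Y, β, h, rfl⟩ | ⟨i, h, rfl⟩ := h
  exacts [Or.inl ⟨Y, β, hl _ h, rfl⟩, Or.inr ⟨i, hi _ h, rfl⟩]

/-- The component of an edge. -/
def Component (D : Diagram I₀ I₁ S T) : Type := Quot fun e g : D.E => D.tgt e = D.src g

/-- The component of an edge. -/
def component (D : Diagram I₀ I₁ S T) (e : D.E) : D.Component := Quot.mk _ e

instance (D : Diagram I₀ I₁ S T) : Finite D.Component :=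
  have := D.finite_E
  Quot.finite _

/-- The component contributes the generator `x`. -/
def Contributes (D : Diagram I₀ I₁ S T) (x : LoopSet C ⊕ IdealInter I₀ I₁) (c : D.Component) :
    Prop :=
  ∃ e, D.component e = c ∧ HasValue D e x

/-- The number of components that contribute a given generator. -/
noncomputable def mult (D : Diagram I₀ I₁ S T) (x : LoopSet C ⊕ IdealInter I₀ I₁) : ℕ :=
  Nat.card {c // D.Contributes x c}

/-- The maps `k` and `r` need to be inverse to each other only on components. Condition `hv'`
handles a value that is read at an edge outside the image of `k`. -/
theorem mult_congr {D D' : Diagram I₀ I₁ S T} (k : D'.E → D.E) (r : D.E → D'.E)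
    (hk : ∀ a b, D'.tgt a = D'.src b → D.component (k a) = D.component (k b))
    (hr : ∀ e g, D.tgt e = D.src g → D'.component (r e) = D'.component (r g))
    (hrk : ∀ a, D'.component (r (k a)) = D'.component a)
    (hkr : ∀ e, D.component (k (r e)) = D.component e)
    (hv : ∀ a x, HasValue D' a x ↔ HasValue D (k a) x)
    (hv' : ∀ e x, HasValue D e x → ∃ a, D.component (k a) = D.component e ∧ HasValue D (k a) x) :
    D'.mult = D.mult := by
  let φ : D'.Component ≃ D.Component :=
    { toFun := Quot.lift (fun a => D.component (k a)) hk
      invFun := Quot.lift (fun e => D'.component (r e)) hr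
      left_inv := by
        rintro ⟨a⟩
        exact hrk a
      right_inv := by
        rintro ⟨e⟩
        exact hkr e }
  funext x
  refine Nat.card_congr (φ.subtypeEquiv fun c => ?_)
  constructor
  · rintro ⟨a, rfl, ha⟩
    exact ⟨k a, rfl, (hv a x).1 ha⟩
  · rintro ⟨e, he, hx⟩
    obtain ⟨a, h1, h2⟩ := hv' e x hx
    exact ⟨a, φ.injective (h1.trans he), (hv a x).2 h2⟩

/-- An embedding of the edges of a diagram as a union of components. -/
structure IsSaturated (D G : Diagram I₀ I₁ S T) (ι : D.E → G.E) : Prop where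
  inj : Function.Injective ι
  lab : ∀ e, G.lab (ι e) = D.lab e
  adj : ∀ e g, G.tgt (ι e) = G.src (ι g) ↔ D.tgt e = D.src g
  next : ∀ e h, G.tgt (ι e) = G.src h → h ∈ Set.range ι
  prev : ∀ e h, G.tgt h = G.src (ι e) → h ∈ Set.range ι

namespace IsSaturated

variable {D G : Diagram I₀ I₁ S T} {ι : D.E → G.E}

theorem walk (hι : IsSaturated D G ι) {e f : D.E} {a : Arrow C} (h : Walk D {e} e f a) :
    Walk G {ι e} (ι e) (ι f) a := by
  induction h with
  | start =>
    rw [← hι.lab]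
    exact .start
  | step _ h1 h2 h3 ih =>
    exact ih.step ((hι.adj _ _).2 h1) (fun h => h2 (hι.inj h)) (by rwa [hι.lab])

theorem exists_walk (hι : IsSaturated D G ι) {e : D.E} {f : G.E} {a : Arrow C}
    (h : Walk G {ι e} (ι e) f a) : ∃ f', ι f' = f ∧ Walk D {e} e f' a := by
  induction h with
  | start =>
    rw [hι.lab]
    exact ⟨e, rfl, .start⟩
  | step _ h1 h2 h3 ih =>
    obtain ⟨f', rfl, hw⟩ := ih
    obtain ⟨g, rfl⟩ := hι.next _ _ h1
    refine ⟨g, rfl, hw.step ((hι.adj _ _).1 h1) ?_ (by rwa [← hι.lab])⟩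
    rintro rfl
    exact h2 rfl

theorem hasValue_iff (hι : IsSaturated D G ι) {e : D.E} {x : LoopSet C ⊕ IdealInter I₀ I₁} :
    HasValue G (ι e) x ↔ HasValue D e x := by
  constructor
  · refine fun h => h.imp (fun a => ?_) fun a => ?_
    · rintro ⟨f, hw, hf⟩
      obtain ⟨f, rfl, hw'⟩ := hι.exists_walk hw
      exact ⟨f, hw', (hι.adj _ _).1 hf⟩
    · rintro ⟨f, hw, h1, h2⟩
      obtain ⟨f, rfl, hw'⟩ := hι.exists_walk hw
      exact ⟨f, hw', fun h hh => h1 (ι h) ((hι.adj _ _).2 hh),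
        fun h hh => h2 (ι h) ((hι.adj _ _).2 hh.symm).symm⟩
  · refine fun h => h.imp (fun a => ?_) fun a => ?_
    · rintro ⟨f, hw, hf⟩
      exact ⟨ι f, hι.walk hw, (hι.adj _ _).2 hf⟩
    · rintro ⟨f, hw, h1, h2⟩
      refine ⟨ι f, hι.walk hw, fun h hh => ?_, fun h hh => ?_⟩
      · obtain ⟨h, rfl⟩ := hι.prev _ _ hh
        exact h1 h ((hι.adj _ _).1 hh)
      · obtain ⟨h, rfl⟩ := hι.next _ _ hh.symm
        exact h2 h ((hι.adj _ _).1 hh.symm).symm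

end IsSaturated

theorem Iso.mult_eq {D D' : Diagram I₀ I₁ S T} (h : Iso D D') : D.mult = D'.mult := by
  obtain ⟨j, k, h₁, h₂, h₃, h₄⟩ := h
  have hadj : ∀ e g, D'.tgt (k e) = D'.src (k g) ↔ D.tgt e = D.src g := fun e g => by
    rw [h₂, h₃, (j.injective.sumMap Function.injective_id).eq_iff]
  have hι : IsSaturated D D' k :=
    ⟨k.injective, h₄, hadj, fun _ h _ => k.surjective h, fun _ h _ => k.surjective h⟩
  refine mult_congr k k.symm (fun a b hab => Quot.sound ((hadj a b).2 hab)) (fun e g heg => ?_)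
    (fun a => by rw [k.symm_apply_apply]) (fun e => by rw [k.apply_symm_apply])
    (fun a x => hι.hasValue_iff.symm) fun e x hx => ⟨k.symm e, ?_⟩
  · refine Quot.sound ((hadj _ _).1 ?_)
    rwa [k.apply_symm_apply, k.apply_symm_apply]
  · rw [k.apply_symm_apply]
    exact ⟨rfl, hx⟩

/-- The walk cannot pass through `e` before its end: at most one edge starts at each vertex, so the
next edge would be `g`, which is forbidden. It can thus be prefixed by `e`. -/
theorem Walk.rotate {D : Diagram I₀ I₁ S T} {e g h : D.E} {a b : Arrow C}
    (heg : D.tgt e = D.src g) (hne : e ≠ g) (hw : Walk D {g} g h a) (hh : h ≠ e)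
    (hab : IsComp (D.lab e) a b) : Walk D {e} e h b := by
  induction hw generalizing b with
  | start => exact Walk.start.step heg (fun h => hne h.symm) hab
  | @step f h y z hw h1 h2 h3 ih =>
    have hf : f ≠ e := by
      rintro rfl
      exact h2 (D.src_inj (h1.symm.trans heg))
    obtain ⟨c, h4, h5⟩ := h3.assoc_symm hab
    exact (ih hf h4).step h1 hh h5

theorem Walk.left_eq {D : Diagram I₀ I₁ S T} {K : Set D.E} {e f : D.E} {a : Arrow C}
    (h : Walk D K e f a) : a.left = (D.lab e).left := by
  induction h with
  | start => rfl
  | step _ _ _ h ih => rw [h.left_eq, ih]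

/-- A circle read from `g` ends with `e`. If its composite is `γ ≫ δ`, where `δ` is the label of
`e`, then the composite read from `e` is `δ ≫ γ`, which is the same loop. An interval cannot have
`g` as its first edge, since `e` precedes it. -/
theorem HasValue.rotate {D : Diagram I₀ I₁ S T} {e g : D.E} {x : LoopSet C ⊕ IdealInter I₀ I₁}
    (heg : D.tgt e = D.src g) (hne : e ≠ g) (h : HasValue D g x) : HasValue D e x := by
  obtain ⟨Y, β, ⟨f, hw, hf⟩, rfl⟩ | ⟨i, ⟨f, -, h, -⟩, -⟩ := h
  · obtain rfl := D.tgt_inj (hf.trans heg.symm)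
    generalize hb : Arrow.mk β = b at hw
    cases hw with
    | start => exact absurd rfl hne
    | @step f' _ a _ hw h1 h2 h3 =>
      obtain ⟨c, hc⟩ := exists_isComp ((D.lab_comm heg).trans hw.left_eq.symm)
      have hff : f' ≠ f := by
        rintro rfl
        exact h2 (D.src_inj (h1.symm.trans heg))
      have hw' := hw.rotate heg hne hff hc
      obtain ⟨X, Y', Z, γ, δ, rfl, h4, rfl⟩ := h3
      rw [h4] at hc
      obtain ⟨X', Y'', Z', γ', δ', h5, h6, rfl⟩ := hc
      cases hb
      cases h5
      cases h6
      exact Or.inl ⟨_, _, ⟨f', hw', h1⟩, congrArg Sum.inl (Quot.sound (.rotate γ δ))⟩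
  · exact absurd heg (h e)

/-- The edge `e` is always followed by `g`, so it neither closes a circle read from some `k a` nor
ends an interval. The final edge is therefore a `lastEdge`, and `walk_singleton_iff` applies. -/
theorem IsErase.hasValue_iff {D D' : Diagram I₀ I₁ S T} {v e g j k e'}
    (h : IsErase D D' v e g j k e') {a : D'.E} {x : LoopSet C ⊕ IdealInter I₀ I₁} :
    HasValue D' a x ↔ HasValue D (k a) x := by
  have hs : ∀ f b, D.tgt (lastEdge g k e' f) = D.src (k b) ↔ D'.tgt f = D'.src b := fun f b => by
    rw [h.tgt_lastEdge, h.src_k, h.map_j_injective.eq_iff]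
  have he : ∀ b, D.tgt e ≠ D.src (k b) := fun b hb => by
    rw [h.tgt_eq_src] at hb
    exact h.k_ne b (D.src_inj hb).symm
  constructor
  · refine fun hx => hx.imp (fun y => ?_) fun y => ?_
    · rintro ⟨f, hw, hf⟩
      exact ⟨_, h.walk_singleton_iff.1 hw, (hs _ _).2 hf⟩
    · rintro ⟨f, hw, h1, h2⟩
      refine ⟨_, h.walk_singleton_iff.1 hw, fun b hb => ?_, fun b hb => ?_⟩
      · obtain ⟨b, rfl⟩ := h.exists_lastEdge (f := b) (by
          rintro rfl
          exact he _ hb)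
        exact h1 b ((hs _ _).1 hb)
      · by_cases hbg : b = g
        · rw [hbg, h.src_g, h.tgt_lastEdge] at hb
          exact h.map_j_ne _ hb.symm
        · obtain ⟨b, rfl⟩ := h.exists_k hbg
          exact h2 b ((hs _ _).1 hb.symm).symm
  · refine fun hx => hx.imp (fun y => ?_) fun y => ?_
    · rintro ⟨f, hw, hf⟩
      obtain ⟨f, rfl⟩ := h.exists_lastEdge (f := f) (by
          rintro rfl
          exact he _ hf)
      exact ⟨f, h.walk_singleton_iff.2 hw, (hs _ _).1 hf⟩
    · rintro ⟨f, hw, h1, h2⟩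
      obtain ⟨f, rfl⟩ := h.exists_lastEdge (f := f) (by
          rintro rfl
          exact h2 g h.tgt_eq_src.symm)
      exact ⟨f, h.walk_singleton_iff.2 hw, fun b hb => h1 _ ((hs _ _).2 hb),
        fun b hb => h2 _ ((hs _ _).2 hb.symm).symm⟩

/-- The only edge lost is `g`, which belongs to the component of `e`. The retraction `r` sends it to
`e'`, and a value read at `g` is also read at `e` by `HasValue.rotate`. -/
theorem IsErase.mult_eq {D D' : Diagram I₀ I₁ S T} {v e g j k e'}
    (h : IsErase D D' v e g j k e') : D'.mult = D.mult := by
  classical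
  have hlast : ∀ a, D.component (k a) = D.component (lastEdge g k e' a) := by
    intro a
    unfold lastEdge
    split_ifs with ha
    · rw [ha, h.k_e]
      exact Quot.sound h.tgt_eq_src
    · rfl
  have hr : ∀ b : D.E, ∃ a, (b ≠ g → k a = b) ∧ (b = g → a = e') := by
    intro b
    by_cases hb : b = g
    · exact ⟨e', by simp [hb], by simp⟩
    · obtain ⟨a, rfl⟩ := h.exists_k hb
      exact ⟨a, by simp, fun h => absurd h hb⟩
  choose r hr hr' using hr
  have hrk : ∀ a, r (k a) = a := fun a => h.k_inj (hr _ (h.k_ne a))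
  have hrl : ∀ a, r (lastEdge g k e' a) = a := by
    intro a
    unfold lastEdge
    split_ifs with ha
    · rw [hr' g rfl, ha]
    · exact hrk a
  have hkg : k (r g) = e := by rw [hr' g rfl, h.k_e]
  refine mult_congr k r ?_ ?_ ?_ ?_ (fun _ _ => h.hasValue_iff) ?_
  · intro a b hab
    rw [hlast]
    refine Quot.sound ?_
    rw [h.tgt_lastEdge, h.src_k, hab]
  · intro b c hbc
    by_cases hb : b = e
    · rw [hb, h.tgt_eq_src] at hbc
      rw [← D.src_inj hbc, hr' g rfl, hb, ← h.k_e, hrk]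
    · obtain ⟨b, rfl⟩ := h.exists_lastEdge hb
      by_cases hc : c = g
      · rw [h.tgt_lastEdge, hc, h.src_g] at hbc
        exact absurd hbc (h.map_j_ne _)
      · obtain ⟨c, rfl⟩ := h.exists_k hc
        rw [hrl, hrk]
        refine Quot.sound (h.map_j_injective ?_)
        rw [← h.tgt_lastEdge, ← h.src_k, hbc]
  · intro a
    rw [hrk]
  · intro b
    by_cases hb : b = g
    · rw [hb, hkg]
      exact Quot.sound h.tgt_eq_src
    · rw [hr b hb]
  · intro b x hx
    by_cases hb : b = g
    · refine ⟨r g, ?_, ?_⟩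
      · rw [hb, hkg]
        exact Quot.sound h.tgt_eq_src
      · rw [hkg]
        rw [hb] at hx
        exact hx.rotate h.tgt_eq_src h.e_ne_g
    · refine ⟨r b, ?_⟩
      rw [hr b hb]
      exact ⟨rfl, hx⟩

theorem Rel.mult_eq {D D' : Diagram I₀ I₁ S T} (h : Rel D D') : D.mult = D'.mult := by
  obtain h | h := h
  · exact h.mult_eq
  · obtain ⟨v, e, g, j, k, e', h⟩ := erase_iff.1 h
    exact h.mult_eq.symm

end Diagram

end BrauerCat
-- Closed diagrams and the endomorphisms of the unit
namespace BrauerCat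

namespace Diagram

instance {C : Type u} : IsEmpty (Bd ([] : List (C × Bool)) []) :=
  inferInstanceAs (IsEmpty (Fin 0 ⊕ Fin 0))

instance {C : Type u} : IsEmpty (Fin ([] : List (C × Bool)).length) :=
  inferInstanceAs (IsEmpty (Fin 0))

/-- Only middle points are shared by the two diagrams, and gluing along the empty sequence has none.
-/
theorem lower_ne_upper {C : Type u} {A B : Type} (x : A ⊕ Bd ([] : List (C × Bool)) [])
    (y : B ⊕ Bd ([] : List (C × Bool)) []) :
    (lower x : ((A ⊕ B) ⊕ Fin ([] : List (C × Bool)).length) ⊕ Bd ([] : List (C × Bool)) []) ≠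
      upper y := by
  rcases x with x | x
  · rcases y with y | y
    · simp [lower, upper]
    · exact isEmptyElim y
  · exact isEmptyElim x

end Diagram

variable {C : Type u} [Category.{v} C] {I₀ : LeftIdeal C} {I₁ : RightIdeal C}

namespace Diagram

/-! ### Closed diagrams -/

theorem isSaturated_glue_inl (D D' : Diagram I₀ I₁ [] []) :
    IsSaturated D (D.glue D') Sum.inl where
  inj := Sum.inl_injective
  lab _ := rfl
  adj _ _ := lower_inj.eq_iff
  next := by
    rintro e (h | h) heh
    exacts [⟨h, rfl⟩, absurd heh (lower_ne_upper _ _)]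
  prev := by
    rintro e (h | h) heh
    exacts [⟨h, rfl⟩, absurd heh.symm (lower_ne_upper _ _)]

theorem isSaturated_glue_inr (D D' : Diagram I₀ I₁ [] []) :
    IsSaturated D' (D.glue D') Sum.inr where
  inj := Sum.inr_injective
  lab _ := rfl
  adj _ _ := upper_inj.eq_iff
  next := by
    rintro e (h | h) heh
    exacts [absurd heh.symm (lower_ne_upper _ _), ⟨h, rfl⟩]
  prev := by
    rintro e (h | h) heh
    exacts [absurd heh (lower_ne_upper _ _), ⟨h, rfl⟩]

/-- Gluing closed diagrams is disjoint union, so the components of the result are those of the two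
pieces, with the same values. -/
theorem mult_glue (D D' : Diagram I₀ I₁ [] []) (x : LoopSet C ⊕ IdealInter I₀ I₁) :
    (D.glue D').mult x = D.mult x + D'.mult x := by
  have hl := isSaturated_glue_inl D D'
  have hr := isSaturated_glue_inr D D'
  let φ : (D.glue D').Component ≃ D.Component ⊕ D'.Component :=
    { toFun := Quot.lift
        (Sum.elim (fun e => Sum.inl (D.component e)) fun e => Sum.inr (D'.component e)) (by
          rintro (e | e) (g | g) h
          · exact congrArg Sum.inl (Quot.sound ((hl.adj e g).1 h))
          · exact absurd h (lower_ne_upper _ _)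
          · exact absurd h.symm (lower_ne_upper _ _)
          · exact congrArg Sum.inr (Quot.sound ((hr.adj e g).1 h)))
      invFun := Sum.elim
        (Quot.lift (fun e => (D.glue D').component (Sum.inl e)) fun e g h =>
          Quot.sound ((hl.adj e g).2 h))
        (Quot.lift (fun e => (D.glue D').component (Sum.inr e)) fun e g h =>
          Quot.sound ((hr.adj e g).2 h))
      left_inv := by
        rintro ⟨e | e⟩ <;> rfl
      right_inv := by
        rintro (c | c)
        · induction c using Quot.ind
          rfl
        · induction c using Quot.ind
          rfl }
  refine Eq.trans (Nat.card_congr (Equiv.trans (φ.subtypeEquiv fun c => ?_)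
    (Equiv.subtypeSum (p := Sum.elim (D.Contributes x) (D'.Contributes x))))) Nat.card_sum
  constructor
  · rintro ⟨e | e, rfl, h⟩
    · exact ⟨e, rfl, hl.hasValue_iff.1 h⟩
    · exact ⟨e, rfl, hr.hasValue_iff.1 h⟩
  · intro h
    obtain ⟨c, rfl⟩ := φ.symm.surjective c
    rw [φ.apply_symm_apply] at h
    obtain c | c := c
    · obtain ⟨e, rfl, h⟩ := h
      exact ⟨Sum.inl e, rfl, hl.hasValue_iff.2 h⟩
    · obtain ⟨e, rfl, h⟩ := h
      exact ⟨Sum.inr e, rfl, hr.hasValue_iff.2 h⟩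

theorem mult_ident_nil (x : LoopSet C ⊕ IdealInter I₀ I₁) :
    (ident [] : Diagram I₀ I₁ [] []).mult x = 0 := by
  have : IsEmpty {c // (ident [] : Diagram I₀ I₁ [] []).Contributes x c} :=
    ⟨fun ⟨_, e, _⟩ => Fin.elim0 e⟩
  exact Nat.card_of_isEmpty

open Classical in
theorem mult_eq_count_singleton {D : Diagram I₀ I₁ [] []} (e₀ : D.E) (he : ∀ e, e = e₀)
    {x : LoopSet C ⊕ IdealInter I₀ I₁} (hx : ∀ y, HasValue D e₀ y ↔ y = x)
    (y : LoopSet C ⊕ IdealInter I₀ I₁) : D.mult y = Multiset.count y {x} := by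
  rw [Multiset.count_singleton]
  split_ifs with hy
  · refine Nat.card_eq_one_iff_exists.2 ⟨⟨_, e₀, rfl, (hx y).2 hy⟩, ?_⟩
    rintro ⟨_, e, rfl, -⟩
    exact Subtype.ext (congrArg D.component (he e))
  · have : IsEmpty {c // D.Contributes y c} := ⟨by
      rintro ⟨_, e, -, h⟩
      rw [he e, hx] at h
      exact hy h⟩
    exact Nat.card_of_isEmpty

/-- The only edge is in the stop set, so the only walk is the trivial one and its composite is `β`
itself. -/
theorem hasValue_circle_iff {X : C} (β : X ⟶ X) (y : LoopSet C ⊕ IdealInter I₀ I₁) :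
    HasValue (circle (I₀ := I₀) (I₁ := I₁) β) () y ↔ y = Sum.inl (Quot.mk _ ⟨X, β⟩) := by
  constructor
  · rintro (⟨Y, γ, ⟨f, hw, -⟩, rfl⟩ | ⟨i, ⟨f, -, h, -⟩, -⟩)
    · generalize hc : Arrow.mk γ = c at hw
      cases hw with
      | start =>
        cases hc
        rfl
      | step _ _ h _ => exact absurd rfl h
    · exact absurd rfl (h ())
  · rintro rfl
    exact Or.inl ⟨X, β, ⟨(), .start, rfl⟩, rfl⟩

theorem hasValue_interval_iff (i : IdealInter I₀ I₁) (y : LoopSet C ⊕ IdealInter I₀ I₁) :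
    HasValue (interval i) () y ↔ y = Sum.inr i := by
  constructor
  · rintro (⟨Y, γ, ⟨f, -, h⟩, -⟩ | ⟨i', ⟨f, hw, -⟩, rfl⟩)
    · exact absurd (Sum.inl_injective h) Bool.noConfusion
    · generalize hc : i'.1 = c at hw
      cases hw with
      | start => exact congrArg Sum.inr (Subtype.ext hc)
      | step _ _ h _ => exact absurd rfl h
  · rintro rfl
    exact Or.inr ⟨i, ⟨(), .start, fun _ h => absurd (Sum.inl_injective h) Bool.noConfusion,
      fun _ h => absurd (Sum.inl_injective h) Bool.noConfusion⟩, rfl⟩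

theorem glue_comm (D D' : Diagram I₀ I₁ [] []) : Iso (D.glue D') (D'.glue D) := by
  have hl : ∀ {A B : Type} (x : A ⊕ Bd ([] : List (C × Bool)) []),
      (upper x : ((B ⊕ A) ⊕ Fin ([] : List (C × Bool)).length) ⊕ Bd ([] : List (C × Bool)) []) =
        Sum.map ((Equiv.sumComm A B).sumCongr (Equiv.refl _)) id (lower x) := by
    rintro A B (x | x)
    exacts [rfl, isEmptyElim x]
  have hr : ∀ {A B : Type} (x : B ⊕ Bd ([] : List (C × Bool)) []),
      (lower x : ((B ⊕ A) ⊕ Fin ([] : List (C × Bool)).length) ⊕ Bd ([] : List (C × Bool)) []) =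
        Sum.map ((Equiv.sumComm A B).sumCongr (Equiv.refl _)) id (upper x) := by
    rintro A B (x | x)
    exacts [rfl, isEmptyElim x]
  refine ⟨(Equiv.sumComm D.V D'.V).sumCongr (Equiv.refl _), Equiv.sumComm D.E D'.E, ?_, ?_, ?_, ?_⟩
  · rintro ((v | v) | v) <;> rfl
  · rintro (e | e)
    exacts [hl _, hr _]
  · rintro (e | e)
    exacts [hl _, hr _]
  · rintro (e | e) <;> rfl

/-! ### Rotating a circle -/

/-- The circle with two vertices, labelled by `X` and `Y`, and two edges, labelled by `β` and
`γ`. -/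
def bigon {X Y : C} (β : X ⟶ Y) (γ : Y ⟶ X) : Diagram I₀ I₁ [] [] where
  V := Bool
  E := Bool
  finite_V := inferInstance
  finite_E := inferInstance
  vlab b := if b then Y else X
  src b := Sum.inl b
  tgt b := Sum.inl (!b)
  lab b := if b then Arrow.mk γ else Arrow.mk β
  lab_left := by rintro (_ | _) <;> rfl
  lab_right := by rintro (_ | _) <;> rfl
  src_inj := Sum.inl_injective
  tgt_inj _ _ h := Bool.not_inj (Sum.inl_injective h)
  bd_src := isEmptyElim
  bd_tgt := isEmptyElim
  not_isolated b := Or.inl ⟨b, rfl⟩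
  start_mem _ b _ h := absurd (congrArg Sum.inl (Bool.not_not b)) (h (!b))
  end_mem _ b _ h := absurd rfl (h b)

theorem bigon_iso {X Y : C} (β : X ⟶ Y) (γ : Y ⟶ X) :
    Iso (bigon (I₀ := I₀) (I₁ := I₁) β γ) (bigon γ β) :=
  ⟨Equiv.boolNot, Equiv.boolNot, by rintro (_ | _) <;> rfl, by rintro (_ | _) <;> rfl,
    by rintro (_ | _) <;> rfl, by rintro (_ | _) <;> rfl⟩

/-- The vertex `true`, labelled by `Y`, is erased. -/
theorem bigon_sim {X Y : C} (β : X ⟶ Y) (γ : Y ⟶ X) :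
    Sim (bigon (I₀ := I₀) (I₁ := I₁) β γ) (circle (β ≫ γ)) := by
  let D := bigon (I₀ := I₀) (I₁ := I₁) β γ
  let k : Unit → D.E := fun _ => false
  have hk : true ∉ Set.range k := fun ⟨_, h⟩ => Bool.noConfusion h
  have hw : Walk D (Set.range k) (k ()) true (Arrow.mk (β ≫ γ)) :=
    (Walk.start (D := D)).step rfl hk (IsComp.mk β γ)
  refine sim_of_merge D _ (fun _ => false) k (fun _ _ _ => rfl) ?_ (fun _ => rfl) (fun _ => rfl)
    (fun _ => ⟨_, hw, rfl⟩) ?_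
  · rintro v
    constructor
    · rintro ⟨w, rfl⟩ g hg
      exact ⟨(), (Sum.inl_injective hg).symm⟩
    · intro h
      obtain ⟨w, hw⟩ := h v rfl
      exact ⟨w, hw⟩
  · rintro (_ | _)
    exacts [⟨(), _, .start⟩, ⟨(), _, hw⟩]

/-- Both circles come from the same circle with two vertices, by erasing one or the other. -/
theorem circle_comp_sim {X Y : C} (β : X ⟶ Y) (γ : Y ⟶ X) :
    Sim (circle (I₀ := I₀) (I₁ := I₁) (β ≫ γ)) (circle (γ ≫ β)) :=
  (bigon_sim β γ).symm.trans ((bigon_iso β γ).sim.trans (bigon_sim γ β))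

/-! ### Splitting off components -/

/-- A point whose vertex, if any, satisfies `p`, as a point of the corresponding subtype. -/
def restrictPt {A B : Type*} (p : A → Prop) : (x : A ⊕ B) → (∀ v, x = Sum.inl v → p v) →
    {v // p v} ⊕ B
  | Sum.inl v, h => Sum.inl ⟨v, h v rfl⟩
  | Sum.inr b, _ => Sum.inr b

theorem map_restrictPt {A B : Type} (p : A → Prop) (x : A ⊕ B) (h) :
    Sum.map Subtype.val id (restrictPt p x h) = x := by
  rcases x with x | x <;> rfl

theorem restrictPt_eq_iff {A B : Type} (p : A → Prop) (x : A ⊕ B) (h) (y : {v // p v} ⊕ B) :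
    restrictPt p x h = y ↔ x = Sum.map Subtype.val id y := by
  rw [← (map_val_injective _).eq_iff, map_restrictPt]

theorem elim_restrictPt {A B L : Type*} (p : A → Prop) (x : A ⊕ B) (h) (f : A → L) (g : B → L) :
    Sum.elim (fun v : {v // p v} => f v) g (restrictPt p x h) = Sum.elim f g x := by
  rcases x with x | x <;> rfl

/-- The part of a closed diagram that consists of a given union of components. -/
def restrict (D : Diagram I₀ I₁ [] []) (P : D.E → Prop)
    (hP : ∀ e g, D.tgt e = D.src g → (P e ↔ P g)) : Diagram I₀ I₁ [] [] where
  V := {v // ∃ e, P e ∧ (D.src e = Sum.inl v ∨ D.tgt e = Sum.inl v)}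
  E := {e // P e}
  finite_V := have := D.finite_V; inferInstance
  finite_E := have := D.finite_E; inferInstance
  vlab v := D.vlab v
  src e := restrictPt _ (D.src e) fun _ h => ⟨e, e.2, Or.inl h⟩
  tgt e := restrictPt _ (D.tgt e) fun _ h => ⟨e, e.2, Or.inr h⟩
  lab e := D.lab e
  lab_left e := by
    rw [D.lab_left]
    exact (elim_restrictPt _ _ _ _ _).symm
  lab_right e := by
    rw [D.lab_right]
    exact (elim_restrictPt _ _ _ _ _).symm
  src_inj e g h := by
    rw [restrictPt_eq_iff, map_restrictPt] at h
    exact Subtype.ext (D.src_inj h)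
  tgt_inj e g h := by
    rw [restrictPt_eq_iff, map_restrictPt] at h
    exact Subtype.ext (D.tgt_inj h)
  bd_src := isEmptyElim
  bd_tgt := isEmptyElim
  not_isolated := by
    rintro ⟨v, e, he, h | h⟩
    · exact Or.inl ⟨⟨e, he⟩, (restrictPt_eq_iff _ _ _ _).2 h⟩
    · exact Or.inr ⟨⟨e, he⟩, (restrictPt_eq_iff _ _ _ _).2 h⟩
  start_mem e v he h := by
    rw [restrictPt_eq_iff] at he
    -- By `hP` the neighbours of a selected edge are selected, so an inner endpoint of the part is
    -- already one of `D`.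
    refine D.start_mem e v he fun g hg => ?_
    exact h ⟨g, (hP _ _ (hg.trans he.symm)).2 e.2⟩ ((restrictPt_eq_iff _ _ _ _).2 hg)
  end_mem e v he h := by
    rw [restrictPt_eq_iff] at he
    refine D.end_mem e v he fun g hg => ?_
    exact h ⟨g, (hP _ _ (he.trans hg.symm)).1 e.2⟩ ((restrictPt_eq_iff _ _ _ _).2 hg)

theorem glue_restrict_iso (D : Diagram I₀ I₁ [] []) (P : D.E → Prop)
    (hP : ∀ e g, D.tgt e = D.src g → (P e ↔ P g)) :
    Iso ((D.restrict P hP).glue (D.restrict (fun e => ¬P e) fun e g h => not_congr (hP e g h)))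
      D := by
  classical
  set D₁ := D.restrict P hP
  set D₂ := D.restrict (fun e => ¬P e) fun e g h => not_congr (hP e g h)
  let j : (D₁.V ⊕ D₂.V) ⊕ Fin ([] : List (C × Bool)).length → D.V :=
    Sum.elim (Sum.elim Subtype.val Subtype.val) isEmptyElim
  -- Two edges that share a vertex either coincide, by injectivity of `src` and `tgt`, or are
  -- consecutive; in both cases `P` holds for both or for neither.
  have hdisj : ∀ (v : D₁.V) (w : D₂.V), v.1 ≠ w.1 := by
    rintro ⟨v, e, he, h⟩ ⟨w, g, hg, h'⟩ (rfl : v = w)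
    obtain h | h := h <;> obtain h' | h' := h'
    · exact hg (D.src_inj (h.trans h'.symm) ▸ he)
    · exact hg ((hP g e (h'.trans h.symm)).2 he)
    · exact hg ((hP e g (h.trans h'.symm)).1 he)
    · exact hg (D.tgt_inj (h.trans h'.symm) ▸ he)
  have hj : Function.Bijective j := by
    constructor
    · rintro ((v | v) | v) ((w | w) | w) h
      · exact congrArg (Sum.inl ∘ Sum.inl) (Subtype.ext h)
      · exact absurd h (hdisj v w)
      · exact isEmptyElim w
      · exact absurd h.symm (hdisj w v)
      · exact congrArg (Sum.inl ∘ Sum.inr) (Subtype.ext h)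
      all_goals exact isEmptyElim ‹Fin ([] : List (C × Bool)).length›
    · intro v
      -- The absence of isolated vertices ensures that the two parts cover all vertices.
      obtain ⟨e, h⟩ : ∃ e, D.src e = Sum.inl v ∨ D.tgt e = Sum.inl v := by
        obtain ⟨e, h⟩ | ⟨e, h⟩ := D.not_isolated v
        exacts [⟨e, Or.inl h⟩, ⟨e, Or.inr h⟩]
      by_cases he : P e
      · exact ⟨Sum.inl (Sum.inl ⟨v, e, he, h⟩), rfl⟩
      · exact ⟨Sum.inl (Sum.inr ⟨v, e, he, h⟩), rfl⟩
  have hl : ∀ x : D₁.V ⊕ Bd ([] : List (C × Bool)) [],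
      (Sum.map j id (lower x) : D.V ⊕ Bd ([] : List (C × Bool)) []) =
        Sum.map Subtype.val id x := by
    rintro (x | x)
    exacts [rfl, isEmptyElim x]
  have hr : ∀ x : D₂.V ⊕ Bd ([] : List (C × Bool)) [],
      (Sum.map j id (upper x) : D.V ⊕ Bd ([] : List (C × Bool)) []) =
        Sum.map Subtype.val id x := by
    rintro (x | x)
    exacts [rfl, isEmptyElim x]
  refine ⟨Equiv.ofBijective j hj, Equiv.sumCompl P, ?_, ?_, ?_, ?_⟩
  · rintro ((v | v) | v)
    exacts [rfl, rfl, isEmptyElim v]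
  · rintro (e | e)
    · exact ((hl _).trans (map_restrictPt _ _ _)).symm
    · exact ((hr _).trans (map_restrictPt _ _ _)).symm
  · rintro (e | e)
    · exact ((hl _).trans (map_restrictPt _ _ _)).symm
    · exact ((hr _).trans (map_restrictPt _ _ _)).symm
  · rintro (e | e) <;> rfl

theorem exists_src_eq (D : Diagram I₀ I₁ [] []) (e : D.E) : ∃ v, D.src e = Sum.inl v := by
  rcases h : D.src e with v | b
  exacts [⟨v, rfl⟩, isEmptyElim b]

theorem exists_tgt_eq (D : Diagram I₀ I₁ [] []) (e : D.E) : ∃ v, D.tgt e = Sum.inl v := by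
  rcases h : D.tgt e with v | b
  exacts [⟨v, rfl⟩, isEmptyElim b]

/-- A closed diagram with one edge is a circle or an interval. -/
theorem iso_of_unique (D : Diagram I₀ I₁ [] []) (e₀ : D.E) (he : ∀ e, e = e₀) :
    (∃ (X : C) (β : X ⟶ X), Iso (circle β) D) ∨ ∃ i, Iso (interval i) D := by
  obtain ⟨v, hv⟩ := D.exists_src_eq e₀
  obtain ⟨w, hw⟩ := D.exists_tgt_eq e₀
  have hV : ∀ x, x = v ∨ x = w := by
    intro x
    obtain ⟨e, h⟩ | ⟨e, h⟩ := D.not_isolated x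
    · rw [he e, hv] at h
      exact Or.inl (Sum.inl_injective h).symm
    · rw [he e, hw] at h
      exact Or.inr (Sum.inl_injective h).symm
  have hk : Function.Bijective (fun _ : Unit => e₀) :=
    ⟨fun _ _ _ => rfl, fun e => ⟨(), (he e).symm⟩⟩
  have hl : (D.lab e₀).left = D.vlab v := by rw [D.lab_left, hv]; rfl
  have hr : (D.lab e₀).right = D.vlab w := by rw [D.lab_right, hw]; rfl
  by_cases hvw : v = w
  · subst hvw
    left
    obtain ⟨X, β, hβ⟩ : ∃ (X : C) (β : X ⟶ X), D.lab e₀ = Arrow.mk β := by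
      generalize D.lab e₀ = a at hl hr
      obtain ⟨X, Y, β⟩ := a
      obtain rfl : X = Y := hl.trans hr.symm
      exact ⟨X, β, rfl⟩
    rw [hβ] at hl
    have hj : Function.Bijective (fun _ : Unit => v) :=
      ⟨fun _ _ _ => rfl, fun x => ⟨(), ((hV x).elim id id).symm⟩⟩
    exact ⟨X, β, Equiv.ofBijective _ hj, Equiv.ofBijective _ hk, fun _ => hl.symm, fun _ => hv,
      fun _ => hw, fun _ => hβ⟩
  · right
    have hj : Function.Bijective (fun b : Bool => if b then w else v) := by
      constructor
      · rintro (_ | _) (_ | _) h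
        · rfl
        · exact absurd h hvw
        · exact absurd h.symm hvw
        · rfl
      · intro x
        obtain rfl | rfl := hV x
        exacts [⟨false, rfl⟩, ⟨true, rfl⟩]
    -- The only edge neither ends at `v` nor starts at `w`. Both are inner endpoints, so its label
    -- lies in both ideals.
    refine ⟨⟨D.lab e₀, D.start_mem e₀ v hv fun e h => ?_, D.end_mem e₀ w hw fun e h => ?_⟩,
      Equiv.ofBijective _ hj, Equiv.ofBijective _ hk, ?_, fun _ => hv, fun _ => hw, fun _ => rfl⟩
    · rw [he e, hw] at h
      exact hvw (Sum.inl_injective h).symm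
    · rw [he e, hv] at h
      exact hvw (Sum.inl_injective h)
    · rintro (_ | _)
      exacts [hl.symm, hr.symm]

theorem iso_ident_nil (D : Diagram I₀ I₁ [] []) [IsEmpty D.E] : Iso D (ident []) := by
  have : IsEmpty D.V := ⟨fun v => (D.not_isolated v).elim (fun ⟨e, _⟩ => isEmptyElim e)
    fun ⟨e, _⟩ => isEmptyElim e⟩
  exact ⟨Equiv.equivOfIsEmpty D.V Empty, Equiv.equivOfIsEmpty D.E (Fin 0), isEmptyElim, isEmptyElim,
    isEmptyElim, isEmptyElim⟩

end Diagram

open Diagram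

/-! ### The endomorphisms of the unit object -/

/-- The endomorphism of the unit object represented by a closed diagram. -/
def ofClosed (D : Diagram I₀ I₁ [] []) : End (𝟙_ (BrauerCat I₀ I₁)) := Hom.mk D

/-- The endomorphisms of the unit object commute. -/
@[reducible]
def endCommMonoid (I₀ : LeftIdeal C) (I₁ : RightIdeal C) :
    CommMonoid (End (𝟙_ (BrauerCat I₀ I₁))) where
  mul_comm := by
    rintro ⟨D⟩ ⟨D'⟩
    exact (glue_comm D' D).sim

attribute [local instance] endCommMonoid

/-- The circle of a loop, and the interval of an element of both ideals. -/
def generator (x : LoopSet C ⊕ IdealInter I₀ I₁) : End (𝟙_ (BrauerCat I₀ I₁)) :=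
  Sum.elim (Quot.lift (fun l : Σ X : C, X ⟶ X => ofClosed (circle l.2)) (by
    rintro _ _ ⟨β, γ⟩
    exact circle_comp_sim β γ)) (fun i => ofClosed (interval i)) x

/-- The endomorphism of the unit object given by a multiset of generators. -/
def ofMultiset (I₀ : LeftIdeal C) (I₁ : RightIdeal C) :
    Multiplicative (Multiset (LoopSet C ⊕ IdealInter I₀ I₁)) →* End (𝟙_ (BrauerCat I₀ I₁)) where
  toFun m := ((Multiplicative.toAdd m).map generator).prod
  map_one' := by simp
  map_mul' := by simp

theorem ofMultiset_singleton (x : LoopSet C ⊕ IdealInter I₀ I₁) :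
    ofMultiset I₀ I₁ (Multiplicative.ofAdd {x}) = generator x :=
  (congrArg Multiset.prod (Multiset.map_singleton _ _)).trans (Multiset.prod_singleton _)

/-- The number of components that contribute a given generator. -/
noncomputable def Hom.mult (f : End (𝟙_ (BrauerCat I₀ I₁))) : LoopSet C ⊕ IdealInter I₀ I₁ → ℕ :=
  Quot.lift Diagram.mult (fun _ _ h => h.mult_eq) f

theorem Hom.mult_mul (f g : End (𝟙_ (BrauerCat I₀ I₁))) (x : LoopSet C ⊕ IdealInter I₀ I₁) :
    Hom.mult (f * g) x = Hom.mult f x + Hom.mult g x := by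
  obtain ⟨D⟩ := f
  obtain ⟨D'⟩ := g
  -- In `End`, the product `f * g` is `g ≫ f`; hence the reversed order.
  exact (mult_glue D' D x).trans (add_comm _ _)

open Classical in
theorem Hom.mult_generator (x y : LoopSet C ⊕ IdealInter I₀ I₁) :
    Hom.mult (generator x) y = Multiset.count y {x} := by
  obtain ⟨X, β⟩ | i := x
  · exact mult_eq_count_singleton () (fun _ => rfl) (hasValue_circle_iff β) y
  · exact mult_eq_count_singleton () (fun _ => rfl) (hasValue_interval_iff i) y

open Classical in
theorem Hom.mult_prod (m : Multiset (LoopSet C ⊕ IdealInter I₀ I₁))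
    (y : LoopSet C ⊕ IdealInter I₀ I₁) : Hom.mult (m.map generator).prod y = m.count y := by
  induction m using Multiset.induction with
  | empty =>
    rw [Multiset.map_zero, Multiset.prod_zero, Multiset.count_zero]
    exact mult_ident_nil y
  | cons x m ih =>
    rw [Multiset.map_cons, Multiset.prod_cons, Hom.mult_mul, Hom.mult_generator, ih,
      ← Multiset.singleton_add, Multiset.count_add]

/-- The multiplicity of each generator can be read off from the product. -/
theorem ofMultiset_injective (I₀ : LeftIdeal C) (I₁ : RightIdeal C) :
    Function.Injective (ofMultiset I₀ I₁) := by
  classical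
  intro m m' h
  exact Multiset.ext.2 fun y => (Hom.mult_prod m.toAdd y).symm.trans
    ((congrFun (congrArg Hom.mult h) y).trans (Hom.mult_prod m'.toAdd y))

/-- Induction on the number of edges. If two different edges are consecutive, a vertex is erased;
otherwise one edge is split off as a component, which is a generator. -/
theorem ofClosed_mem_mrange (D : Diagram I₀ I₁ [] []) :
    ofClosed D ∈ MonoidHom.mrange (ofMultiset I₀ I₁) := by
  generalize hn : Nat.card D.E = n
  induction n using Nat.strong_induction_on generalizing D with
  | _ n ih =>
  have := D.finite_E
  by_cases hmerge : ∃ e g, e ≠ g ∧ D.tgt e = D.src g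
  · obtain ⟨e, g, hne, heg⟩ := hmerge
    obtain ⟨v, hv⟩ := D.exists_src_eq g
    obtain ⟨D', j, k, e', h⟩ := D.exists_isErase (heg.trans hv) hv hne
    have hlt : Nat.card D'.E < Nat.card D.E :=
      D.card_lt_of_injective k h.k_inj h.k_ne
    have hs : ofClosed D = ofClosed D' :=
      (erase_iff.2 ⟨_, _, _, _, _, _, h⟩).sim
    rw [hs]
    exact ih _ (hn ▸ hlt) D' rfl
  -- An edge can now be followed only by itself, so each single edge forms a component.
  · have hadj : ∀ e g, D.tgt e = D.src g → e = g := fun e g h => by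
      by_contra hne
      exact hmerge ⟨e, g, hne, h⟩
    rcases isEmpty_or_nonempty D.E with hE | ⟨⟨e₀⟩⟩
    · have hs : ofClosed D = 1 := D.iso_ident_nil.sim
      rw [hs]
      exact one_mem _
    · have hP : ∀ e g, D.tgt e = D.src g → (e = e₀ ↔ g = e₀) := fun e g h => by rw [hadj e g h]
      have hs : ofClosed D =
          ofClosed (D.restrict (fun e => ¬e = e₀) fun e g h => not_congr (hP e g h)) *
            ofClosed (D.restrict (fun e => e = e₀) hP) := (glue_restrict_iso D _ hP).sim.symm
      rw [hs]
      refine mul_mem (ih _ ?_ _ rfl) ?_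
      · rw [← hn]
        exact Finite.card_subtype_lt (x := e₀) fun h => h rfl
      · obtain ⟨X, β, h⟩ | ⟨i, h⟩ := iso_of_unique (D.restrict (fun e => e = e₀) hP) ⟨e₀, rfl⟩
          fun e => Subtype.ext e.2
        · exact ⟨_, (ofMultiset_singleton (Sum.inl (Quot.mk _ ⟨X, β⟩))).trans h.sim⟩
        · exact ⟨_, (ofMultiset_singleton (Sum.inr i)).trans h.sim⟩

theorem ofMultiset_bijective (I₀ : LeftIdeal C) (I₁ : RightIdeal C) :
    Function.Bijective (ofMultiset I₀ I₁) :=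
  ⟨ofMultiset_injective I₀ I₁, Quot.ind ofClosed_mem_mrange⟩

/-- The endomorphisms of the unit object are the free commutative monoid on the generators. -/
noncomputable def endUnitEquiv (I₀ : LeftIdeal C) (I₁ : RightIdeal C) :
    End (𝟙_ (BrauerCat I₀ I₁)) ≃* Multiplicative (Multiset (LoopSet C ⊕ IdealInter I₀ I₁)) :=
  (MulEquiv.ofBijective (ofMultiset I₀ I₁) (ofMultiset_bijective I₀ I₁)).symm

theorem endUnitEquiv_generator (x : LoopSet C ⊕ IdealInter I₀ I₁) :
    endUnitEquiv I₀ I₁ (generator x) = Multiplicative.ofAdd {x} :=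
  (MulEquiv.symm_apply_eq (MulEquiv.ofBijective (ofMultiset I₀ I₁) (ofMultiset_bijective I₀ I₁))).2
    (ofMultiset_singleton x).symm

end BrauerCat
theorem mainTheorem11 {C : Type u} [Category.{v} C] (I₀ : LeftIdeal C) (I₁ : RightIdeal C) :
    ∃ (hc : BrauerCat.IsCategory I₀ I₁) (hm : BrauerCat.IsMonoidal hc),
      letI : Category (BrauerCat I₀ I₁) := BrauerCat.category hc
      letI : MonoidalCategory (BrauerCat I₀ I₁) := BrauerCat.monoidal hc hm
      -- strict
      IsStrictMonoidal (BrauerCat I₀ I₁) ∧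
      -- symmetric
      (∃ _ : SymmetricCategory (BrauerCat I₀ I₁), ∀ X Y : BrauerCat I₀ I₁,
        (β_ X Y).hom = BrauerCat.Hom.mk (BrauerCat.Diagram.swap X Y)) ∧
      -- rigid
      Nonempty (RigidCategory (BrauerCat I₀ I₁)) ∧
      (∀ X : BrauerCat I₀ I₁, ∃ P : ExactPairing X X.dual,
        P.coevaluation' = BrauerCat.Hom.mk (BrauerCat.Diagram.cup X) ∧
        P.evaluation' = BrauerCat.Hom.mk (BrauerCat.Diagram.cap X)) ∧
      -- contains `C` as a subcategory, through `X ↦ X⁺` and `β ↦ β₊`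
      (∃ ι : C ⥤ BrauerCat I₀ I₁,
        ι.toPrefunctor = ⟨BrauerCat.plus I₀ I₁,
          fun β => BrauerCat.Hom.mk (BrauerCat.Diagram.strand β)⟩ ∧
        Function.Injective ι.obj ∧ ι.Faithful) ∧
      -- the endomorphisms of the unit object are the free commutative monoid
      (∃ φ : End (𝟙_ (BrauerCat I₀ I₁)) ≃*
          Multiplicative (Multiset (LoopSet C ⊕ IdealInter I₀ I₁)),
        (∀ (X : C) (β : X ⟶ X), φ (BrauerCat.Hom.mk (BrauerCat.Diagram.circle β)) =
          Multiplicative.ofAdd {Sum.inl (Quot.mk _ ⟨X, β⟩)}) ∧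
        (∀ f : IdealInter I₀ I₁,
          φ (BrauerCat.Hom.mk (BrauerCat.Diagram.interval f)) =
            Multiplicative.ofAdd {Sum.inr f})) := by
  refine ⟨BrauerCat.isCategory I₀ I₁, BrauerCat.isMonoidal I₀ I₁, BrauerCat.isStrictMonoidal I₀ I₁,
    ⟨BrauerCat.symmetricCategory, fun X Y => rfl⟩, BrauerCat.nonempty_rigidCategory I₀ I₁,
    fun X => ⟨BrauerCat.exactPairing X, rfl, rfl⟩,
    ⟨BrauerCat.strandFunctor I₀ I₁, rfl, BrauerCat.strandFunctor_obj_injective I₀ I₁,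
      inferInstance⟩,
    BrauerCat.endUnitEquiv I₀ I₁,
    fun X β => BrauerCat.endUnitEquiv_generator (Sum.inl (Quot.mk _ ⟨X, β⟩)),
    fun f => BrauerCat.endUnitEquiv_generator (Sum.inr f)⟩
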